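/- Let $N$ be a simply connected Lie group with Lie algebra $\mathfrak n$ and center $Z$, and suppose that $N$ is 2-step nilpotent in the sense that $[\mathfrak n,\mathfrak n]\subseteq\mathfrak z$, where $\mathfrak z$ is the center of $\mathfrak n$. Let $\langle\,,\rangle$ be a nondegenerate symmetric bilinear form on $\mathfrak n$ (of any signature), and also denote by $\langle\,,\rangle$ the left-invariant pseudoriemannian metric tensor on $N$ that it determines. Let $\mathfrak U=\mathfrak z\cap\mathfrak z^\perp$, and fix a totally null subspace $\mathfrak V\subseteq\mathfrak n$ that is dually paired with $\mathfrak U$ by $\langle\,,\rangle$. Put $\mathfrak Z=\mathfrak z\cap\mathfrak U^\perp\cap\mathfrak V^\perp$, let $\mathfrak E$ be the orthocomplement of $\mathfrak Z$ in $\mathfrak U^\perp\cap\mathfrak V^\perp$, and put $\mathfrak v=\mathfrak V\oplus\mathfrak E$, so that $\mathfrak n=\mathfrak z\oplus\mathfrak v$. Let $\Gamma$ be a lattice in $N$, that is, a discrete subgroup such that $\Gamma\backslash N$ is compact. Give $\Gamma\backslash N$ the metric tensor for which the projection $N\to\Gamma\backslash N$ is a local isometry, and the splitting $T(\Gamma\backslash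 N)=\mathfrak z(\Gamma\backslash N)\oplus\mathfrak v(\Gamma\backslash N)$ induced by the left-invariant splitting of $TN$ determined by $\mathfrak n=\mathfrak z\oplus\mathfrak v$. Let $I^{spl}(\Gamma\backslash N)$ be the group of all smooth isometries of $\Gamma\backslash N$ whose differentials map each of the two summands of this splitting onto itself, with the compact-open topology, and let $I^{spl}_0(\Gamma\backslash N)$ be its identity component. Let $m=\dim\mathfrak z$. Then $(\Gamma\cap Z)\backslash Z$ is an $m$-dimensional torus, $I^{spl}_0(\Gamma\backslash N)$ is, with its topology, a Lie group acting smoothly on $\Gamma\backslash N$, and $$F:(\Gamma\cap Z)\backslash Z\to I^{spl}_0(\Gamma\backslash N),\qquad F\big((\Gamma\cap Z)z\big)(\Gamma n)=\Gamma zn\quad(z\in Z,\ n\in N),$$ is well defined and is an isomorphism of Lie groups (a group isomorphism that is smooth with smooth inverse). Moreover, $I^{spl}_0(\Gamma\backslash N)$ acts freely on $\Gamma\backslash N$, and its orbits are embedded submanifolds that are geodesically complete, flat and totally geodesic. Here, since the metric may be degenerate on an orbit $P$, these notions refer to the Levi-Civita connection $\nabla$ and the curvature tensor $R(X,Y)W=\nabla_X\nabla_YW-\nabla_Y\nabla_XW-\nabla_{[X,Y]}W$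 of $\Gamma\backslash N$: $P$ is totally geodesic if $\nabla_XY$ is tangent to $P$ along $P$ whenever the smooth vector fields $X,Y$ are; $P$ is flat if $\langle R(x,y)y,x\rangle=0$ for all $p\in P$ and $x,y\in T_pP$; and $P$ is complete if every vector tangent to $P$ is the initial velocity of a geodesic of $\Gamma\backslash N$ that is defined on all of $\mathbb R$ and stays in $P$. -/

import Mathlib

open scoped Manifold ContDiff Topology
open Bundle

set_option linter.unusedSectionVars false

namespace PseudoNil

noncomputable section

section General

variable {d : ℕ} {M : Type*} [TopologicalSpace M] [ChartedSpace (EuclideanSpace ℝ (Fin d)) M]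

variable (d M) in
/-- A field of bilinear forms on the tangent spaces of a `d`-dimensional manifold. -/
abbrev MetricTensor : Type _ :=
  ∀ x : M, TangentSpace (𝓡 d) x →ₗ[ℝ] TangentSpace (𝓡 d) x →ₗ[ℝ] ℝ

variable (d M) in
/-- A field of linear subspaces of the tangent spaces. -/
abbrev Distribution : Type _ := ∀ x : M, Submodule ℝ (TangentSpace (𝓡 d) x)

/-- `ψ` is a smooth diffeomorphism, preserves the metric tensor `g` and maps each of the two
distributions `D₁`, `D₂` onto itself. -/
structure IsSplitIsometry (g : MetricTensor d M) (D₁ D₂ : Distribution d M) (ψ : M ≃ₜ M) :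
    Prop where
  smooth : ContMDiff (𝓡 d) (𝓡 d) ∞ ψ
  smooth_symm : ContMDiff (𝓡 d) (𝓡 d) ∞ ψ.symm
  metric : ∀ (x : M) (u w : TangentSpace (𝓡 d) x),
    g (ψ x) (mfderiv (𝓡 d) (𝓡 d) ψ x u) (mfderiv (𝓡 d) (𝓡 d) ψ x w) = g x u w
  map_fst : ∀ x : M, (D₁ x).map (mfderiv (𝓡 d) (𝓡 d) ψ x).toLinearMap = D₁ (ψ x)
  map_snd : ∀ x : M, (D₂ x).map (mfderiv (𝓡 d) (𝓡 d) ψ x).toLinearMap = D₂ (ψ x)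

theorem IsSplitIsometry.one (g : MetricTensor d M) (D₁ D₂ : Distribution d M) :
    IsSplitIsometry g D₁ D₂ 1 where
  smooth := contMDiff_id
  smooth_symm := contMDiff_id
  metric x u w := by
    change g x (mfderiv (𝓡 d) (𝓡 d) id x u) (mfderiv (𝓡 d) (𝓡 d) id x w) = g x u w
    rw [mfderiv_id]; rfl
  map_fst x := by
    change (D₁ x).map (mfderiv (𝓡 d) (𝓡 d) id x).toLinearMap = D₁ x
    rw [mfderiv_id]; exact Submodule.map_id _
  map_snd x := by
    change (D₂ x).map (mfderiv (𝓡 d) (𝓡 d) id x).toLinearMap = D₂ x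
    rw [mfderiv_id]; exact Submodule.map_id _

theorem mfderiv_homeo_mul {φ ψ : M ≃ₜ M} (hφ : ContMDiff (𝓡 d) (𝓡 d) ∞ φ)
    (hψ : ContMDiff (𝓡 d) (𝓡 d) ∞ ψ) (x : M) :
    mfderiv (𝓡 d) (𝓡 d) (φ * ψ : M ≃ₜ M) x =
      (mfderiv (𝓡 d) (𝓡 d) φ (ψ x)).comp (mfderiv (𝓡 d) (𝓡 d) ψ x) :=
  mfderiv_comp x (hφ.mdifferentiableAt (by simp)) (hψ.mdifferentiableAt (by simp))

theorem IsSplitIsometry.mul {g : MetricTensor d M} {D₁ D₂ : Distribution d M} {φ ψ : M ≃ₜ M}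
    (hφ : IsSplitIsometry g D₁ D₂ φ) (hψ : IsSplitIsometry g D₁ D₂ ψ) :
    IsSplitIsometry g D₁ D₂ (φ * ψ) where
  smooth := hφ.smooth.comp hψ.smooth
  smooth_symm := hψ.smooth_symm.comp hφ.smooth_symm
  metric x u w := by
    rw [mfderiv_homeo_mul hφ.smooth hψ.smooth]
    exact (hφ.metric (ψ x) _ _).trans (hψ.metric x u w)
  map_fst x := by
    rw [mfderiv_homeo_mul hφ.smooth hψ.smooth]
    refine (Submodule.map_comp _ _ _).trans ?_
    rw [hψ.map_fst x]; exact hφ.map_fst (ψ x)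
  map_snd x := by
    rw [mfderiv_homeo_mul hφ.smooth hψ.smooth]
    refine (Submodule.map_comp _ _ _).trans ?_
    rw [hψ.map_snd x]; exact hφ.map_snd (ψ x)

theorem IsSplitIsometry.inv {g : MetricTensor d M} {D₁ D₂ : Distribution d M} {ψ : M ≃ₜ M}
    (hψ : IsSplitIsometry g D₁ D₂ ψ) : IsSplitIsometry g D₁ D₂ ψ⁻¹ := by
  have hcomp : ∀ y : M, (mfderiv (𝓡 d) (𝓡 d) ψ.symm (ψ y)).comp (mfderiv (𝓡 d) (𝓡 d) ψ y) =
      ContinuousLinearMap.id ℝ (TangentSpace (𝓡 d) y) := fun y => by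
    refine (mfderiv_comp y (hψ.smooth_symm.mdifferentiableAt (by simp))
      (hψ.smooth.mdifferentiableAt (by simp))).symm.trans ?_
    rw [show (ψ.symm ∘ ψ : M → M) = id from funext fun z => ψ.symm_apply_apply z, mfderiv_id]
  have hcomp' : ∀ y : M, (mfderiv (𝓡 d) (𝓡 d) ψ y).comp (mfderiv (𝓡 d) (𝓡 d) ψ.symm (ψ y)) =
      ContinuousLinearMap.id ℝ (TangentSpace (𝓡 d) (ψ y)) := fun y => by
    have h := mfderiv_comp (ψ y) (I := 𝓡 d) (I' := 𝓡 d) (I'' := 𝓡 d) (g := ψ) (f := ψ.symm)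
      (hψ.smooth.mdifferentiableAt (by simp)) (hψ.smooth_symm.mdifferentiableAt (by simp))
    rw [show (ψ ∘ ψ.symm : M → M) = id from funext fun z => ψ.apply_symm_apply z, mfderiv_id,
      ψ.symm_apply_apply] at h
    exact h.symm
  have hg : ∀ a b : M, a = b → ∀ u w : EuclideanSpace ℝ (Fin d), g a u w = g b u w := by
    rintro a _ rfl u w; rfl
  have hD : ∀ (D : Distribution d M) (a b : M), a = b →
      (D a : Submodule ℝ (EuclideanSpace ℝ (Fin d))) = D b := by
    rintro D a _ rfl; rfl
  have hmap : ∀ D : Distribution d M,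
      (∀ x : M, (D x).map (mfderiv (𝓡 d) (𝓡 d) ψ x).toLinearMap = D (ψ x)) →
      ∀ y : M, (D (ψ y)).map (mfderiv (𝓡 d) (𝓡 d) ψ.symm (ψ y)).toLinearMap =
        D (ψ.symm (ψ y)) := fun D h y => by
    rw [← h y]
    refine (Submodule.map_comp _ _ _).symm.trans ?_
    refine Eq.trans ?_ (hD D _ _ (ψ.symm_apply_apply y)).symm
    have := congrArg (fun L => Submodule.map (ContinuousLinearMap.toLinearMap L) (D y)) (hcomp y)
    exact this.trans (Submodule.map_id _)
  refine ⟨hψ.smooth_symm, hψ.smooth, fun x u w => ?_, fun x => ?_, fun x => ?_⟩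
  · obtain ⟨y, rfl⟩ := ψ.surjective x
    refine (hg _ _ (ψ.symm_apply_apply y) _ _).trans ?_
    refine (hψ.metric y _ _).symm.trans ?_
    have h1 := fun v => congrArg (fun L => L v) (hcomp' y)
    exact congrArg₂ (fun a b => g (ψ y) a b) (h1 u) (h1 w)
  · obtain ⟨y, rfl⟩ := ψ.surjective x
    exact hmap D₁ hψ.map_fst y
  · obtain ⟨y, rfl⟩ := ψ.surjective x
    exact hmap D₂ hψ.map_snd y

/-- The group of all isometries of `g` that preserve the splitting `D₁ ⊕ D₂`. -/
def splitIsometryGroup (g : MetricTensor d M) (D₁ D₂ : Distribution d M) : Subgroup (M ≃ₜ M) where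
  carrier := {ψ | IsSplitIsometry g D₁ D₂ ψ}
  mul_mem' := IsSplitIsometry.mul
  one_mem' := IsSplitIsometry.one g D₁ D₂
  inv_mem' := IsSplitIsometry.inv

/-- The compact-open topology on the group of homeomorphisms. -/
instance homeomorphTopology {X : Type*} [TopologicalSpace X] : TopologicalSpace (X ≃ₜ X) :=
  TopologicalSpace.induced (fun ψ => (⟨ψ, ψ.continuous⟩ : C(X, X))) inferInstance

instance {X : Type*} [TopologicalSpace X] [CompactSpace X] [T2Space X] :
    IsTopologicalGroup (X ≃ₜ X) where
  continuous_mul := by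
    refine continuous_induced_rng.mpr ?_
    have h : Continuous (fun ψ : X ≃ₜ X => (⟨ψ, ψ.continuous⟩ : C(X, X))) :=
      continuous_induced_dom
    exact (h.comp continuous_fst).compCM (h.comp continuous_snd)
  continuous_inv := by
    refine continuous_induced_rng.mpr (ContinuousMap.continuous_compactOpen.mpr ?_)
    intro K hK U hU
    have h : Continuous (fun ψ : X ≃ₜ X => (⟨ψ, ψ.continuous⟩ : C(X, X))) :=
      continuous_induced_dom
    have h2 := ContinuousMap.continuous_compactOpen.mp h Uᶜ hU.isClosed_compl.isCompact Kᶜ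
      hK.isClosed.isOpen_compl
    convert h2 using 1
    ext ψ
    constructor
    · intro hm x hx hK'
      have : ψ.symm (ψ x) ∈ U := hm hK'
      rw [ψ.symm_apply_apply] at this
      exact hx this
    · intro hm x hx
      by_contra hU'
      have : ψ (ψ.symm x) ∈ Kᶜ := hm hU'
      rw [ψ.apply_symm_apply] at this
      exact this hx

/-- The velocity of a curve at time `t`, as a point of the tangent bundle. -/
def velocity (c : ℝ → M) (t : ℝ) : TangentBundle (𝓡 d) M :=
  ⟨c t, mfderiv 𝓘(ℝ, ℝ) (𝓡 d) c t (1 : ℝ)⟩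

/-- The vectors at `x` tangent to the subset `S`: velocities at `x` of smooth curves in `S`. -/
def tangentVectors (S : Set M) (x : M) : Set (TangentSpace (𝓡 d) x) :=
  {v | ∃ c : ℝ → M, ContMDiff 𝓘(ℝ, ℝ) (𝓡 d) ∞ c ∧ (∀ t, c t ∈ S) ∧
    velocity (d := d) c 0 = ⟨x, v⟩}

variable [IsManifold (𝓡 d) ∞ M]

variable (d M) in
/-- Connections (covariant derivatives) on the tangent bundle. -/
abbrev Connection : Type _ :=
  CovariantDerivative (𝓡 d) (EuclideanSpace ℝ (Fin d)) (TangentSpace (𝓡 d) : M → Type _)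

/-- `X` is a smooth vector field. -/
def IsSmoothField (X : ∀ x : M, TangentSpace (𝓡 d) x) : Prop :=
  ContMDiff (𝓡 d) (𝓡 d).tangent ∞ (fun x => (⟨x, X x⟩ : TangentBundle (𝓡 d) M))

/-- `nab` is the Levi-Civita connection of `g`: torsion free and compatible with `g`. -/
structure IsLeviCivita (g : MetricTensor d M) (nab : Connection d M) : Prop where
  torsion : nab.torsion = 0
  metric : ∀ (X Y : ∀ x : M, TangentSpace (𝓡 d) x), IsSmoothField X → IsSmoothField Y →
    ∀ (x : M) (v : TangentSpace (𝓡 d) x),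
      mfderiv (𝓡 d) 𝓘(ℝ, ℝ) (fun y => g y (X y) (Y y)) x v =
        g x (nab X x v) (Y x) + g x (X x) (nab Y x v)

/-- The curvature operator `R(X, Y) W = ∇_X ∇_Y W - ∇_Y ∇_X W - ∇_[X, Y] W`
(in Mathlib's convention, `nab W x v` is `∇_v W`). -/
def curvature (nab : Connection d M) (X Y W : ∀ x : M, TangentSpace (𝓡 d) x) (x : M) :
    TangentSpace (𝓡 d) x :=
  nab (fun y => nab W y (Y y)) x (X x) - nab (fun y => nab W y (X y)) x (Y x)
    - nab W x (VectorField.mlieBracket (𝓡 d) X Y x)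

/-- `w` is the covariant derivative at time `t` of the vector field `V` along the curve `c`. It is
computed by writing `V = ∑ i, f i • X i ∘ c` near `t` with vector fields `X i` of `M`:
then `w = ∑ i, (f i)' (t) • X i (c t) + f i t • ∇_{c'(t)} (X i)`. -/
def HasCovDerivAlong (nab : Connection d M) (c : ℝ → M) (V : ∀ t : ℝ, TangentSpace (𝓡 d) (c t))
    (t : ℝ) (w : TangentSpace (𝓡 d) (c t)) : Prop :=
  ∃ (k : ℕ) (X : Fin k → ∀ x : M, TangentSpace (𝓡 d) x) (f : Fin k → ℝ → ℝ),
    (∀ i, IsSmoothField (X i)) ∧ (∀ i, DifferentiableAt ℝ (f i) t) ∧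
    (∀ᶠ s in 𝓝 t, V s = ∑ i, f i s • X i (c s)) ∧
    w = ∑ i, (deriv (f i) t • X i (c t) + f i t • nab (X i) (c t) (velocity c t).2)

/-- `c : ℝ → M` is a (complete) geodesic: `∇_{c'} c' = 0` at all times. -/
def IsGeodesic (nab : Connection d M) (c : ℝ → M) : Prop :=
  ContMDiff 𝓘(ℝ, ℝ) (𝓡 d) ∞ c ∧
    ∀ t, HasCovDerivAlong nab c (fun s => (velocity c s).2) t 0

/-- A submanifold `S`, on which the metric may be degenerate, is totally geodesic:
`∇_X Y` is tangent to `S` whenever `X` and `Y` are. -/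
def IsTotallyGeodesic (nab : Connection d M) (S : Set M) : Prop :=
  ∀ X Y : ∀ x : M, TangentSpace (𝓡 d) x, IsSmoothField X → IsSmoothField Y →
    (∀ x ∈ S, X x ∈ tangentVectors S x) → (∀ x ∈ S, Y x ∈ tangentVectors S x) →
    ∀ x ∈ S, nab Y x (X x) ∈ tangentVectors S x

/-- A submanifold `S`, on which the metric may be degenerate, is flat: all planes tangent to `S`
are homaloidal, that is `⟨R(X, Y) Y, X⟩ = 0` for `X`, `Y` tangent to `S`. -/
def IsFlat (g : MetricTensor d M) (nab : Connection d M) (S : Set M) : Prop :=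
  ∀ x ∈ S, ∀ X Y : ∀ x : M, TangentSpace (𝓡 d) x, IsSmoothField X → IsSmoothField Y →
    X x ∈ tangentVectors S x → Y x ∈ tangentVectors S x →
    g x (curvature nab X Y Y x) (X x) = 0

/-- A totally geodesic submanifold `S` is geodesically complete: for every initial vector tangent
to `S` there is a geodesic defined for all times, and it stays in `S`. -/
def IsGeodesicallyComplete (nab : Connection d M) (S : Set M) : Prop :=
  ∀ x ∈ S, ∀ v ∈ tangentVectors (d := d) S x, ∃ c : ℝ → M,
    IsGeodesic nab c ∧ velocity (d := d) c 0 = ⟨x, v⟩ ∧ ∀ t, c t ∈ S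

end General

section LieGroup

variable {d : ℕ} {N : Type*} [Group N] [TopologicalSpace N]
  [ChartedSpace (EuclideanSpace ℝ (Fin d)) N] [LieGroup (𝓡 d) ∞ N]

instance : LieGroup (𝓡 d) (minSmoothness ℝ 3) N := by
  rw [minSmoothness_of_isRCLikeNormedField]; infer_instance

variable (d N) in
/-- The center of the Lie algebra of `N`. -/
def lieCenter : Submodule ℝ (GroupLieAlgebra (𝓡 d) N) :=
  (LieAlgebra.center ℝ (GroupLieAlgebra (𝓡 d) N)).toSubmodule

/-- The null part `𝔲 = 𝔷 ∩ 𝔷^⊥` of the center. -/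
def nullU (B : LinearMap.BilinForm ℝ (GroupLieAlgebra (𝓡 d) N)) :
    Submodule ℝ (GroupLieAlgebra (𝓡 d) N) :=
  lieCenter d N ⊓ B.orthogonal (lieCenter d N)

/-- `V` is a null subspace complementary to the null part `𝔲` of the center: it is totally null and
the inner product gives a perfect pairing between `𝔲` and `V`. -/
structure IsNullComplement (B : LinearMap.BilinForm ℝ (GroupLieAlgebra (𝓡 d) N))
    (V : Submodule ℝ (GroupLieAlgebra (𝓡 d) N)) : Prop where
  null : V ≤ B.orthogonal V
  disjoint_left : Disjoint (nullU B) (B.orthogonal V)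
  disjoint_right : Disjoint V (B.orthogonal (nullU B))

/-- The part of the center in `𝔲^⊥ ∩ V^⊥`. -/
def partZ (B : LinearMap.BilinForm ℝ (GroupLieAlgebra (𝓡 d) N))
    (V : Submodule ℝ (GroupLieAlgebra (𝓡 d) N)) : Submodule ℝ (GroupLieAlgebra (𝓡 d) N) :=
  lieCenter d N ⊓ (B.orthogonal (nullU B) ⊓ B.orthogonal V)

/-- The orthocomplement of `partZ` in `𝔲^⊥ ∩ V^⊥`. -/
def partE (B : LinearMap.BilinForm ℝ (GroupLieAlgebra (𝓡 d) N))
    (V : Submodule ℝ (GroupLieAlgebra (𝓡 d) N)) : Submodule ℝ (GroupLieAlgebra (𝓡 d) N) :=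
  (B.orthogonal (nullU B) ⊓ B.orthogonal V) ⊓ B.orthogonal (partZ B V)

/-- The complement `𝔳 = V ⊕ 𝔢` of the center. -/
def subspaceV (B : LinearMap.BilinForm ℝ (GroupLieAlgebra (𝓡 d) N))
    (V : Submodule ℝ (GroupLieAlgebra (𝓡 d) N)) : Submodule ℝ (GroupLieAlgebra (𝓡 d) N) :=
  V ⊔ partE B V

end LieGroup

section Quotient

/-- The quotient `Γ\N` of `N` by the left action of the subgroup `Γ`. -/
abbrev LeftQuotient {N : Type*} [Group N] (Γ : Subgroup N) : Type _ :=
  MulAction.orbitRel.Quotient Γ N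

/-- The natural projection `N → Γ\N`. -/
def LeftQuotient.mk {N : Type*} [Group N] (Γ : Subgroup N) (n : N) : LeftQuotient Γ :=
  Quotient.mk (MulAction.orbitRel Γ N) n

variable {d : ℕ} {N : Type*} [Group N] [TopologicalSpace N] [IsTopologicalGroup N] [T2Space N]
  [LocallyCompactSpace N] [ChartedSpace (EuclideanSpace ℝ (Fin d)) N] [LieGroup (𝓡 d) ∞ N]

instance (Γ : Subgroup N) [DiscreteTopology Γ] : ProperlyDiscontinuousSMul Γ N :=
  Γ.properlyDiscontinuousSMul_of_tendsto_cofinite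
    (Γ.tendsto_coe_cofinite_of_discrete (isDiscrete_iff_discreteTopology.mpr inferInstance))

variable (Γ : Subgroup N) [DiscreteTopology Γ]

theorem isCov : IsQuotientCoveringMap (LeftQuotient.mk Γ) Γ :=
  isQuotientCoveringMap_quotientMk_of_properlyDiscontinuousSMul

instance : T2Space (LeftQuotient Γ) := inferInstanceAs (T2Space (Quotient (MulAction.orbitRel Γ N)))

theorem isLH : IsLocalHomeomorph (LeftQuotient.mk Γ) := (isCov Γ).isCoveringMap.isLocalHomeomorph

/-- Charts of `Γ\N` are charts of `N` composed with local inverses of the projection. -/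
theorem chart_eq (e : OpenPartialHomeomorph (LeftQuotient Γ) (EuclideanSpace ℝ (Fin d)))
  (he : e ∈ atlas (EuclideanSpace ℝ (Fin d)) (LeftQuotient Γ)) : ∃ n : N, e = ((isLH Γ).localInverseAt n).trans (chartAt _ n) := by
  obtain ⟨q, rfl⟩ := he
  exact ⟨_, rfl⟩

theorem localInv_mul (a n : N) (h : LeftQuotient.mk Γ n ∈ ((isLH Γ).localInverseAt a).source) :
    ∃ γ : Γ, ∀ᶠ x in 𝓝 n, (isLH Γ).localInverseAt a (LeftQuotient.mk Γ x) = (γ : N) * x := by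
  set s := (isLH Γ).localInverseAt a with hs
  have h1 : LeftQuotient.mk Γ (s (LeftQuotient.mk Γ n)) = LeftQuotient.mk Γ n :=
    (isLH Γ).apply_localInverseAt_of_mem h
  obtain ⟨γ, hγ⟩ := (isCov Γ).apply_eq_iff_mem_orbit.mp h1
  refine ⟨γ, ?_⟩
  have hγ' : (γ : N) * n = s (LeftQuotient.mk Γ n) := hγ
  have hc : Continuous (LeftQuotient.mk Γ) := (isLH Γ).continuous
  have h2 : ∀ᶠ x in 𝓝 n, LeftQuotient.mk Γ x ∈ s.source :=
    hc.continuousAt.eventually (s.open_source.mem_nhds h)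
  have h3 : ∀ᶠ x in 𝓝 n, (γ : N) * x ∈ s.target := by
    have : ContinuousAt (fun x : N => (γ : N) * x) n := by fun_prop
    refine this.eventually (s.open_target.mem_nhds ?_)
    change (γ : N) * n ∈ s.target
    rw [hγ']; exact s.map_source h
  filter_upwards [h2, h3] with x hx hx'
  refine (isLH Γ).injOn_localInverseAt_target (x := a) (s.map_source hx) hx' ?_
  rw [(isLH Γ).apply_localInverseAt_of_mem hx]
  exact ((isCov Γ).map_smul γ (e := x)).symm


instance : IsManifold (𝓡 d) ∞ (LeftQuotient Γ) := by
  refine isManifold_of_contDiffOn _ _ _ fun e e' he he' => ?_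
  obtain ⟨a, rfl⟩ := chart_eq Γ e he
  obtain ⟨b, rfl⟩ := chart_eq Γ e' he'
  intro y hy
  simp only [mfld_simps] at hy
  obtain ⟨⟨hy1, hy2⟩, hy3, hy4⟩ := hy
  rw [IsLocalHomeomorph.localInverseAt_symm] at hy3 hy4
  obtain ⟨γ, hγ⟩ := localInv_mul Γ b _ hy3
  set c := chartAt (EuclideanSpace ℝ (Fin d)) a with hc
  set c' := chartAt (EuclideanSpace ℝ (Fin d)) b with hc'
  have hγ0 := hγ.self_of_nhds
  have hy5 : (γ : N) * c.symm y ∈ c'.source := by rw [← hγ0]; exact hy4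
  have h1 : ContMDiffAt (𝓡 d) (𝓡 d) ∞ c.symm y :=
    (contMDiffOn_chart_symm (I := 𝓡 d) (x := a)).contMDiffAt (c.open_target.mem_nhds hy1)
  have h2 : ContMDiffAt (𝓡 d) (𝓡 d) ∞ (fun x : N => (γ : N) * x) (c.symm y) :=
    contMDiff_mul_left.contMDiffAt
  have h3 : ContMDiffAt (𝓡 d) (𝓡 d) ∞ c' ((γ : N) * c.symm y) :=
    (contMDiffOn_chart (I := 𝓡 d) (x := b)).contMDiffAt (c'.open_source.mem_nhds hy5)
  have h4 : ContDiffAt ℝ ∞ (fun z => c' ((γ : N) * c.symm z)) y :=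
    contMDiffAt_iff_contDiffAt.mp (h3.comp y (h2.comp y h1))
  refine (h4.congr_of_eventuallyEq ?_).contDiffWithinAt
  filter_upwards [h1.continuousAt.eventually hγ] with z hz
  simp only [mfld_simps, IsLocalHomeomorph.localInverseAt_symm]
  exact congrArg c' hz

theorem mk_contMDiff : ContMDiff (𝓡 d) (𝓡 d) ∞ (LeftQuotient.mk Γ : N → LeftQuotient Γ) := by
  intro n
  set e := chartAt (EuclideanSpace ℝ (Fin d)) (LeftQuotient.mk Γ n) with he
  obtain ⟨b, hb⟩ := chart_eq Γ e (chart_mem_atlas _ _)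
  have hn : LeftQuotient.mk Γ n ∈ e.source := mem_chart_source _ _
  rw [contMDiffAt_iff_target_of_mem_source (y := LeftQuotient.mk Γ n) hn]
  refine ⟨(isLH Γ).continuous.continuousAt, ?_⟩
  have hn' := hn
  rw [hb] at hn'
  simp only [mfld_simps] at hn'
  obtain ⟨γ, hγ⟩ := localInv_mul Γ b _ hn'.1
  have hγ0 := hγ.self_of_nhds
  set c' := chartAt (EuclideanSpace ℝ (Fin d)) b with hc'
  have hy5 : (γ : N) * n ∈ c'.source := by rw [← hγ0]; exact hn'.2
  have h2 : ContMDiffAt (𝓡 d) (𝓡 d) ∞ (fun x : N => (γ : N) * x) n :=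
    contMDiff_mul_left.contMDiffAt
  have h3 : ContMDiffAt (𝓡 d) (𝓡 d) ∞ c' ((γ : N) * n) :=
    (contMDiffOn_chart (I := 𝓡 d) (x := b)).contMDiffAt (c'.open_source.mem_nhds hy5)
  refine (h3.comp n h2).congr_of_eventuallyEq ?_
  filter_upwards [hγ] with z hz
  simp only [mfld_simps, ← he, hb]
  exact congrArg c' hz

theorem mk_localInverse (n : N) : ∃ s : LeftQuotient Γ → N,
    ContMDiffAt (𝓡 d) (𝓡 d) ∞ s (LeftQuotient.mk Γ n) ∧ s (LeftQuotient.mk Γ n) = n ∧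
    (∀ᶠ x in 𝓝 n, s (LeftQuotient.mk Γ x) = x) ∧
    ∀ᶠ q in 𝓝 (LeftQuotient.mk Γ n), LeftQuotient.mk Γ (s q) = q := by
  set e := chartAt (EuclideanSpace ℝ (Fin d)) (LeftQuotient.mk Γ n) with he
  obtain ⟨b, hb⟩ := chart_eq Γ e (chart_mem_atlas _ _)
  have hn : LeftQuotient.mk Γ n ∈ e.source := mem_chart_source _ _
  have hn' := hn
  rw [hb] at hn'
  simp only [mfld_simps] at hn'
  obtain ⟨γ, hγ⟩ := localInv_mul Γ b _ hn'.1
  have hγ0 := hγ.self_of_nhds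
  set c' := chartAt (EuclideanSpace ℝ (Fin d)) b with hc'
  set s := (isLH Γ).localInverseAt b with hs
  have key : ContMDiffAt (𝓡 d) (𝓡 d) ∞ s (LeftQuotient.mk Γ n) := by
    have h1 : ContMDiffAt (𝓡 d) (𝓡 d) ∞ e (LeftQuotient.mk Γ n) :=
      (contMDiffOn_chart (I := 𝓡 d)).contMDiffAt (e.open_source.mem_nhds hn)
    have h2 : ContMDiffAt (𝓡 d) (𝓡 d) ∞ c'.symm (e (LeftQuotient.mk Γ n)) := by
      refine (contMDiffOn_chart_symm (I := 𝓡 d) (x := b)).contMDiffAt (c'.open_target.mem_nhds ?_)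
      rw [hb]
      exact c'.map_source hn'.2
    refine (h2.comp _ h1).congr_of_eventuallyEq ?_
    filter_upwards [e.open_source.mem_nhds hn] with q hq
    rw [hb] at hq
    simp only [mfld_simps] at hq
    rw [hb]
    exact (c'.left_inv hq.2).symm
  refine ⟨fun q => (γ : N)⁻¹ * s q, ?_, ?_, ?_, ?_⟩
  · exact (contMDiff_mul_left (I := 𝓡 d) (n := ∞) (a := (γ : N)⁻¹)).contMDiffAt.comp _ key
  · simp [hγ0]
  · filter_upwards [hγ] with x hx
    simp [hx]
  · filter_upwards [s.open_source.mem_nhds hn'.1] with q hq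
    have h5 : LeftQuotient.mk Γ ((γ⁻¹ : Γ) • s q) = LeftQuotient.mk Γ (s q) :=
      (isCov Γ).map_smul γ⁻¹
    exact h5.trans ((isLH Γ).apply_localInverseAt_of_mem hq)

namespace LeftQuotient

/-- The linear map `𝔫 → T_{p(n)}(Γ\N)` that sends `v` to the image under `dp` of the left-invariant
vector field of `v` at `n`, where `p : N → Γ\N` is the projection. -/
def frameAt (n : N) : GroupLieAlgebra (𝓡 d) N →L[ℝ] TangentSpace (𝓡 d) (mk Γ n) :=
  mfderiv (𝓡 d) (𝓡 d) (fun h : N => mk Γ (n * h)) 1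

theorem frameAt_apply (n : N) (v : GroupLieAlgebra (𝓡 d) N) :
    frameAt Γ n v = mfderiv (𝓡 d) (𝓡 d) (mk Γ) n (mulInvariantVectorField v n) := by
  have h1 : MDifferentiableAt (𝓡 d) (𝓡 d) (mk Γ : N → LeftQuotient Γ) (n * 1) :=
    (mk_contMDiff Γ).mdifferentiableAt (by simp)
  have h2 : MDifferentiableAt (𝓡 d) (𝓡 d) (fun h : N => n * h) 1 :=
    (contMDiff_mul_left (I := 𝓡 d) (n := ∞) (a := n)).mdifferentiableAt (by simp)
  have h3 := mfderiv_comp (1 : N) h1 h2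
  have h4 : ∀ m : N, m = n → ∀ u : EuclideanSpace ℝ (Fin d),
      (mfderiv (𝓡 d) (𝓡 d) (mk Γ) m u : EuclideanSpace ℝ (Fin d)) =
        mfderiv (𝓡 d) (𝓡 d) (mk Γ) n u := by rintro m rfl u; rfl
  exact (congrArg (fun L => L v) h3).trans (h4 _ (mul_one n) _)

/-- The frame at a point of `Γ\N` only depends on the point, not on the representative. -/
theorem frameAt_smul (γ : Γ) (n : N) (v : GroupLieAlgebra (𝓡 d) N) :
    (frameAt Γ ((γ : N) * n) v : EuclideanSpace ℝ (Fin d)) = frameAt Γ n v := by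
  have : (fun h : N => mk Γ ((γ : N) * n * h)) = fun h : N => mk Γ (n * h) := by
    funext h
    rw [mul_assoc]
    exact (isCov Γ).map_smul γ
  unfold frameAt
  rw [this]
  rfl

/-- The frame `𝔫 → T_x(Γ\N)` of left-invariant vector fields at a point `x`. -/
def frame (x : LeftQuotient Γ) : GroupLieAlgebra (𝓡 d) N →L[ℝ] TangentSpace (𝓡 d) x :=
  frameAt Γ (Quotient.out x)

theorem frameAt_inverse (n : N) :
    ∃ L : EuclideanSpace ℝ (Fin d) →L[ℝ] EuclideanSpace ℝ (Fin d),
      (∀ v, L (frameAt Γ n v) = v) ∧ ∀ w, frameAt Γ n (L w) = w := by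
  obtain ⟨s, hs, hsn, hl, hr⟩ := mk_localInverse (d := d) Γ n
  set P : N → LeftQuotient Γ := fun h => mk Γ (n * h) with hP
  set σ : LeftQuotient Γ → N := fun q => n⁻¹ * s q with hσ
  have hP1 : P 1 = mk Γ n := by simp [hP]
  have hσ1 : σ (mk Γ n) = 1 := by simp [hσ, hsn]
  have hPs : ContMDiff (𝓡 d) (𝓡 d) ∞ P := (mk_contMDiff Γ).comp contMDiff_mul_left
  have hσs : ContMDiffAt (𝓡 d) (𝓡 d) ∞ σ (mk Γ n) :=
    (contMDiff_mul_left (I := 𝓡 d) (n := ∞) (a := n⁻¹)).contMDiffAt.comp _ hs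
  have e1 : (σ ∘ P) =ᶠ[𝓝 1] id := by
    have : Filter.Tendsto (fun h : N => n * h) (𝓝 1) (𝓝 n) := by
      simpa using (continuous_const_mul n).tendsto 1
    filter_upwards [this.eventually hl] with h hh
    simp [hσ, hP, hh]
  have e2 : (P ∘ σ) =ᶠ[𝓝 (mk Γ n)] id := by
    filter_upwards [hr] with q hq
    simp [hσ, hP, hq]
  refine ⟨mfderiv (𝓡 d) (𝓡 d) σ (mk Γ n), fun v => ?_, fun w => ?_⟩
  · have h1 := mfderiv_comp (I := 𝓡 d) (I' := 𝓡 d) (I'' := 𝓡 d) (1 : N) (g := σ) (f := P)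
      (by rw [hP1]; exact hσs.mdifferentiableAt (by simp)) (hPs.mdifferentiableAt (by simp))
    rw [e1.mfderiv_eq, mfderiv_id] at h1
    have h2 : ∀ q, q = mk Γ n → ∀ u : EuclideanSpace ℝ (Fin d),
        (mfderiv (𝓡 d) (𝓡 d) σ q u : EuclideanSpace ℝ (Fin d)) =
          mfderiv (𝓡 d) (𝓡 d) σ (mk Γ n) u := by rintro q rfl u; rfl
    exact (h2 _ hP1 _).symm.trans (congrArg (fun L => L v) h1).symm
  · have h1 := mfderiv_comp (I := 𝓡 d) (I' := 𝓡 d) (I'' := 𝓡 d) (mk Γ n) (g := P) (f := σ)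
      (hPs.mdifferentiableAt (by simp)) (hσs.mdifferentiableAt (by simp))
    rw [e2.mfderiv_eq, mfderiv_id] at h1
    have h2 : ∀ q, q = 1 → ∀ u : EuclideanSpace ℝ (Fin d),
        (mfderiv (𝓡 d) (𝓡 d) P q u : EuclideanSpace ℝ (Fin d)) =
          mfderiv (𝓡 d) (𝓡 d) P 1 u := by rintro q rfl u; rfl
    exact (h2 _ hσ1 _).symm.trans (congrArg (fun L => L w) h1).symm

theorem frame_mk (n : N) (v : GroupLieAlgebra (𝓡 d) N) :
    frame Γ (mk Γ n) v = frameAt Γ n v := by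
  have h : mk Γ (Quotient.out (mk Γ n)) = mk Γ n := Quotient.out_eq _
  obtain ⟨γ, hγ⟩ := (isCov Γ).apply_eq_iff_mem_orbit.mp h
  have hγ' : (γ : N) * n = Quotient.out (mk Γ n) := hγ
  have h2 := frameAt_smul (d := d) Γ γ n v
  rw [hγ'] at h2
  exact h2

/-- The metric tensor of `Γ\N` induced by the left-invariant metric tensor of `N` with value `B` at
the identity. -/
def metric (B : LinearMap.BilinForm ℝ (GroupLieAlgebra (𝓡 d) N)) :
    MetricTensor d (LeftQuotient Γ) := fun x =>
  LinearMap.compl₁₂ B (frame Γ x).inverse.toLinearMap (frame Γ x).inverse.toLinearMap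

/-- The left-invariant fields have the inner products prescribed by `B`: the projection
`N → Γ\N` is a local isometry. -/
theorem metric_mk (B : LinearMap.BilinForm ℝ (GroupLieAlgebra (𝓡 d) N)) (n : N)
    (v w : GroupLieAlgebra (𝓡 d) N) :
    metric Γ B (mk Γ n) (mfderiv (𝓡 d) (𝓡 d) (mk Γ) n (mulInvariantVectorField v n))
      (mfderiv (𝓡 d) (𝓡 d) (mk Γ) n (mulInvariantVectorField w n)) = B v w := by
  rw [← frameAt_apply, ← frameAt_apply, ← frame_mk, ← frame_mk]
  have key : ∀ u : GroupLieAlgebra (𝓡 d) N,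
      (frame (d := d) Γ (mk Γ n)).inverse (frame (d := d) Γ (mk Γ n) u) = u := by
    intro u
    obtain ⟨L, h1, h2⟩ := frameAt_inverse (d := d) Γ n
    have : (frame (d := d) Γ (mk Γ n)).inverse = L := by
      refine ContinuousLinearMap.inverse_eq ?_ ?_
      · ext1 w
        exact (frame_mk Γ n (L w)).trans (h2 w)
      · ext1 w
        exact (congrArg L (frame_mk (d := d) Γ n w)).trans (h1 w)
    rw [this]
    exact (congrArg L (frame_mk (d := d) Γ n u)).trans (h1 u)
  simp only [metric, LinearMap.compl₁₂_apply]
  exact congrArg₂ (fun a b => B a b) (key v) (key w)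

/-- The distribution on `Γ\N` induced by the left-invariant distribution of `N` with value `W` at
the identity. -/
def distribution (W : Submodule ℝ (GroupLieAlgebra (𝓡 d) N)) :
    Distribution d (LeftQuotient Γ) := fun x => W.map (frame Γ x).toLinearMap

end LeftQuotient

/-- The group of the isometries of `Γ\N` that preserve the splitting
`T(Γ\N) = 𝔷(Γ\N) ⊕ 𝔳(Γ\N)`. -/
abbrev splGroup (B : LinearMap.BilinForm ℝ (GroupLieAlgebra (𝓡 d) N))
    (V : Submodule ℝ (GroupLieAlgebra (𝓡 d) N)) : Subgroup (LeftQuotient Γ ≃ₜ LeftQuotient Γ) :=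
  splitIsometryGroup (LeftQuotient.metric Γ B) (LeftQuotient.distribution Γ (lieCenter d N))
    (LeftQuotient.distribution Γ (subspaceV B V))

/-- The identity component of `splGroup`, for the compact-open topology. -/
abbrev splGroupZero [CompactSpace (LeftQuotient Γ)]
    (B : LinearMap.BilinForm ℝ (GroupLieAlgebra (𝓡 d) N))
    (V : Submodule ℝ (GroupLieAlgebra (𝓡 d) N)) : Subgroup (splGroup Γ B V) :=
  Subgroup.connectedComponentOfOne (splGroup Γ B V)

/-- The orbit of a point of `Γ\N` under `splGroupZero`. -/
def orbit [CompactSpace (LeftQuotient Γ)]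
    (B : LinearMap.BilinForm ℝ (GroupLieAlgebra (𝓡 d) N))
    (V : Submodule ℝ (GroupLieAlgebra (𝓡 d) N)) (x : LeftQuotient Γ) : Set (LeftQuotient Γ) :=
  Set.range fun ψ : splGroupZero Γ B V => ψ.1.1 x

/-- The quotient `(Γ ∩ Z)\Z` of the center `Z` of `N`. -/
abbrev CentralTorus {N : Type*} [Group N] (Γ : Subgroup N) : Type _ :=
  Subgroup.center N ⧸ Γ.subgroupOf (Subgroup.center N)

/-- The dimension of the center of the Lie algebra of `N`. -/
abbrev centerDim (d : ℕ) (N : Type*) [Group N] [TopologicalSpace N]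
    [ChartedSpace (EuclideanSpace ℝ (Fin d)) N] [LieGroup (𝓡 d) ∞ N] : ℕ :=
  Module.finrank ℝ (lieCenter d N)

end Quotient

end

end PseudoNil

open PseudoNil

/-! Write `𝔫 = 𝔷 ⊕ 𝔳` for the splitting of the Lie algebra. In a simply connected two-step nilpotent
group the exponential map is a diffeomorphism and the product becomes `x + y + ½[x, y]` (`gexp_bch`,
`gexp_homeomorph_exists`, `contMDiff_glog`). So each map `par Γ n : a ↦ Γ n exp a` is a local
coordinate system of the quotient, in which the left-invariant field of `v` is `v + ½[a, v]`. These
fields descend to a global frame of `Γ\N`, and all the calculus is done on components in that frame.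

Geometry of the orbits. In the frame the metric is constant, so the Levi-Civita connection has
constant Christoffel symbols, given by Koszul's formula. Each bracket in that formula for `C x y`
involves `x` or `y`, so `C` vanishes on pairs of central vectors
(`IsChristoffel.eq_zero_of_mem_center`). The tangent spaces of an orbit are spanned by the frame
fields of `𝔷` (`mem_tangentVectors_orbit_iff`). Hence orbits are totally geodesic and flat, and
projected cosets of central one-parameter groups are complete geodesics in them.

Rigidity. A split isometry `ψ` uniformly close to the identity lifts to a map of `N` that commutes
with `Γ` (`exists_lift_of_close`). Let `Ψ` be the lift in exponential coordinates and `D` its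
differential in the left-invariant frame. Then `D` preserves the form, `𝔷` and `𝔳`. Put `S y x` for
the derivative of `D x` along the field of `y`. Symmetry of the second derivatives of `Ψ` gives `S y
x - S x y = D[y, x] - [D y, D x]`, an element of `𝔷`. On `𝔳` the left side is in `𝔳`, so both sides
vanish there, and they vanish trivially if an argument is central. So `S` is symmetric, while
differentiating the metric condition makes `⟨S y x, D w⟩` skew in `x, w`. A trilinear form symmetric
in one pair of arguments and skew in another is zero, so `D` is a constant `A`
(`expDeriv_eq_const`), and `Ψ a = y · A a` with `y = Ψ 0`. Commuting with `Γ` gives `A l = l - [y,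
l]` for `l ∈ log Γ`. Since `log Γ` spans `𝔫` (`span_glog_eq_top`), this holds on all of `𝔫`. As `A`
preserves `𝔳`, the bracket `[y, 𝔳]` lies in `𝔳 ∩ 𝔷 = 0`, so `y` is central and `ψ` is a central
translation.

The group. The central translations therefore form an open subgroup of the group of split
isometries. They are the continuous image of the connected group `(Γ ∩ Z)\Z`, so they form the
identity component (`range_torusHom`). A central translation with a fixed point lies in `Γ`, which
gives injectivity and freeness. The lattice meets the center cocompactly
(`exists_isCompact_center`), so the source is compact and the isomorphism is a homeomorphism. Both
groups receive their smooth structure from the covering by the vector space `𝔷`; in the coordinates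
`par` an orbit map is the inclusion of `𝔷` into `𝔷 ⊕ 𝔳`, hence an embedding. -/

namespace PseudoNil

noncomputable section

/-! ### Derivatives as linear maps of the model spaces, so that base points do not enter the types
-/

section ModelDerivative

variable {E : Type*} [NormedAddCommGroup E] [NormedSpace ℝ E] {H : Type*} [TopologicalSpace H]
  {I : ModelWithCorners ℝ E H} {M : Type*} [TopologicalSpace M] [ChartedSpace H M]
  {E' : Type*} [NormedAddCommGroup E'] [NormedSpace ℝ E'] {H' : Type*} [TopologicalSpace H']
  {I' : ModelWithCorners ℝ E' H'} {M' : Type*} [TopologicalSpace M'] [ChartedSpace H' M']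
  {E'' : Type*} [NormedAddCommGroup E''] [NormedSpace ℝ E''] {H'' : Type*} [TopologicalSpace H'']
  {I'' : ModelWithCorners ℝ E'' H''} {M'' : Type*} [TopologicalSpace M''] [ChartedSpace H'' M'']

variable (I I') in
/-- `HasMFDerivAt`, with the derivative regarded as a map between the model vector spaces. -/
def HasModelDerivAt (f : M → M') (x : M) (L : E →L[ℝ] E') : Prop :=
  HasMFDerivAt I I' f x L

variable (I I') in
/-- `mfderiv` regarded as a map between the model vector spaces. -/
def modelDeriv (f : M → M') (x : M) : E →L[ℝ] E' := mfderiv I I' f x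

theorem HasModelDerivAt.modelDeriv_eq {f : M → M'} {x : M} {L : E →L[ℝ] E'}
    (h : HasModelDerivAt I I' f x L) : modelDeriv I I' f x = L :=
  HasMFDerivAt.mfderiv h

theorem HasModelDerivAt.unique {f : M → M'} {x : M} {L L' : E →L[ℝ] E'}
    (h : HasModelDerivAt I I' f x L) (h' : HasModelDerivAt I I' f x L') : L = L' :=
  h.modelDeriv_eq.symm.trans h'.modelDeriv_eq

theorem hasModelDerivAt_of_mdifferentiableAt {f : M → M'} {x : M}
    (h : MDifferentiableAt I I' f x) : HasModelDerivAt I I' f x (modelDeriv I I' f x) :=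
  h.hasMFDerivAt

theorem hasModelDerivAt_of_contMDiffAt {f : M → M'} {x : M} {n : WithTop ℕ∞}
    (h : ContMDiffAt I I' n f x) (hn : n ≠ 0) :
    HasModelDerivAt I I' f x (modelDeriv I I' f x) :=
  (h.mdifferentiableAt hn).hasMFDerivAt

theorem HasModelDerivAt.comp {f : M → M'} {g : M' → M''} {x : M} {y : M'} {L : E →L[ℝ] E'}
    {L' : E' →L[ℝ] E''} (hg : HasModelDerivAt I' I'' g y L') (hf : HasModelDerivAt I I' f x L)
    (h : f x = y) : HasModelDerivAt I I'' (g ∘ f) x (L'.comp L) := by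
  subst h
  exact HasMFDerivAt.comp x hg hf

theorem HasModelDerivAt.congr {f g : M → M'} {x : M} {L : E →L[ℝ] E'}
    (hf : HasModelDerivAt I I' f x L) (h : g =ᶠ[𝓝 x] f) : HasModelDerivAt I I' g x L :=
  HasMFDerivAt.congr_of_eventuallyEq hf h

theorem HasModelDerivAt.continuousAt {f : M → M'} {x : M} {L : E →L[ℝ] E'}
    (hf : HasModelDerivAt I I' f x L) : ContinuousAt f x :=
  HasMFDerivAt.continuousAt hf

theorem hasModelDerivAt_id (x : M) :
    HasModelDerivAt I I id x (ContinuousLinearMap.id ℝ E) :=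
  hasMFDerivAt_id x

theorem hasModelDerivAt_iff_hasFDerivAt {f : E → E'} {x : E} {L : E →L[ℝ] E'} :
    HasModelDerivAt 𝓘(ℝ, E) 𝓘(ℝ, E') f x L ↔ HasFDerivAt f L x :=
  hasMFDerivAt_iff_hasFDerivAt

theorem hasModelDerivAt_extChartAt [IsManifold I 1 M] (x : M) :
    HasModelDerivAt I 𝓘(ℝ, E) (extChartAt I x) x (ContinuousLinearMap.id ℝ E) := by
  have h1 : MDifferentiableAt I 𝓘(ℝ, E) (extChartAt I x) x :=
    (contMDiffAt_extChartAt (n := 1)).mdifferentiableAt (by simp)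
  have h2 := hasModelDerivAt_of_mdifferentiableAt h1
  have h3 : modelDeriv I 𝓘(ℝ, E) (extChartAt I x) x = ContinuousLinearMap.id ℝ E := by
    have h4 := mfderiv_extChartAt_self (I := I) (x := x)
    exact h4
  rwa [h3] at h2

/-- The Lie bracket of two fields, computed in a parametrization of the manifold. -/
theorem mlieBracket_eq_of_parametrization [CompleteSpace E] [CompleteSpace E']
    [IsManifold I' ∞ M'] {f : E → M'} {a : E}
    (hf : ContMDiffAt 𝓘(ℝ, E) I' ∞ f a)
    (hinv : ∀ᶠ b in 𝓝 a, (modelDeriv 𝓘(ℝ, E) I' f b).IsInvertible)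
    {X Y : ∀ x : M', TangentSpace I' x}
    (hX : MDifferentiableAt I' I'.tangent (fun x => (⟨x, X x⟩ : TangentBundle I' M')) (f a))
    (hY : MDifferentiableAt I' I'.tangent (fun x => (⟨x, Y x⟩ : TangentBundle I' M')) (f a))
    {ξ η : E → E} (hξ : ∀ᶠ b in 𝓝 a, modelDeriv 𝓘(ℝ, E) I' f b (ξ b) = X (f b))
    (hη : ∀ᶠ b in 𝓝 a, modelDeriv 𝓘(ℝ, E) I' f b (η b) = Y (f b)) :
    (VectorField.mlieBracket I' X Y (f a) : E') =
      modelDeriv 𝓘(ℝ, E) I' f a (VectorField.lieBracket ℝ ξ η a) := by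
  -- The bracket commutes with pullback; it remains to see that the pullbacks by `f` of the two
  -- fields are `ξ` and `η` near `a`.
  have key : ∀ (Z : ∀ x : M', TangentSpace I' x) (ζ : E → E),
      (∀ᶠ b in 𝓝 a, modelDeriv 𝓘(ℝ, E) I' f b (ζ b) = Z (f b)) →
      VectorField.mpullback 𝓘(ℝ, E) I' f Z =ᶠ[𝓝 a] ζ := by
    intro Z ζ h
    filter_upwards [h, hinv] with b hb hb'
    have h1 : (VectorField.mpullback 𝓘(ℝ, E) I' f Z b : E) =
        (modelDeriv 𝓘(ℝ, E) I' f b).inverse (Z (f b)) := rfl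
    refine h1.trans ?_
    refine (congrArg (modelDeriv 𝓘(ℝ, E) I' f b).inverse hb.symm).trans ?_
    exact hb'.inverse_apply_eq.mpr rfl
  have : IsManifold I' (minSmoothness ℝ 3) M' := by
    rw [minSmoothness_of_isRCLikeNormedField]; infer_instance
  have h1 := VectorField.mpullback_mlieBracket (n := ∞) hX hY hf
    (by rw [minSmoothness_of_isRCLikeNormedField]; exact WithTop.coe_le_coe.mpr le_top)
  have h2 : VectorField.mlieBracket 𝓘(ℝ, E) (VectorField.mpullback 𝓘(ℝ, E) I' f X)
      (VectorField.mpullback 𝓘(ℝ, E) I' f Y) a = VectorField.lieBracket ℝ ξ η a := by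
    rw [← VectorField.mlieBracketWithin_univ, VectorField.mlieBracketWithin_eq_lieBracketWithin]
    refine (congrFun (VectorField.lieBracketWithin_univ (𝕜 := ℝ)
      (V := fun b => (VectorField.mpullback 𝓘(ℝ, E) I' f X b : E))
      (W := fun b => (VectorField.mpullback 𝓘(ℝ, E) I' f Y b : E))) a).trans ?_
    exact (key X ξ hξ).lieBracket_vectorField_eq (key Y η hη)
  rw [h2] at h1
  have h3 : (modelDeriv 𝓘(ℝ, E) I' f a).inverse (VectorField.mlieBracket I' X Y (f a)) =
      VectorField.lieBracket ℝ ξ η a := h1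
  exact (hinv.self_of_nhds.inverse_apply_eq.mp h3)

end ModelDerivative

/-! ### The group law, the left-invariant fields and the Lie bracket in the chart at the identity -/

section ChartAtOne

variable (d : ℕ) (N : Type*) [Group N] [TopologicalSpace N]
  [ChartedSpace (EuclideanSpace ℝ (Fin d)) N]

/-- The preferred chart at the identity of a Lie group. -/
def oneChart : PartialEquiv N (EuclideanSpace ℝ (Fin d)) := extChartAt (𝓡 d) (1 : N)

/-- The coordinates of the identity in the chart `oneChart`. -/
def oneCoord : EuclideanSpace ℝ (Fin d) := oneChart d N 1

/-- The multiplication of a Lie group in the chart at the identity. -/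
def chartMul (u v : EuclideanSpace ℝ (Fin d)) : EuclideanSpace ℝ (Fin d) :=
  oneChart d N ((oneChart d N).symm u * (oneChart d N).symm v)

/-- The left-invariant fields in the chart at the identity. -/
def chartLeft (u : EuclideanSpace ℝ (Fin d)) :
    EuclideanSpace ℝ (Fin d) →L[ℝ] EuclideanSpace ℝ (Fin d) :=
  fderiv ℝ (chartMul d N u) (oneCoord d N)

theorem oneCoord_mem : oneCoord d N ∈ (oneChart d N).target := mem_extChartAt_target 1

theorem oneChart_one_mem : (1 : N) ∈ (oneChart d N).source := mem_extChartAt_source 1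

@[simp] theorem oneChart_symm_oneCoord : (oneChart d N).symm (oneCoord d N) = 1 :=
    extChartAt_to_inv 1

@[simp] theorem oneChart_one : oneChart d N 1 = oneCoord d N := rfl

theorem oneChart_target_mem_nhds {u : EuclideanSpace ℝ (Fin d)} (hu : u ∈ (oneChart d N).target) :
    (oneChart d N).target ∈ 𝓝 u := extChartAt_target_mem_nhds' hu

theorem oneChart_source_mem_nhds {g : N} (hg : g ∈ (oneChart d N).source) :
    (oneChart d N).source ∈ 𝓝 g := extChartAt_source_mem_nhds' hg

section Manifold
variable [IsManifold (𝓡 d) ∞ N]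

theorem contMDiffAt_oneChart {g : N} (hg : g ∈ (oneChart d N).source) :
    ContMDiffAt (𝓡 d) 𝓘(ℝ, EuclideanSpace ℝ (Fin d)) ∞ (oneChart d N) g :=
  (contMDiffOn_extChartAt (x := (1 : N))).contMDiffAt
    (by rw [← extChartAt_source (𝓡 d)]; exact oneChart_source_mem_nhds d N hg)

theorem contMDiffAt_oneChart_symm {u : EuclideanSpace ℝ (Fin d)}
    (hu : u ∈ (oneChart d N).target) :
    ContMDiffAt 𝓘(ℝ, EuclideanSpace ℝ (Fin d)) (𝓡 d) ∞ (oneChart d N).symm u :=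
  (contMDiffOn_extChartAt_symm (1 : N)).contMDiffAt (oneChart_target_mem_nhds d N hu)

/-- The tangent space at `1` is identified with the model space through this very chart. -/
theorem hasModelDerivAt_oneChart :
    HasModelDerivAt (𝓡 d) 𝓘(ℝ, EuclideanSpace ℝ (Fin d)) (oneChart d N) 1
      (ContinuousLinearMap.id ℝ _) :=
  have : IsManifold (𝓡 d) 1 N := IsManifold.of_le (n := ∞) (by simp)
  hasModelDerivAt_extChartAt (1 : N)

theorem oneChart_symm_modelDeriv_isInvertible {u : EuclideanSpace ℝ (Fin d)}
    (hu : u ∈ (oneChart d N).target) :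
    (modelDeriv 𝓘(ℝ, EuclideanSpace ℝ (Fin d)) (𝓡 d) (oneChart d N).symm u).IsInvertible := by
  have : IsManifold (𝓡 d) 1 N := IsManifold.of_le (n := ∞) (by simp)
  have h := isInvertible_mfderivWithin_extChartAt_symm (I := 𝓡 d) hu
  rw [ModelWithCorners.range_eq_univ, mfderivWithin_univ] at h
  exact h

theorem hasModelDerivAt_oneChart_symm :
    HasModelDerivAt 𝓘(ℝ, EuclideanSpace ℝ (Fin d)) (𝓡 d) (oneChart d N).symm (oneCoord d N)
      (ContinuousLinearMap.id ℝ _) := by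
  have h1 := hasModelDerivAt_of_contMDiffAt
    (contMDiffAt_oneChart_symm d N (oneCoord_mem d N)) (by simp)
  have h2 := (hasModelDerivAt_oneChart d N).comp h1 (by simp)
  have h3 : HasModelDerivAt 𝓘(ℝ, EuclideanSpace ℝ (Fin d)) 𝓘(ℝ, EuclideanSpace ℝ (Fin d))
      (oneChart d N ∘ (oneChart d N).symm) (oneCoord d N) (ContinuousLinearMap.id ℝ _) := by
    refine (hasModelDerivAt_id _).congr ?_
    filter_upwards [oneChart_target_mem_nhds d N (oneCoord_mem d N)] with u hu
    exact (oneChart d N).right_inv hu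
  have h4 := h2.unique h3
  rw [ContinuousLinearMap.id_comp] at h4
  rwa [h4] at h1

end Manifold

variable [LieGroup (𝓡 d) ∞ N]

theorem contDiffAt_chartMul {u : EuclideanSpace ℝ (Fin d)} (hu : u ∈ (oneChart d N).target) :
    ContDiffAt ℝ ∞ (Function.uncurry (chartMul d N)) (u, oneCoord d N) := by
  rw [← contMDiffAt_iff_contDiffAt]
  have h1 : ContMDiffAt 𝓘(ℝ, EuclideanSpace ℝ (Fin d) × EuclideanSpace ℝ (Fin d)) (𝓡 d) ∞
      (fun p : EuclideanSpace ℝ (Fin d) × EuclideanSpace ℝ (Fin d) =>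
        (oneChart d N).symm p.1 * (oneChart d N).symm p.2) (u, oneCoord d N) := by
    refine ContMDiffAt.mul ?_ ?_
    · exact (contMDiffAt_oneChart_symm d N hu).comp (u, oneCoord d N)
        contDiffAt_fst.contMDiffAt
    · exact (contMDiffAt_oneChart_symm d N (oneCoord_mem d N)).comp (u, oneCoord d N)
        contDiffAt_snd.contMDiffAt
  refine ContMDiffAt.comp (u, oneCoord d N) (contMDiffAt_oneChart d N ?_) h1
  simpa using (oneChart d N).map_target hu

theorem contDiffAt_chartLeft {u : EuclideanSpace ℝ (Fin d)} (hu : u ∈ (oneChart d N).target) :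
    ContDiffAt ℝ ∞ (chartLeft d N) u :=
  (contDiffAt_chartMul d N hu).fderiv contDiffAt_const (by simp)

theorem chartLeft_oneCoord : chartLeft d N (oneCoord d N) = ContinuousLinearMap.id ℝ _ := by
  have h : chartMul d N (oneCoord d N) =ᶠ[𝓝 (oneCoord d N)] id := by
    filter_upwards [oneChart_target_mem_nhds d N (oneCoord_mem d N)] with u hu
    simp [chartMul, (oneChart d N).right_inv hu]
  rw [chartLeft, h.fderiv_eq, fderiv_id]

theorem hasFDerivAt_chartMul {u : EuclideanSpace ℝ (Fin d)} (hu : u ∈ (oneChart d N).target) :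
    HasFDerivAt (chartMul d N u) (chartLeft d N u) (oneCoord d N) := by
  have h := contDiffAt_chartMul d N hu
  have h2 : ContDiffAt ℝ ∞ (chartMul d N u) (oneCoord d N) :=
    h.comp (oneCoord d N) (contDiffAt_const.prodMk contDiffAt_id)
  exact (h2.differentiableAt (by simp)).hasFDerivAt

variable {N}

/-- The value at `g` of the left-invariant field of `v`, as a vector of the model space. -/
def leftField (g : N) : EuclideanSpace ℝ (Fin d) →L[ℝ] EuclideanSpace ℝ (Fin d) :=
  modelDeriv (𝓡 d) (𝓡 d) (fun h : N => g * h) 1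

theorem hasModelDerivAt_mul_left (g h : N) :
    HasModelDerivAt (𝓡 d) (𝓡 d) (fun k : N => g * k) h
      (modelDeriv (𝓡 d) (𝓡 d) (fun k : N => g * k) h) :=
  hasModelDerivAt_of_contMDiffAt (n := ∞) contMDiff_mul_left.contMDiffAt (by simp)

-- In the chart, `chartLeft u` is the differential at `1` of the left translation by the point with
-- coordinates `u`; the inverse chart therefore carries it to the left-invariant fields.
variable (N) in
theorem oneChart_symm_modelDeriv {u : EuclideanSpace ℝ (Fin d)} (hu : u ∈ (oneChart d N).target) :
    (modelDeriv 𝓘(ℝ, EuclideanSpace ℝ (Fin d)) (𝓡 d) (oneChart d N).symm u).comp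
      (chartLeft d N u) = leftField d ((oneChart d N).symm u) := by
  have h1 := hasModelDerivAt_of_contMDiffAt (contMDiffAt_oneChart_symm d N hu) (by simp)
  have h2 := h1.comp (hasModelDerivAt_iff_hasFDerivAt.mpr (hasFDerivAt_chartMul d N hu))
    (by simp [chartMul, (oneChart d N).right_inv hu])
  have h3 := (hasModelDerivAt_mul_left d ((oneChart d N).symm u) 1).comp
    (hasModelDerivAt_oneChart_symm d N) (by simp)
  refine (h2.unique (h3.congr ?_)).trans (ContinuousLinearMap.comp_id _)
  have h4 : ContinuousAt (fun v => (oneChart d N).symm u * (oneChart d N).symm v)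
      (oneCoord d N) := h3.continuousAt
  have h5 : ∀ᶠ v in 𝓝 (oneCoord d N), (oneChart d N).symm u * (oneChart d N).symm v ∈
      (oneChart d N).source := by
    refine h4.eventually (oneChart_source_mem_nhds d N ?_)
    simpa using (oneChart d N).map_target hu
  filter_upwards [h5] with v hv
  exact (oneChart d N).left_inv hv

variable (N) in
/-- The Lie bracket as a bilinear map on the model space. -/
def lieBr (x y : EuclideanSpace ℝ (Fin d)) : EuclideanSpace ℝ (Fin d) :=
  Bracket.bracket (L := GroupLieAlgebra (𝓡 d) N) (M := GroupLieAlgebra (𝓡 d) N) x y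

-- The bracket of the Lie algebra is the value at `1` of the bracket of left-invariant fields. In
-- the chart these are `u ↦ chartLeft u x`, and the bracket of fields on a vector space is a
-- difference of directional derivatives.
variable (N) in
theorem lieBr_eq (x y : EuclideanSpace ℝ (Fin d)) :
    lieBr d N x y = fderiv ℝ (fun u => chartLeft d N u y) (oneCoord d N) x -
      fderiv ℝ (fun u => chartLeft d N u x) (oneCoord d N) y := by
  have hmem : ∀ᶠ u in 𝓝 (oneCoord d N), u ∈ (oneChart d N).target :=
    oneChart_target_mem_nhds d N (oneCoord_mem d N)
  have hd : ∀ z : EuclideanSpace ℝ (Fin d), MDifferentiableAt (𝓡 d) (𝓡 d).tangent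
      (fun g : N => (⟨g, mulInvariantVectorField (I := 𝓡 d) (G := N) z g⟩ :
        TangentBundle (𝓡 d) N)) ((oneChart d N).symm (oneCoord d N)) :=
    fun z => mdifferentiableAt_mulInvariantVectorField (I := 𝓡 d) (G := N) z
  have key : ∀ z : EuclideanSpace ℝ (Fin d), ∀ᶠ u in 𝓝 (oneCoord d N),
      modelDeriv 𝓘(ℝ, EuclideanSpace ℝ (Fin d)) (𝓡 d) (oneChart d N).symm u (chartLeft d N u z) =
        mulInvariantVectorField (I := 𝓡 d) (G := N) z ((oneChart d N).symm u) := fun z => by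
    filter_upwards [hmem] with u hu
    exact congrArg (fun L => L z) (oneChart_symm_modelDeriv d N hu)
  have h := mlieBracket_eq_of_parametrization
    (contMDiffAt_oneChart_symm d N (oneCoord_mem d N))
    (hmem.mono fun u hu => oneChart_symm_modelDeriv_isInvertible d N hu) (hd x) (hd y)
    (key x) (key y)
  rw [(hasModelDerivAt_oneChart_symm d N).modelDeriv_eq, VectorField.lieBracket_eq] at h
  simp only [chartLeft_oneCoord] at h
  have h2 : ∀ g : N, g = 1 → lieBr d N x y = (VectorField.mlieBracket (𝓡 d)
      (mulInvariantVectorField (I := 𝓡 d) (G := N) x)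
      (mulInvariantVectorField (I := 𝓡 d) (G := N) y) g : EuclideanSpace ℝ (Fin d)) := by
    rintro g rfl; rfl
  exact (h2 _ (oneChart_symm_oneCoord d N)).trans h

end ChartAtOne

/-! ### Mixed partial derivatives -/

section MixedPartials

variable {E F G : Type*} [NormedAddCommGroup E] [NormedSpace ℝ E] [NormedAddCommGroup F]
  [NormedSpace ℝ F] [NormedAddCommGroup G] [NormedSpace ℝ G]

theorem fderiv_fderiv_fst {f : E × F → G} {p : E} {q : F} (hf : ContDiffAt ℝ 2 f (p, q))
    (y : E) (x : F) :
    fderiv ℝ (fun c => fderiv ℝ (fun b => f (b, c)) p y) q x =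
      fderiv ℝ (fderiv ℝ f) (p, q) (0, x) (y, 0) := by
  have h1 : ∀ᶠ c in 𝓝 q, fderiv ℝ (fun b => f (b, c)) p y = fderiv ℝ f (p, c) (y, 0) := by
    have h2 : ∀ᶠ z in 𝓝 (p, q), ContDiffAt ℝ 2 f z := hf.eventually (by simp)
    have h3 : ContinuousAt (fun c : F => (p, c)) q := by fun_prop
    filter_upwards [h3.eventually h2] with c hc
    have h4 : HasFDerivAt (fun b : E => (b, c)) (ContinuousLinearMap.inl ℝ E F) p :=
      hasFDerivAt_prodMk_left p c
    have h5 := (hc.differentiableAt (by simp)).hasFDerivAt.comp p h4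
    rw [HasFDerivAt.fderiv (f := fun b => f (b, c)) h5]
    rfl
  rw [Filter.EventuallyEq.fderiv_eq h1]
  have h6 : HasFDerivAt (fun c : F => (p, c)) (ContinuousLinearMap.inr ℝ E F) q :=
    hasFDerivAt_prodMk_right p q
  have h7 : DifferentiableAt ℝ (fderiv ℝ f) (p, q) :=
    (hf.fderiv_right (m := 1) (by norm_num)).differentiableAt (by simp)
  have h8 := ((h7.hasFDerivAt.comp q h6).clm_apply (hasFDerivAt_const ((y, 0) : E × F) q))
  rw [HasFDerivAt.fderiv (f := fun c => fderiv ℝ f (p, c) (y, 0)) h8]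
  simp

theorem fderiv_fderiv_snd {f : E × F → G} {p : E} {q : F} (hf : ContDiffAt ℝ 2 f (p, q))
    (y : E) (x : F) :
    fderiv ℝ (fun b => fderiv ℝ (fun c => f (b, c)) q x) p y =
      fderiv ℝ (fderiv ℝ f) (p, q) (y, 0) (0, x) := by
  have h1 : ∀ᶠ b in 𝓝 p, fderiv ℝ (fun c => f (b, c)) q x = fderiv ℝ f (b, q) (0, x) := by
    have h2 : ∀ᶠ z in 𝓝 (p, q), ContDiffAt ℝ 2 f z := hf.eventually (by simp)
    have h3 : ContinuousAt (fun b : E => (b, q)) p := by fun_prop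
    filter_upwards [h3.eventually h2] with b hb
    have h4 : HasFDerivAt (fun c : F => (b, c)) (ContinuousLinearMap.inr ℝ E F) q :=
      hasFDerivAt_prodMk_right b q
    have h5 := (hb.differentiableAt (by simp)).hasFDerivAt.comp q h4
    rw [HasFDerivAt.fderiv (f := fun c => f (b, c)) h5]
    rfl
  rw [Filter.EventuallyEq.fderiv_eq h1]
  have h6 : HasFDerivAt (fun b : E => (b, q)) (ContinuousLinearMap.inl ℝ E F) p :=
    hasFDerivAt_prodMk_left p q
  have h7 : DifferentiableAt ℝ (fderiv ℝ f) (p, q) :=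
    (hf.fderiv_right (m := 1) (by norm_num)).differentiableAt (by simp)
  have h8 := ((h7.hasFDerivAt.comp p h6).clm_apply (hasFDerivAt_const ((0, x) : E × F) p))
  rw [HasFDerivAt.fderiv (f := fun b => fderiv ℝ f (b, q) (0, x)) h8]
  simp

/-- Both iterated derivatives are values of the second derivative of `f` on the product, which is
symmetric. This turns right translations into left ones in `hasDerivAt_Ad`. -/
theorem fderiv_fderiv_comm {f : E × F → G} {p : E} {q : F} (hf : ContDiffAt ℝ 2 f (p, q))
    (y : E) (x : F) :
    fderiv ℝ (fun c => fderiv ℝ (fun b => f (b, c)) p y) q x =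
      fderiv ℝ (fun b => fderiv ℝ (fun c => f (b, c)) q x) p y := by
  rw [fderiv_fderiv_fst hf, fderiv_fderiv_snd hf]
  exact hf.isSymmSndFDerivAt (by simp) _ _

end MixedPartials

/-! ### Derivatives of curves in the left trivialization -/

section LeftDerivative

variable {d : ℕ} {N : Type*} [Group N] [TopologicalSpace N]
  [ChartedSpace (EuclideanSpace ℝ (Fin d)) N] [LieGroup (𝓡 d) ∞ N]

/-- The curve `c` in a Lie group has the derivative `v` at time `t` in the left trivialization. -/
def HasLeftDeriv (c : ℝ → N) (v : EuclideanSpace ℝ (Fin d)) (t : ℝ) : Prop :=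
  HasModelDerivAt 𝓘(ℝ, ℝ) (𝓡 d) c t (ContinuousLinearMap.toSpanSingleton ℝ (leftField d (c t) v))

theorem leftField_one : leftField d (1 : N) = ContinuousLinearMap.id ℝ _ := by
  have h : (fun h : N => 1 * h) = id := funext one_mul
  rw [leftField, h]
  exact (hasModelDerivAt_id (1 : N)).modelDeriv_eq

theorem hasModelDerivAt_leftField (g : N) :
    HasModelDerivAt (𝓡 d) (𝓡 d) (fun h : N => g * h) 1 (leftField d g) :=
  hasModelDerivAt_mul_left d g 1

theorem modelDeriv_mul_left_leftField (g h : N) :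
    (modelDeriv (𝓡 d) (𝓡 d) (fun k : N => g * k) h).comp (leftField d h) =
      leftField d (g * h) := by
  have h1 := (hasModelDerivAt_mul_left d g h).comp (hasModelDerivAt_leftField h) (mul_one h)
  refine h1.unique ?_
  have h2 : (fun k : N => g * k) ∘ (fun k : N => h * k) = fun k => (g * h) * k :=
    funext fun k => (mul_assoc g h k).symm
  rw [h2]
  exact hasModelDerivAt_leftField (g * h)

theorem toSpanSingleton_comp (L : EuclideanSpace ℝ (Fin d) →L[ℝ] EuclideanSpace ℝ (Fin d))
    (v : EuclideanSpace ℝ (Fin d)) :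
    L.comp (ContinuousLinearMap.toSpanSingleton ℝ v) =
      ContinuousLinearMap.toSpanSingleton ℝ (L v) := by
  ext1; simp

theorem HasLeftDeriv.const_mul {c : ℝ → N} {v : EuclideanSpace ℝ (Fin d)} {t : ℝ}
    (h : HasLeftDeriv c v t) (g : N) : HasLeftDeriv (fun s => g * c s) v t := by
  have h1 := (hasModelDerivAt_mul_left d g (c t)).comp h rfl
  rw [toSpanSingleton_comp] at h1
  rw [HasLeftDeriv, ← modelDeriv_mul_left_leftField]
  exact h1

/-- Moves the curve to the identity, where the trivialization is the identity map and one chart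
suffices for all computations. -/
theorem hasLeftDeriv_iff {c : ℝ → N} {v : EuclideanSpace ℝ (Fin d)} {t : ℝ} :
    HasLeftDeriv c v t ↔ HasModelDerivAt 𝓘(ℝ, ℝ) (𝓡 d) (fun s => (c t)⁻¹ * c s) t
      (ContinuousLinearMap.toSpanSingleton ℝ v) := by
  constructor
  · intro h
    have h1 := h.const_mul (c t)⁻¹
    rw [HasLeftDeriv, inv_mul_cancel, leftField_one] at h1
    exact h1
  · intro h
    have h1 := (hasModelDerivAt_leftField (c t)).comp h (inv_mul_cancel _)
    rw [toSpanSingleton_comp] at h1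
    refine h1.congr (Filter.Eventually.of_forall fun s => ?_)
    simp

/-- The adjoint representation of a Lie group. -/
def Ad (g : N) : EuclideanSpace ℝ (Fin d) →L[ℝ] EuclideanSpace ℝ (Fin d) :=
  modelDeriv (𝓡 d) (𝓡 d) (fun h : N => g * h * g⁻¹) 1

theorem hasModelDerivAt_Ad (g : N) :
    HasModelDerivAt (𝓡 d) (𝓡 d) (fun h : N => g * h * g⁻¹) 1 (Ad g) :=
  hasModelDerivAt_of_contMDiffAt (n := ∞)
    ((contMDiff_mul_right (a := g⁻¹)).comp (contMDiff_mul_left (a := g))).contMDiffAt (by simp)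

theorem Ad_mul (g h : N) : Ad (d := d) (g * h) = (Ad g).comp (Ad h) := by
  refine (hasModelDerivAt_Ad (g * h)).unique ?_
  refine ((hasModelDerivAt_Ad g).comp (hasModelDerivAt_Ad h) (by simp)).congr ?_
  exact Filter.Eventually.of_forall fun k => by simp [mul_assoc]

theorem Ad_one : Ad (d := d) (1 : N) = ContinuousLinearMap.id ℝ _ := by
  refine (hasModelDerivAt_Ad (1 : N)).unique ?_
  exact (hasModelDerivAt_id (1 : N)).congr (Filter.Eventually.of_forall fun k => by simp)

theorem hasModelDerivAt_curve_oneChart {c : ℝ → N} {v : EuclideanSpace ℝ (Fin d)} {t : ℝ}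
    (h : HasModelDerivAt 𝓘(ℝ, ℝ) (𝓡 d) c t (ContinuousLinearMap.toSpanSingleton ℝ v))
    (ht : c t = 1) : HasDerivAt (fun s => oneChart d N (c s)) v t := by
  have h1 := (hasModelDerivAt_oneChart d N).comp h ht
  rw [ContinuousLinearMap.id_comp] at h1
  exact (hasModelDerivAt_iff_hasFDerivAt.mp h1).hasDerivAt.congr_deriv (by simp)

theorem hasModelDerivAt_curve_of_oneChart {c : ℝ → N} {v : EuclideanSpace ℝ (Fin d)} {t : ℝ}
    (h : HasDerivAt (fun s => oneChart d N (c s)) v t) (hc : ContinuousAt c t)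
    (ht : c t = 1) :
    HasModelDerivAt 𝓘(ℝ, ℝ) (𝓡 d) c t (ContinuousLinearMap.toSpanSingleton ℝ v) := by
  have h1 := (hasModelDerivAt_oneChart_symm d N).comp
    (hasModelDerivAt_iff_hasFDerivAt.mpr h.hasFDerivAt) (by simp [ht])
  rw [ContinuousLinearMap.id_comp] at h1
  refine h1.congr ?_
  have h2 : (oneChart d N).source ∈ 𝓝 (c t) := by
    rw [ht]; exact oneChart_source_mem_nhds d N (oneChart_one_mem d N)
  filter_upwards [hc.eventually h2] with s hs
  exact ((oneChart d N).left_inv hs).symm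

/-- Multiplication by `1` on either side is the identity, so both partial derivatives are the
identity. -/
theorem hasFDerivAt_uncurry_chartMul :
    HasFDerivAt (Function.uncurry (chartMul d N))
      (ContinuousLinearMap.fst ℝ _ _ + ContinuousLinearMap.snd ℝ _ _)
      (oneCoord d N, oneCoord d N) := by
  have h := ((contDiffAt_chartMul d N (oneCoord_mem d N)).differentiableAt (by simp)).hasFDerivAt
  have hl : HasFDerivAt (fun u => Function.uncurry (chartMul d N) (u, oneCoord d N))
      (ContinuousLinearMap.id ℝ _) (oneCoord d N) := by
    refine (hasFDerivAt_id _).congr_of_eventuallyEq ?_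
    filter_upwards [oneChart_target_mem_nhds d N (oneCoord_mem d N)] with u hu
    simp [chartMul, (oneChart d N).right_inv hu]
  have hr : HasFDerivAt (fun u => Function.uncurry (chartMul d N) (oneCoord d N, u))
      (ContinuousLinearMap.id ℝ _) (oneCoord d N) := by
    refine (hasFDerivAt_id _).congr_of_eventuallyEq ?_
    filter_upwards [oneChart_target_mem_nhds d N (oneCoord_mem d N)] with u hu
    simp [chartMul, (oneChart d N).right_inv hu]
  have hl' := (h.comp (f := fun u => (u, oneCoord d N)) (oneCoord d N)
    (hasFDerivAt_prodMk_left _ _)).unique hl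
  have hr' := (h.comp (f := fun u => (oneCoord d N, u)) (oneCoord d N)
    (hasFDerivAt_prodMk_right _ _)).unique hr
  have key : fderiv ℝ (Function.uncurry (chartMul d N)) (oneCoord d N, oneCoord d N) =
      ContinuousLinearMap.fst ℝ _ _ + ContinuousLinearMap.snd ℝ _ _ := by
    refine ContinuousLinearMap.ext fun p => ?_
    obtain ⟨v, w⟩ := p
    have h1 := congrArg (fun L => L v) hl'
    have h2 := congrArg (fun L => L w) hr'
    simp only [ContinuousLinearMap.comp_apply, ContinuousLinearMap.inl_apply,
      ContinuousLinearMap.inr_apply, ContinuousLinearMap.id_apply] at h1 h2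
    have h3 : ((v, w) : EuclideanSpace ℝ (Fin d) × EuclideanSpace ℝ (Fin d)) =
        (v, 0) + (0, w) := by simp
    rw [h3, map_add, h1, h2]
    simp
  rwa [key] at h

theorem hasModelDerivAt_mul_curves [IsTopologicalGroup N] {c b : ℝ → N}
    {v w : EuclideanSpace ℝ (Fin d)} {t : ℝ}
    (hc : HasModelDerivAt 𝓘(ℝ, ℝ) (𝓡 d) c t (ContinuousLinearMap.toSpanSingleton ℝ v))
    (hb : HasModelDerivAt 𝓘(ℝ, ℝ) (𝓡 d) b t (ContinuousLinearMap.toSpanSingleton ℝ w))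
    (hct : c t = 1) (hbt : b t = 1) :
    HasModelDerivAt 𝓘(ℝ, ℝ) (𝓡 d) (fun s => c s * b s) t
      (ContinuousLinearMap.toSpanSingleton ℝ (v + w)) := by
  refine hasModelDerivAt_curve_of_oneChart ?_ (hc.continuousAt.mul hb.continuousAt)
    (by simp [hct, hbt])
  have h1 := hasModelDerivAt_curve_oneChart hc hct
  have h2 := hasModelDerivAt_curve_oneChart hb hbt
  have h3 : HasFDerivAt (Function.uncurry (chartMul d N))
      (ContinuousLinearMap.fst ℝ _ _ + ContinuousLinearMap.snd ℝ _ _)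
      (oneChart d N (c t), oneChart d N (b t)) := by
    rw [hct, hbt]; exact hasFDerivAt_uncurry_chartMul
  have h4 := h3.comp_hasDerivAt t (h1.prodMk h2)
  refine (h4.congr_deriv (by simp)).congr_of_eventuallyEq ?_
  have hs : (oneChart d N).source ∈ 𝓝 (1 : N) :=
    oneChart_source_mem_nhds d N (oneChart_one_mem d N)
  filter_upwards [hc.continuousAt.eventually (by rw [hct]; exact hs),
    hb.continuousAt.eventually (by rw [hbt]; exact hs)] with s h5 h6
  simp [chartMul, (oneChart d N).left_inv h5, (oneChart d N).left_inv h6]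

/-- `(c b)(t)⁻¹ (c b)(s)` is the conjugate of `c(t)⁻¹ c(s)` by `b(t)⁻¹`, times `b(t)⁻¹ b(s)`. At the
identity the velocities of a product add. -/
theorem HasLeftDeriv.mul [IsTopologicalGroup N] {c b : ℝ → N} {v w : EuclideanSpace ℝ (Fin d)}
    {t : ℝ} (hc : HasLeftDeriv c v t) (hb : HasLeftDeriv b w t) :
    HasLeftDeriv (fun s => c s * b s) (Ad (b t)⁻¹ v + w) t := by
  rw [hasLeftDeriv_iff] at hc hb ⊢
  have h1 := (hasModelDerivAt_Ad (b t)⁻¹).comp hc (by simp)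
  rw [toSpanSingleton_comp] at h1
  refine (hasModelDerivAt_mul_curves h1 hb (by simp) (by simp)).congr ?_
  refine Filter.Eventually.of_forall fun s => ?_
  simp [mul_assoc]

theorem HasLeftDeriv.scomp {c : ℝ → N} {v : EuclideanSpace ℝ (Fin d)} {f : ℝ → ℝ} {f' t : ℝ}
    (hc : HasLeftDeriv c v (f t)) (hf : HasDerivAt f f' t) :
    HasLeftDeriv (fun s => c (f s)) (f' • v) t := by
  have h := HasModelDerivAt.comp hc (hasModelDerivAt_iff_hasFDerivAt.mpr hf.hasFDerivAt) rfl
  refine cast ?_ h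
  unfold HasLeftDeriv
  congr 1
  ext1
  simp

theorem HasLeftDeriv.continuousAt {c : ℝ → N} {v : EuclideanSpace ℝ (Fin d)} {t : ℝ}
    (hc : HasLeftDeriv c v t) : ContinuousAt c t := HasModelDerivAt.continuousAt hc

theorem isMIntegralCurve_of_hasLeftDeriv {c : ℝ → N} {v : EuclideanSpace ℝ (Fin d)}
    (h : ∀ t, HasLeftDeriv c v t) :
    IsMIntegralCurve (I := 𝓡 d) c (fun g => mulInvariantVectorField (I := 𝓡 d) v g) := by
  intro t
  refine cast ?_ (h t)
  unfold HasLeftDeriv HasModelDerivAt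
  congr 1

theorem hasLeftDeriv_of_isMIntegralCurve {c : ℝ → N} {v : EuclideanSpace ℝ (Fin d)}
    (h : IsMIntegralCurve (I := 𝓡 d) c (fun g => mulInvariantVectorField (I := 𝓡 d) v g))
    (t : ℝ) : HasLeftDeriv c v t := by
  refine cast ?_ (h t)
  unfold HasLeftDeriv HasModelDerivAt
  congr 1

theorem contMDiff_one_mulInvariantVectorField (v : EuclideanSpace ℝ (Fin d)) :
    ContMDiff (𝓡 d) (𝓡 d).tangent 1 (fun g : N =>
      (⟨g, mulInvariantVectorField (I := 𝓡 d) v g⟩ : TangentBundle (𝓡 d) N)) :=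
  (contMDiff_mulInvariantVectorField (I := 𝓡 d) (G := N) v).of_le
    (by rw [minSmoothness_of_isRCLikeNormedField]; norm_num)

theorem eq_of_hasLeftDeriv [T2Space N] {c b : ℝ → N} {v : EuclideanSpace ℝ (Fin d)}
    (hc : ∀ t, HasLeftDeriv c v t) (hb : ∀ t, HasLeftDeriv b v t) (h0 : c 0 = b 0) : c = b := by
  have : IsManifold (𝓡 d) 1 N := IsManifold.of_le (n := ∞) (by simp)
  exact isMIntegralCurve_Ioo_eq_of_contMDiff_boundaryless (t₀ := 0)
    (contMDiff_one_mulInvariantVectorField v) (isMIntegralCurve_of_hasLeftDeriv hc)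
    (isMIntegralCurve_of_hasLeftDeriv hb) h0

end LeftDerivative

/-! ### The differential of the adjoint representation -/

section AdjointDerivative

variable {d : ℕ} {N : Type*} [Group N] [TopologicalSpace N] [IsTopologicalGroup N]
  [ChartedSpace (EuclideanSpace ℝ (Fin d)) N] [LieGroup (𝓡 d) ∞ N]

variable (d N) in
/-- The map `(a, c), b ↦ a b c` of a Lie group in the chart at the identity. -/
def chartMul₃ (p : EuclideanSpace ℝ (Fin d) × EuclideanSpace ℝ (Fin d))
    (b : EuclideanSpace ℝ (Fin d)) : EuclideanSpace ℝ (Fin d) :=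
  oneChart d N ((oneChart d N).symm p.1 * (oneChart d N).symm b * (oneChart d N).symm p.2)

theorem contDiffAt_chartMul₃ :
    ContDiffAt ℝ ∞ (Function.uncurry (chartMul₃ d N))
      ((oneCoord d N, oneCoord d N), oneCoord d N) := by
  rw [← contMDiffAt_iff_contDiffAt]
  have ho := contMDiffAt_oneChart_symm d N (oneCoord_mem d N)
  refine ContMDiffAt.comp _ (contMDiffAt_oneChart d N ?_) ((ContMDiffAt.mul ?_ ?_).mul ?_)
  · simpa only [oneChart_symm_oneCoord, mul_one] using oneChart_one_mem d N
  · exact ContMDiffAt.comp ((oneCoord d N, oneCoord d N), oneCoord d N) ho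
      (contDiffAt_fst.comp _ contDiffAt_fst).contMDiffAt
  · exact ContMDiffAt.comp ((oneCoord d N, oneCoord d N), oneCoord d N) ho
      contDiffAt_snd.contMDiffAt
  · exact ContMDiffAt.comp ((oneCoord d N, oneCoord d N), oneCoord d N) ho
      (contDiffAt_snd.comp _ contDiffAt_fst).contMDiffAt

theorem Ad_eq_fderiv {g : N} (hg : g ∈ (oneChart d N).source) (hg' : g⁻¹ ∈ (oneChart d N).source) :
    Ad g = fderiv ℝ (chartMul₃ d N (oneChart d N g, oneChart d N g⁻¹)) (oneCoord d N) := by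
  have h1 := (hasModelDerivAt_oneChart d N).comp ((hasModelDerivAt_Ad g).comp
    (hasModelDerivAt_oneChart_symm d N) (by simp)) (by simp)
  rw [ContinuousLinearMap.id_comp, ContinuousLinearMap.comp_id] at h1
  have h2 := hasModelDerivAt_iff_hasFDerivAt.mp h1
  rw [← h2.fderiv]
  congr 1
  funext u
  simp [chartMul₃, (oneChart d N).left_inv hg, (oneChart d N).left_inv hg']

/-- Regard `Ad (c s) y` as the value at `(c s, c (-s))` of the derivative of `b ↦ a b a'` in the
direction `y`. The left factor has velocity `x` and the right one `-x`, so the derivative is the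
difference of the two partial derivatives, which `lieBr_eq` identifies with the bracket. -/
theorem hasDerivAt_Ad {c : ℝ → N} {x : EuclideanSpace ℝ (Fin d)} (hc : HasLeftDeriv c x 0)
    (h0 : c 0 = 1) (hinv : ∀ s, c (-s) = (c s)⁻¹) (y : EuclideanSpace ℝ (Fin d)) :
    HasDerivAt (fun s => Ad (c s) y) (lieBr d N x y) 0 := by
  set A : EuclideanSpace ℝ (Fin d) × EuclideanSpace ℝ (Fin d) → EuclideanSpace ℝ (Fin d) :=
    fun p => fderiv ℝ (chartMul₃ d N p) (oneCoord d N) y with hA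
  have hAd : DifferentiableAt ℝ A (oneCoord d N, oneCoord d N) := by
    have h := ContDiffAt.fderiv (m := 1) contDiffAt_chartMul₃
      (contDiffAt_const (c := oneCoord d N)) (by exact WithTop.coe_le_coe.mpr le_top)
    exact (h.differentiableAt (by simp)).clm_apply (differentiableAt_const y)
  have hc' : HasModelDerivAt 𝓘(ℝ, ℝ) (𝓡 d) c 0 (ContinuousLinearMap.toSpanSingleton ℝ x) := by
    have := hc
    rw [HasLeftDeriv, h0, leftField_one] at this
    exact this
  have h1 := hasModelDerivAt_curve_oneChart hc' h0
  have h2 : HasDerivAt (fun s => oneChart d N (c (-s))) (-x) 0 := by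
    have h3 : HasDerivAt (fun s : ℝ => -s) (-1) 0 := hasDerivAt_neg 0
    have h4 : HasDerivAt (fun s => oneChart d N (c s)) x (-0) := by rwa [neg_zero]
    exact (h4.scomp (0 : ℝ) h3).congr_deriv (by simp)
  have hA' : HasFDerivAt A (fderiv ℝ A (oneCoord d N, oneCoord d N))
      (oneChart d N (c 0), oneChart d N (c (-0))) := by
    rw [neg_zero, h0]; exact hAd.hasFDerivAt
  have h5 := hA'.comp_hasDerivAt (0 : ℝ) (h1.prodMk h2)
  have hs : (oneChart d N).source ∈ 𝓝 (c 0) := by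
    rw [h0]; exact oneChart_source_mem_nhds d N (oneChart_one_mem d N)
  have hs' : (oneChart d N).source ∈ 𝓝 (c 0)⁻¹ := by
    rw [h0, inv_one]; exact oneChart_source_mem_nhds d N (oneChart_one_mem d N)
  refine (h5.congr_of_eventuallyEq ?_).congr_deriv ?_
  · filter_upwards [hc.continuousAt.eventually hs, hc.continuousAt.inv.eventually hs']
      with s h6 h7
    rw [Ad_eq_fderiv h6 h7]
    simp [hA, hinv]
  · have hl : fderiv ℝ A (oneCoord d N, oneCoord d N) (x, 0) =
        fderiv ℝ (fun u => chartLeft d N u y) (oneCoord d N) x := by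
      have h := (hAd.hasFDerivAt.comp (f := fun u => (u, oneCoord d N)) (oneCoord d N)
        (hasFDerivAt_prodMk_left _ _)).fderiv
      have h' : (A ∘ fun u => (u, oneCoord d N)) = fun u => chartLeft d N u y := by
        funext u
        have : chartMul₃ d N (u, oneCoord d N) = chartMul d N u := by
          funext b; simp [chartMul₃, chartMul]
        simp [hA, this, chartLeft]
      rw [h'] at h
      rw [h]; simp
    -- For the right factor, exchanging the order of differentiation replaces the derivative of a
    -- right translation by that of a left-invariant field.
    have hr : fderiv ℝ A (oneCoord d N, oneCoord d N) (0, x) =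
        fderiv ℝ (fun u => chartLeft d N u x) (oneCoord d N) y := by
      have h := (hAd.hasFDerivAt.comp (f := fun u => (oneCoord d N, u)) (oneCoord d N)
        (hasFDerivAt_prodMk_right _ _)).fderiv
      have h' : (A ∘ fun u => (oneCoord d N, u)) =
          fun u => fderiv ℝ (fun b => Function.uncurry (chartMul d N) (b, u)) (oneCoord d N) y := by
        funext u
        have : chartMul₃ d N (oneCoord d N, u) = fun b => chartMul d N b u := by
          funext b; simp [chartMul₃, chartMul]
        simp [hA, this]
      rw [h'] at h
      have h6 := fderiv_fderiv_comm (f := Function.uncurry (chartMul d N))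
        ((contDiffAt_chartMul d N (oneCoord_mem d N)).of_le
          (by exact WithTop.coe_le_coe.mpr le_top)) y x
      rw [h] at h6
      refine (Eq.trans ?_ h6)
      simp
    have h8 : ((x, -x) : EuclideanSpace ℝ (Fin d) × EuclideanSpace ℝ (Fin d)) =
        (x, 0) - (0, x) := by simp
    rw [h8, map_sub, hl, hr, lieBr_eq]

end AdjointDerivative

/-! ### One-parameter subgroups, the exponential map and the Baker-Campbell-Hausdorff formula -/

section OneParameter

variable {d : ℕ} {N : Type*} [Group N] [TopologicalSpace N] [IsTopologicalGroup N] [T2Space N]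
  [ChartedSpace (EuclideanSpace ℝ (Fin d)) N] [LieGroup (𝓡 d) ∞ N]

/-- Left translates of a local integral curve through `1` are integral curves on the same interval.
The existence time is thus uniform, and the curve extends to the whole line. -/
theorem exists_hasLeftDeriv (x : EuclideanSpace ℝ (Fin d)) :
    ∃ c : ℝ → N, c 0 = 1 ∧ ∀ t, HasLeftDeriv c x t := by
  have : IsManifold (𝓡 d) 1 N := IsManifold.of_le (n := ∞) (by simp)
  have hv := contMDiff_one_mulInvariantVectorField (N := N) x
  obtain ⟨γ, h0, hγ⟩ := exists_isMIntegralCurveAt_of_contMDiffAt_boundaryless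
    (t₀ := 0) (hv.contMDiffAt (x := 1))
  rw [isMIntegralCurveAt_iff'] at hγ
  obtain ⟨ε, hε, hγ⟩ := hγ
  rw [Real.ball_eq_Ioo, zero_sub, zero_add] at hγ
  have hl : ∀ t ∈ Set.Ioo (-ε) ε, HasLeftDeriv γ x t := fun t ht => by
    refine cast ?_ ((hγ t ht).hasMFDerivAt (Ioo_mem_nhds ht.1 ht.2))
    unfold HasLeftDeriv HasModelDerivAt
    congr 1
  have key : ∀ g : N, ∃ c : ℝ → N, c 0 = g ∧ IsMIntegralCurveOn (I := 𝓡 d) c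
      (fun g => mulInvariantVectorField (I := 𝓡 d) x g) (Set.Ioo (-ε) ε) := fun g => by
    refine ⟨fun s => g * γ s, by simp [h0], fun t ht => HasMFDerivAt.hasMFDerivWithinAt ?_⟩
    refine cast ?_ ((hl t ht).const_mul g)
    unfold HasLeftDeriv HasModelDerivAt
    congr 1
  obtain ⟨c, hc0, hc⟩ := exists_isMIntegralCurve_of_isMIntegralCurveOn hv hε key 1
  exact ⟨c, hc0, hasLeftDeriv_of_isMIntegralCurve hc⟩

variable (N) in
/-- The one-parameter subgroup with a given initial velocity. -/
def oneParam (x : EuclideanSpace ℝ (Fin d)) : ℝ → N := (exists_hasLeftDeriv x).choose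

@[simp] theorem oneParam_zero (x : EuclideanSpace ℝ (Fin d)) : oneParam N x 0 = 1 :=
  (exists_hasLeftDeriv x).choose_spec.1

theorem hasLeftDeriv_oneParam (x : EuclideanSpace ℝ (Fin d)) (t : ℝ) :
    HasLeftDeriv (oneParam N x) x t :=
  (exists_hasLeftDeriv x).choose_spec.2 t

theorem eq_oneParam {c : ℝ → N} {x : EuclideanSpace ℝ (Fin d)} (h : ∀ t, HasLeftDeriv c x t)
    (h0 : c 0 = 1) : c = oneParam N x :=
  eq_of_hasLeftDeriv h (hasLeftDeriv_oneParam x) (by simp [h0])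

theorem oneParam_add (x : EuclideanSpace ℝ (Fin d)) (s t : ℝ) :
    oneParam N x (s + t) = oneParam N x s * oneParam N x t := by
  have h1 : ∀ t, HasLeftDeriv (fun t => oneParam N x (s + t)) x t := fun t => by
    have h := (hasLeftDeriv_oneParam (N := N) x (s + t)).scomp ((hasDerivAt_id t).const_add s)
    rwa [one_smul] at h
  have h2 : ∀ t, HasLeftDeriv (fun t => oneParam N x s * oneParam N x t) x t := fun t =>
    (hasLeftDeriv_oneParam x t).const_mul _
  exact congrFun (eq_of_hasLeftDeriv h1 h2 (by simp)) t

theorem oneParam_smul (x : EuclideanSpace ℝ (Fin d)) (s t : ℝ) :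
    oneParam N (s • x) t = oneParam N x (s * t) := by
  refine (congrFun (eq_oneParam (c := fun t => oneParam N x (s * t)) (fun t => ?_) (by simp))
    t).symm
  have h := (hasLeftDeriv_oneParam (N := N) x (s * t)).scomp ((hasDerivAt_id t).const_mul s)
  rwa [mul_one] at h

variable (N) in
/-- The exponential map of a Lie group. -/
def gexp (x : EuclideanSpace ℝ (Fin d)) : N := oneParam N x 1

theorem gexp_smul (x : EuclideanSpace ℝ (Fin d)) (t : ℝ) : gexp N (t • x) = oneParam N x t := by
  rw [gexp, oneParam_smul, mul_one]

theorem hasLeftDeriv_gexp (x : EuclideanSpace ℝ (Fin d)) (t : ℝ) :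
    HasLeftDeriv (fun s => gexp N (s • x)) x t := by
  simp only [gexp_smul]
  exact hasLeftDeriv_oneParam x t

theorem gexp_add_smul (x : EuclideanSpace ℝ (Fin d)) (s t : ℝ) :
    gexp N ((s + t) • x) = gexp N (s • x) * gexp N (t • x) := by
  simp only [gexp_smul, oneParam_add]

@[simp] theorem gexp_zero : gexp N (0 : EuclideanSpace ℝ (Fin d)) = 1 := by
  rw [← zero_smul ℝ (0 : EuclideanSpace ℝ (Fin d)), gexp_smul, oneParam_zero]

theorem gexp_neg (x : EuclideanSpace ℝ (Fin d)) : gexp N (-x) = (gexp N x)⁻¹ := by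
  rw [eq_inv_iff_mul_eq_one]
  have h := gexp_add_smul (N := N) x (-1) 1
  rw [neg_add_cancel, zero_smul, gexp_zero, neg_one_smul, one_smul] at h
  exact h.symm

theorem hasDerivAt_Ad_gexp (x y : EuclideanSpace ℝ (Fin d)) (t : ℝ) :
    HasDerivAt (fun s => Ad (gexp N (s • x)) y) (Ad (gexp N (t • x)) (lieBr d N x y)) t := by
  have h1 := hasDerivAt_Ad (hasLeftDeriv_gexp (N := N) x 0) (by simp)
    (fun s => by rw [neg_smul, gexp_neg]) y
  have h2 : HasDerivAt (fun s : ℝ => s - t) 1 t := (hasDerivAt_id t).sub_const t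
  have h3 : HasDerivAt (fun s => Ad (gexp N (s • x)) y) (lieBr d N x y) (t - t) := by
    rwa [sub_self]
  have h4 := (Ad (gexp N (t • x))).hasFDerivAt.comp_hasDerivAt t (HasDerivAt.scomp (h := fun s : ℝ => s - t) t h3 h2)
  rw [one_smul] at h4
  refine h4.congr_of_eventuallyEq (Filter.Eventually.of_forall fun s => ?_)
  have h5 : gexp N (s • x) = gexp N (t • x) * gexp N ((s - t) • x) := by
    rw [← gexp_add_smul]; congr 2; ring
  simp [h5, Ad_mul]

variable (d N) in
theorem lieBr_self (x : EuclideanSpace ℝ (Fin d)) : lieBr d N x x = 0 :=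
  lie_self (L := GroupLieAlgebra (𝓡 d) N) x

variable (d N) in
/-- The Lie bracket as a continuous bilinear map on the model space. -/
def lieBrL : EuclideanSpace ℝ (Fin d) →L[ℝ] EuclideanSpace ℝ (Fin d) →L[ℝ]
    EuclideanSpace ℝ (Fin d) :=
  LinearMap.toContinuousLinearMap
    ((LinearMap.toContinuousLinearMap (𝕜 := ℝ) (E := EuclideanSpace ℝ (Fin d))
      (F' := EuclideanSpace ℝ (Fin d))).toLinearMap ∘ₗ
      LinearMap.mk₂ ℝ (lieBr d N)
        (fun x y z => add_lie (L := GroupLieAlgebra (𝓡 d) N) (M := GroupLieAlgebra (𝓡 d) N) x y z)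
        (fun c x y => smul_lie (R := ℝ) (L := GroupLieAlgebra (𝓡 d) N)
          (M := GroupLieAlgebra (𝓡 d) N) c x y)
        (fun x y z => lie_add (L := GroupLieAlgebra (𝓡 d) N) (M := GroupLieAlgebra (𝓡 d) N) x y z)
        (fun c x y => lie_smul (R := ℝ) (L := GroupLieAlgebra (𝓡 d) N)
          (M := GroupLieAlgebra (𝓡 d) N) c x y))

variable (d N) in
theorem lieBr_eq_lieBrL (x y : EuclideanSpace ℝ (Fin d)) : lieBr d N x y = lieBrL d N x y := rfl

theorem lieBrL_self (x : EuclideanSpace ℝ (Fin d)) : lieBrL d N x x = 0 := lieBr_self d N x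

theorem lieBrL_skew (x y : EuclideanSpace ℝ (Fin d)) : lieBrL d N x y = -lieBrL d N y x := by
  have h := lieBrL_self (N := N) (x + y)
  simp only [map_add, _root_.add_apply, lieBrL_self, zero_add, add_zero] at h
  exact eq_neg_of_add_eq_zero_right h

variable (d N) in
/-- The Lie algebra is nilpotent of step at most 2. -/
def IsTwoStep : Prop := ∀ x y z : EuclideanSpace ℝ (Fin d), lieBrL d N (lieBrL d N x y) z = 0

theorem IsTwoStep.right (h : IsTwoStep d N) (x y z : EuclideanSpace ℝ (Fin d)) :
    lieBrL d N x (lieBrL d N y z) = 0 := by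
  rw [lieBrL_skew, h, neg_zero]

theorem Ad_gexp_of_lieBrL_eq_zero {x y : EuclideanSpace ℝ (Fin d)} (h : lieBrL d N x y = 0) :
    Ad (gexp N x) y = y := by
  have h1 : ∀ t, HasDerivAt (fun s : ℝ => Ad (gexp N (s • x)) y) 0 t := fun t => by
    have h2 := hasDerivAt_Ad_gexp (N := N) x y t
    rwa [lieBr_eq_lieBrL, h, map_zero] at h2
  have h3 := is_const_of_deriv_eq_zero (fun t => (h1 t).differentiableAt)
    (fun t => (h1 t).deriv) 1 0
  simpa [Ad_one] using h3

/-- The derivative of `Ad (exp s x) y` is `Ad (exp s x) [x, y]`, which is the constant `[x, y]`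
because `[x, y]` commutes with `x`. -/
theorem Ad_gexp (h : IsTwoStep d N) (x y : EuclideanSpace ℝ (Fin d)) :
    Ad (gexp N x) y = y + lieBrL d N x y := by
  have h1 : ∀ t, HasDerivAt (fun s : ℝ => Ad (gexp N (s • x)) y - s • lieBrL d N x y) 0 t :=
    fun t => by
    have h2 := (hasDerivAt_Ad_gexp (N := N) x y t).sub
      ((hasDerivAt_id t).smul_const (lieBrL d N x y))
    refine h2.congr_deriv ?_
    rw [lieBr_eq_lieBrL, Ad_gexp_of_lieBrL_eq_zero (by simp [h.right])]
    simp
  have h3 := is_const_of_deriv_eq_zero (fun t => (h1 t).differentiableAt)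
    (fun t => (h1 t).deriv) 1 0
  simp only [one_smul, zero_smul, sub_zero, gexp_zero, Ad_one, ContinuousLinearMap.id_apply] at h3
  exact eq_add_of_sub_eq h3

/-- The Baker-Campbell-Hausdorff multiplication. -/
def bch (x y : EuclideanSpace ℝ (Fin d)) : EuclideanSpace ℝ (Fin d) :=
  x + y + (1 / 2 : ℝ) • lieBrL d N x y

/-- The curve `exp(s x) exp(s y) exp(-s²/2 [x, y])` has constant left derivative: at time `t` the
first two factors give `x + y + t[x, y]` by the product rule and the last one `-t[x, y]`. By
uniqueness it is the one-parameter group of `x + y`. -/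
theorem gexp_add (h : IsTwoStep d N) (x y : EuclideanSpace ℝ (Fin d)) :
    gexp N (x + y) = gexp N x * gexp N y * gexp N (-(1 / 2 : ℝ) • lieBrL d N x y) := by
  have h1 : ∀ t, HasLeftDeriv (fun s => gexp N (s • x) * gexp N (s • y) *
      gexp N ((-(s ^ 2 / 2)) • lieBrL d N x y)) (x + y) t := fun t => by
    have hA := (hasLeftDeriv_gexp (N := N) x t).mul (hasLeftDeriv_gexp y t)
    have hf : HasDerivAt (fun s : ℝ => -(s ^ 2 / 2)) (-t) t := by
      have := ((hasDerivAt_pow 2 t).div_const 2).neg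
      refine this.congr_deriv ?_
      simp
    have hC := HasLeftDeriv.scomp (f := fun s : ℝ => -(s ^ 2 / 2))
      (hasLeftDeriv_gexp (N := N) (lieBrL d N x y) (-(t ^ 2 / 2))) hf
    have hP := hA.mul hC
    refine cast ?_ hP
    congr 1
    rw [← gexp_neg, ← gexp_neg, Ad_gexp h, Ad_gexp h, lieBrL_skew x y]
    simp only [map_neg, map_smul, _root_.neg_apply, _root_.smul_apply,
      h y x, smul_zero, neg_zero, add_zero]
    module
  have h2 := congrFun (eq_of_hasLeftDeriv h1 (hasLeftDeriv_gexp (x + y)) (by simp)) 1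
  simp only [one_smul, one_pow] at h2
  rw [← h2]

theorem gexp_add_of_lieBrL_eq_zero (h : IsTwoStep d N) {x y : EuclideanSpace ℝ (Fin d)}
    (hxy : lieBrL d N x y = 0) : gexp N (x + y) = gexp N x * gexp N y := by
  rw [gexp_add h, hxy, smul_zero, gexp_zero, mul_one]

/-- The term `½[x, y]` is central, so its exponential splits off and cancels the correction in
`gexp_add`. -/
theorem gexp_bch (h : IsTwoStep d N) (x y : EuclideanSpace ℝ (Fin d)) :
    gexp N (bch (N := N) x y) = gexp N x * gexp N y := by
  rw [bch, gexp_add_of_lieBrL_eq_zero h (by simp [h.right]), gexp_add h, mul_assoc,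
    ← gexp_add_smul]
  simp

end OneParameter

/-! ### Smoothness of the exponential map -/

section ExpSmooth

variable {d : ℕ} {N : Type*} [Group N] [TopologicalSpace N] [IsTopologicalGroup N] [T2Space N]
  [ChartedSpace (EuclideanSpace ℝ (Fin d)) N] [LieGroup (𝓡 d) ∞ N]

theorem HasLeftDeriv.hasDerivAt_oneChart {c : ℝ → N} {v : EuclideanSpace ℝ (Fin d)} {t : ℝ}
    (hc : HasLeftDeriv c v t) (ht : c t ∈ (oneChart d N).source) :
    HasDerivAt (fun s => oneChart d N (c s)) (chartLeft d N (oneChart d N (c t)) v) t := by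
  have hu := (oneChart d N).map_source ht
  have h1 := hasModelDerivAt_of_contMDiffAt (contMDiffAt_oneChart d N ht) (by simp)
  have h2 := hasModelDerivAt_of_contMDiffAt (contMDiffAt_oneChart_symm d N hu) (by simp)
  have h3 := h1.comp h2 ((oneChart d N).left_inv ht)
  have h4 : HasModelDerivAt 𝓘(ℝ, EuclideanSpace ℝ (Fin d)) 𝓘(ℝ, EuclideanSpace ℝ (Fin d))
      (oneChart d N ∘ (oneChart d N).symm) (oneChart d N (c t)) (ContinuousLinearMap.id ℝ _) := by
    refine (hasModelDerivAt_id _).congr ?_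
    filter_upwards [oneChart_target_mem_nhds d N hu] with u hu
    exact (oneChart d N).right_inv hu
  have h5 := h3.unique h4
  have h6 := oneChart_symm_modelDeriv d N hu
  rw [(oneChart d N).left_inv ht] at h6
  have h7 := h1.comp hc rfl
  rw [toSpanSingleton_comp] at h7
  refine (hasModelDerivAt_iff_hasFDerivAt.mp h7).hasDerivAt.congr_deriv ?_
  rw [ContinuousLinearMap.toSpanSingleton_apply, one_smul, ← h6]
  exact congrArg (fun L => L (chartLeft d N (oneChart d N (c t)) v)) h5

/-- Bootstrapping: in the chart the curve solves `u' = chartLeft u x` with smooth coefficients, so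
each order of differentiability yields the next. -/
theorem contMDiff_gexp_smul (x : EuclideanSpace ℝ (Fin d)) :
    ContMDiff 𝓘(ℝ, ℝ) (𝓡 d) ∞ (fun t : ℝ => gexp N (t • x)) := by
  set c : ℝ → N := fun t => gexp N (t • x) with hc
  have hcont : Continuous c :=
    continuous_iff_continuousAt.mpr fun t => (hasLeftDeriv_gexp x t).continuousAt
  set I : Set ℝ := c ⁻¹' (oneChart d N).source with hI
  have hIo : IsOpen I := by
    rw [hI, oneChart, extChartAt_source]
    exact (chartAt (EuclideanSpace ℝ (Fin d)) (1 : N)).open_source.preimage hcont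
  set u : ℝ → EuclideanSpace ℝ (Fin d) := fun t => oneChart d N (c t) with hu
  have hd : ∀ t ∈ I, HasDerivAt u (chartLeft d N (u t) x) t := fun t ht =>
    (hasLeftDeriv_gexp x t).hasDerivAt_oneChart ht
  have hn : ∀ n : ℕ, ContDiffOn ℝ n u I := by
    intro n
    induction n with
    | zero =>
      exact contDiffOn_zero.mpr fun t ht => (hd t ht).continuousAt.continuousWithinAt
    | succ n ih =>
      have hd' : DifferentiableOn ℝ u I := fun t ht =>
        (hd t ht).differentiableAt.differentiableWithinAt
      push_cast
      rw [contDiffOn_succ_iff_deriv_of_isOpen hIo]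
      refine ⟨hd', by simp, ?_⟩
      have h : ContDiffOn ℝ n (fun t => chartLeft d N (u t) x) I := by
        intro t ht
        have h1 : ContDiffAt ℝ n (chartLeft d N) (u t) :=
          (contDiffAt_chartLeft d N ((oneChart d N).map_source ht)).of_le
            (by exact WithTop.coe_le_coe.mpr le_top)
        exact (h1.comp_contDiffWithinAt t (ih t ht)).clm_apply contDiffWithinAt_const
      exact h.congr fun t ht => (hd t ht).deriv
  have hc0 : ContMDiffAt 𝓘(ℝ, ℝ) (𝓡 d) ∞ c 0 := by
    have h0 : (0 : ℝ) ∈ I := by simpa [hI, hc] using oneChart_one_mem d N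
    have h1 : ContDiffAt ℝ ∞ u 0 :=
      (contDiffOn_infty.mpr hn).contDiffAt (hIo.mem_nhds h0)
    have h2 := ContMDiffAt.comp (0 : ℝ)
      (contMDiffAt_oneChart_symm d N ((oneChart d N).map_source h0)) h1.contMDiffAt
    refine h2.congr_of_eventuallyEq ?_
    filter_upwards [hIo.mem_nhds h0] with t ht
    exact ((oneChart d N).left_inv ht).symm
  -- Away from time `0` the curve is a left translate of itself near `0`.
  intro t
  have h1 : ContMDiffAt 𝓘(ℝ, ℝ) (𝓡 d) ∞ (fun s : ℝ => c t * c (s - t)) t := by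
    refine (contMDiff_mul_left (a := c t)).contMDiffAt.comp t ?_
    have h2 : ContMDiffAt 𝓘(ℝ, ℝ) (𝓡 d) ∞ c (t - t) := by rwa [sub_self]
    exact ContMDiffAt.comp (f := fun s : ℝ => s - t) t h2
      (contDiff_id.sub contDiff_const).contMDiff.contMDiffAt
  refine h1.congr_of_eventuallyEq (Filter.Eventually.of_forall fun s => ?_)
  simp only [hc, ← gexp_add_smul, add_sub_cancel]

variable {E' : Type*} [NormedAddCommGroup E'] [NormedSpace ℝ E']

theorem contMDiff_gexp_smul_comp {f : E' → ℝ} (hf : ContDiff ℝ ∞ f)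
    (x : EuclideanSpace ℝ (Fin d)) :
    ContMDiff 𝓘(ℝ, E') (𝓡 d) ∞ (fun p => gexp N (f p • x)) :=
  (contMDiff_gexp_smul x).comp hf.contMDiff

variable (d N) in
/-- The center of the Lie algebra, as a subspace of the model space. -/
def centerE : Submodule ℝ (EuclideanSpace ℝ (Fin d)) := LinearMap.ker (lieBrL d N).toLinearMap

theorem mem_centerE {x : EuclideanSpace ℝ (Fin d)} :
    x ∈ centerE d N ↔ ∀ y, lieBrL d N x y = 0 := by
  rw [centerE, LinearMap.mem_ker]
  exact ContinuousLinearMap.ext_iff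

/-- On the center `gexp` is a homomorphism, so in a basis it is a product of one-parameter groups.
-/
theorem contMDiff_gexp_comp_of_mem_center (h : IsTwoStep d N) {f : E' → EuclideanSpace ℝ (Fin d)}
    (hf : ContDiff ℝ ∞ f) (hfz : ∀ p, f p ∈ centerE d N) :
    ContMDiff 𝓘(ℝ, E') (𝓡 d) ∞ (fun p => gexp N (f p)) := by
  set b := Module.finBasis ℝ (centerE d N) with hb
  obtain ⟨pr, hpr⟩ := (centerE d N).subtype.exists_leftInverse_of_injective
    (Submodule.ker_subtype _)
  have hpr' : ∀ z : centerE d N, pr z = z := fun z => congrArg (fun L => L z) hpr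
  have hcoord : ∀ j, ContDiff ℝ ∞ (fun p => b.coord j (pr (f p))) := fun j =>
    (LinearMap.toContinuousLinearMap (b.coord j ∘ₗ pr)).contDiff.comp hf
  have hs : ∀ s : Finset (Fin (Module.finrank ℝ (centerE d N))),
      ContMDiff 𝓘(ℝ, E') (𝓡 d) ∞
        (fun p => gexp N (∑ j ∈ s, b.coord j (pr (f p)) • (b j : EuclideanSpace ℝ (Fin d)))) := by
    intro s
    induction s using Finset.induction_on with
    | empty => simpa using contMDiff_const
    | insert i s hi ih =>
      refine ((contMDiff_gexp_smul_comp (N := N) (hcoord i) (b i)).mul ih).congr fun p => ?_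
      rw [Finset.sum_insert hi, gexp_add_of_lieBrL_eq_zero h]
      · rfl
      rw [map_smul, _root_.smul_apply, mem_centerE.mp (b i).2, smul_zero]
  refine (hs Finset.univ).congr fun p => ?_
  have h1 := b.sum_repr (pr (f p))
  have h2 : pr (f p) = ⟨f p, hfz p⟩ := hpr' ⟨f p, hfz p⟩
  have h3 := congrArg Subtype.val h1
  rw [h2] at h3
  simp only [Submodule.coe_sum, Submodule.coe_smul] at h3
  simp only [Module.Basis.coord_apply, h2, h3]

/-- The coordinates are added one at a time. By `gexp_add` each step multiplies by a one-parameter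
group and by the exponential of a central bracket, both already known to be smooth. -/
theorem contMDiff_gexp (h : IsTwoStep d N) :
    ContMDiff 𝓘(ℝ, EuclideanSpace ℝ (Fin d)) (𝓡 d) ∞ (gexp (d := d) N) := by
  set e : Fin d → EuclideanSpace ℝ (Fin d) := fun i => EuclideanSpace.single i (1 : ℝ)
  have hcoord : ∀ i, ContDiff ℝ ∞ (fun p : EuclideanSpace ℝ (Fin d) => p i) := fun i =>
    (EuclideanSpace.proj i : EuclideanSpace ℝ (Fin d) →L[ℝ] ℝ).contDiff
  have hsum : ∀ s : Finset (Fin d), ContDiff ℝ ∞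
      (fun p : EuclideanSpace ℝ (Fin d) => ∑ i ∈ s, p i • e i) := fun s =>
    ContDiff.sum fun i _ => (hcoord i).smul contDiff_const
  have hs : ∀ s : Finset (Fin d), ContMDiff 𝓘(ℝ, EuclideanSpace ℝ (Fin d)) (𝓡 d) ∞
      (fun p : EuclideanSpace ℝ (Fin d) => gexp N (∑ i ∈ s, p i • e i)) := by
    intro s
    induction s using Finset.induction_on with
    | empty => simpa using contMDiff_const
    | insert i s hi ih =>
      have h1 : ContMDiff 𝓘(ℝ, EuclideanSpace ℝ (Fin d)) (𝓡 d) ∞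
          (fun p : EuclideanSpace ℝ (Fin d) =>
            gexp N (-(1 / 2 : ℝ) • lieBrL d N (p i • e i) (∑ i ∈ s, p i • e i))) := by
        refine contMDiff_gexp_comp_of_mem_center h ?_ fun p => ?_
        · have h3 (i : Fin d) : ContDiff ℝ ∞ (fun p : EuclideanSpace ℝ (Fin d) => p i • e i) :=
            (hcoord i).smul contDiff_const
          have h2 : ContDiff ℝ ∞ (fun p : EuclideanSpace ℝ (Fin d) =>
              lieBrL d N (p i • e i) (∑ i ∈ s, p i • e i)) :=
            ((lieBrL d N).contDiff.comp (h3 i)).clm_apply (hsum s)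
          exact h2.const_smul (-(1 / 2 : ℝ))
        · exact (centerE d N).smul_mem (-(1 / 2 : ℝ)) (mem_centerE.mpr fun y => h _ _ _)
      refine (((contMDiff_gexp_smul_comp (N := N) (hcoord i) (e i)).mul ih).mul h1).congr
        fun p => ?_
      rw [Finset.sum_insert hi, gexp_add h]
      rfl
  refine (hs Finset.univ).congr fun p => ?_
  congr 1
  ext j
  simp [e, Finset.sum_apply, Pi.single_apply]

end ExpSmooth

/-! ### The exponential map is a diffeomorphism -/

section ExpDiffeo

variable {d : ℕ} {N : Type*} [Group N] [TopologicalSpace N] [IsTopologicalGroup N] [T2Space N]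
  [ChartedSpace (EuclideanSpace ℝ (Fin d)) N] [LieGroup (𝓡 d) ∞ N]

variable (N) in
/-- The value at `a` of the left-invariant field of `v`, in exponential coordinates. -/
def expField (a : EuclideanSpace ℝ (Fin d)) :
    EuclideanSpace ℝ (Fin d) →L[ℝ] EuclideanSpace ℝ (Fin d) :=
  ContinuousLinearMap.id ℝ _ + (1 / 2 : ℝ) • lieBrL d N a

theorem expField_apply (a v : EuclideanSpace ℝ (Fin d)) :
    expField N a v = v + (1 / 2 : ℝ) • lieBrL d N a v := rfl

theorem expField_neg_comp (h : IsTwoStep d N) (a : EuclideanSpace ℝ (Fin d)) :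
    (expField N (-a)).comp (expField N a) = ContinuousLinearMap.id ℝ _ := by
  ext1 v
  simp [expField_apply, h.right]

theorem expField_comp_neg (h : IsTwoStep d N) (a : EuclideanSpace ℝ (Fin d)) :
    (expField N a).comp (expField N (-a)) = ContinuousLinearMap.id ℝ _ := by
  ext1 v
  simp [expField_apply, h.right]

theorem expField_isInvertible (h : IsTwoStep d N) (a : EuclideanSpace ℝ (Fin d)) :
    (expField N a).IsInvertible :=
  ContinuousLinearMap.IsInvertible.of_inverse (expField_comp_neg h a) (expField_neg_comp h a)

theorem hasFDerivAt_bch (a y : EuclideanSpace ℝ (Fin d)) :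
    HasFDerivAt (bch (N := N) a) (expField N a) y := by
  have h1 : bch (N := N) a = fun y => a + expField N a y := by
    funext y; rw [bch, expField_apply, add_assoc]
  rw [h1]
  exact (expField N a).hasFDerivAt.const_add a

theorem bch_zero_right (a : EuclideanSpace ℝ (Fin d)) : bch (N := N) a 0 = a := by simp [bch]

theorem hasModelDerivAt_gexp_modelDeriv (h : IsTwoStep d N) (a : EuclideanSpace ℝ (Fin d)) :
    HasModelDerivAt 𝓘(ℝ, EuclideanSpace ℝ (Fin d)) (𝓡 d) (gexp (d := d) N) a
      (modelDeriv 𝓘(ℝ, EuclideanSpace ℝ (Fin d)) (𝓡 d) (gexp (d := d) N) a) :=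
  hasModelDerivAt_of_contMDiffAt (contMDiff_gexp h).contMDiffAt (by simp)

/-- The differential of the exponential map of a two-step nilpotent group. -/
theorem modelDeriv_gexp_comp (h : IsTwoStep d N) (a : EuclideanSpace ℝ (Fin d)) :
    (modelDeriv 𝓘(ℝ, EuclideanSpace ℝ (Fin d)) (𝓡 d) (gexp (d := d) N) a).comp (expField N a) =
      leftField d (gexp N a) := by
  ext1 v
  have h1 : HasModelDerivAt 𝓘(ℝ, ℝ) 𝓘(ℝ, EuclideanSpace ℝ (Fin d))
      (fun s : ℝ => bch (N := N) a (s • v)) 0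
      (ContinuousLinearMap.toSpanSingleton ℝ (expField N a v)) := by
    rw [hasModelDerivAt_iff_hasFDerivAt]
    have h2 : HasDerivAt (fun s : ℝ => s • v) v 0 := by
      simpa using (hasDerivAt_id (0 : ℝ)).smul_const v
    have h3 := (hasFDerivAt_bch (N := N) a ((0 : ℝ) • v)).comp_hasDerivAt (0 : ℝ) h2
    exact h3.hasFDerivAt
  have h4 := (hasModelDerivAt_gexp_modelDeriv h a).comp h1 (by simp [bch_zero_right])
  rw [toSpanSingleton_comp] at h4
  -- Differentiate `exp(bch a (s v)) = exp a · exp(s v)` at `s = 0` on both sides.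
  have h5 := (hasLeftDeriv_gexp (N := N) v 0).const_mul (gexp N a)
  have h6 : HasLeftDeriv (gexp (d := d) N ∘ fun s : ℝ => bch (N := N) a (s • v)) v 0 := by
    refine HasModelDerivAt.congr (f := fun s : ℝ => gexp N a * gexp N (s • v)) ?_
      (Filter.Eventually.of_forall fun s => gexp_bch h _ _)
    have h7 : (gexp (d := d) N ∘ fun s : ℝ => bch (N := N) a (s • v)) 0 =
      gexp N a * gexp N ((0 : ℝ) • v) := gexp_bch h _ _
    rw [h7]
    exact h5
  have h7 := congrArg (fun L => L 1) (h4.unique h6)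
  simpa [bch_zero_right] using h7

theorem modelDeriv_gexp (h : IsTwoStep d N) (a : EuclideanSpace ℝ (Fin d)) :
    modelDeriv 𝓘(ℝ, EuclideanSpace ℝ (Fin d)) (𝓡 d) (gexp (d := d) N) a =
      (leftField d (gexp N a)).comp (expField N (-a)) := by
  rw [← modelDeriv_gexp_comp h, ContinuousLinearMap.comp_assoc, expField_comp_neg h]
  rfl

theorem modelDeriv_gexp_zero (h : IsTwoStep d N) :
    modelDeriv 𝓘(ℝ, EuclideanSpace ℝ (Fin d)) (𝓡 d) (gexp (d := d) N) 0 =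
      ContinuousLinearMap.id ℝ _ := by
  rw [modelDeriv_gexp h, gexp_zero, leftField_one]
  ext1 v
  simp [expField_apply]

variable (N) in
/-- The exponential map in the chart at the identity. -/
def chartExp (a : EuclideanSpace ℝ (Fin d)) : EuclideanSpace ℝ (Fin d) := oneChart d N (gexp N a)

theorem contDiffAt_chartExp (h : IsTwoStep d N) : ContDiffAt ℝ ∞ (chartExp (d := d) N) 0 := by
  rw [← contMDiffAt_iff_contDiffAt]
  refine ContMDiffAt.comp (0 : EuclideanSpace ℝ (Fin d)) ?_ (contMDiff_gexp h).contMDiffAt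
  refine contMDiffAt_oneChart d N ?_
  rw [gexp_zero]
  exact oneChart_one_mem d N

theorem hasFDerivAt_chartExp (h : IsTwoStep d N) :
    HasFDerivAt (chartExp (d := d) N)
      ((ContinuousLinearEquiv.refl ℝ (EuclideanSpace ℝ (Fin d))) : _ →L[ℝ] _) 0 := by
  have h1 := (hasModelDerivAt_oneChart d N).comp (hasModelDerivAt_gexp_modelDeriv h 0) gexp_zero
  rw [modelDeriv_gexp_zero h] at h1
  exact hasModelDerivAt_iff_hasFDerivAt.mp h1

theorem chartExp_zero : chartExp (d := d) N 0 = oneCoord d N := by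
  rw [chartExp, gexp_zero]; rfl

/-- The inverse function theorem in the chart at `1`: the differential of the exponential map at `0`
is the identity. -/
theorem exists_local_log (h : IsTwoStep d N) :
    ∃ l : N → EuclideanSpace ℝ (Fin d), ContMDiffAt (𝓡 d) 𝓘(ℝ, EuclideanSpace ℝ (Fin d)) ∞ l 1 ∧
      l 1 = 0 ∧ (∀ᶠ a in 𝓝 0, l (gexp N a) = a) ∧ ∀ᶠ g in 𝓝 1, gexp N (l g) = g := by
  have hs : HasStrictFDerivAt (chartExp (d := d) N)
      ((ContinuousLinearEquiv.refl ℝ (EuclideanSpace ℝ (Fin d))) : _ →L[ℝ] _) 0 :=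
    (contDiffAt_chartExp h).hasStrictFDerivAt' (hasFDerivAt_chartExp h) (by simp)
  set ψ := (contDiffAt_chartExp h).localInverse (hasFDerivAt_chartExp h) (by simp) with hψ
  have hψs : ContDiffAt ℝ ∞ ψ (oneCoord d N) := by
    have := (contDiffAt_chartExp h).to_localInverse (hasFDerivAt_chartExp h) (by simp)
    rwa [chartExp_zero] at this
  have hl : ∀ᶠ a in 𝓝 0, ψ (chartExp N a) = a := hs.eventually_left_inverse
  have hr : ∀ᶠ u in 𝓝 (oneCoord d N), chartExp N (ψ u) = u := by
    have := hs.eventually_right_inverse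
    rwa [chartExp_zero] at this
  have hψ0 : ψ (oneCoord d N) = 0 := by
    have := hl.self_of_nhds
    rwa [chartExp_zero] at this
  have h1 : ContMDiffAt (𝓡 d) 𝓘(ℝ, EuclideanSpace ℝ (Fin d)) ∞ (fun g : N => ψ (oneChart d N g))
      1 := ContMDiffAt.comp (1 : N) hψs.contMDiffAt (contMDiffAt_oneChart d N (oneChart_one_mem d N))
  refine ⟨fun g => ψ (oneChart d N g), h1, hψ0, hl, ?_⟩
  have h2 : ∀ᶠ g in 𝓝 (1 : N), chartExp N (ψ (oneChart d N g)) = oneChart d N g :=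
    (contMDiffAt_oneChart d N (oneChart_one_mem d N)).continuousAt.eventually hr
  have h3 : ∀ᶠ g in 𝓝 (1 : N), gexp N (ψ (oneChart d N g)) ∈ (oneChart d N).source := by
    have h4 : ContinuousAt (fun g : N => gexp N (ψ (oneChart d N g))) 1 :=
      ContinuousAt.comp (contMDiff_gexp h).continuous.continuousAt h1.continuousAt
    refine h4.eventually (oneChart_source_mem_nhds d N ?_)
    have h5 : ψ (oneChart d N (1 : N)) = 0 := hψ0
    change gexp N (ψ (oneChart d N 1)) ∈ (oneChart d N).source
    rw [h5, gexp_zero]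
    exact oneChart_one_mem d N
  filter_upwards [h2, h3, oneChart_source_mem_nhds d N (oneChart_one_mem d N)] with g hg hg' hg''
  exact (oneChart d N).injOn hg' hg'' hg

/-- Openness at `0` comes from the local logarithm. It is carried to `a` by `exp(bch a y) = exp a ·
exp y`, since left translations are homeomorphisms. -/
theorem isOpenMap_gexp (h : IsTwoStep d N) : IsOpenMap (gexp (d := d) N) := by
  have h0 : 𝓝 (1 : N) ≤ Filter.map (gexp (d := d) N) (𝓝 0) := by
    obtain ⟨l, hl, hl0, -, hr⟩ := exists_local_log (N := N) h
    intro s hs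
    have h1 : ∀ᶠ g in 𝓝 (1 : N), l g ∈ gexp (d := d) N ⁻¹' s :=
      hl.continuousAt.eventually (by rw [hl0]; exact hs)
    filter_upwards [h1, hr] with g hg hg'
    rwa [Set.mem_preimage, hg'] at hg
  rw [isOpenMap_iff_nhds_le]
  intro a
  have h1 : Filter.map (bch (N := N) a) (𝓝 0) ≤ 𝓝 a := by
    have := (hasFDerivAt_bch (N := N) a 0).continuousAt
    rwa [ContinuousAt, bch_zero_right] at this
  refine le_trans ?_ (Filter.map_mono h1)
  rw [Filter.map_map]
  have h2 : gexp (d := d) N ∘ bch (N := N) a = (fun g => gexp N a * g) ∘ gexp (d := d) N :=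
    funext fun y => gexp_bch h a y
  rw [h2, ← Filter.map_map]
  refine le_trans ?_ (Filter.map_mono h0)
  rw [map_mul_left_nhds, mul_one]

/-- By `gexp_bch` the image is a subgroup; it is open, hence closed, hence everything. -/
theorem gexp_surjective [ConnectedSpace N] (h : IsTwoStep d N) :
    Function.Surjective (gexp (d := d) N) := by
  set H : Subgroup N :=
    { carrier := Set.range (gexp (d := d) N)
      mul_mem' := by
        rintro _ _ ⟨a, rfl⟩ ⟨b, rfl⟩
        exact ⟨_, gexp_bch h a b⟩
      one_mem' := ⟨0, gexp_zero⟩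
      inv_mem' := by
        rintro _ ⟨a, rfl⟩
        exact ⟨_, gexp_neg a⟩ } with hH
  have h1 : IsOpen (H : Set N) := (isOpenMap_gexp h).isOpen_range
  have h2 : (H : Set N) = Set.univ :=
    IsClopen.eq_univ ⟨H.isClosed_of_isOpen h1, h1⟩ ⟨1, H.one_mem⟩
  exact fun g => h2.ge (Set.mem_univ g)

theorem mem_centerE_of_gexp_eq_one (h : IsTwoStep d N) {x : EuclideanSpace ℝ (Fin d)}
    (hx : gexp N x = 1) : x ∈ centerE d N := by
  rw [mem_centerE]
  intro y
  have h1 := Ad_gexp h x y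
  rw [hx, Ad_one] at h1
  simpa using h1.symm

/-- Although `gexp` is not additive, its fibres are cosets of an additive subgroup. If `exp x = exp
y`, then `bch y (-x)` is in the kernel, hence central; bracketing it with `x` gives `[y, x] = 0`,
and it reduces to `y - x`. -/
theorem gexp_eq_iff (h : IsTwoStep d N) {x y : EuclideanSpace ℝ (Fin d)} :
    gexp N x = gexp N y ↔ gexp N (y + -x) = 1 := by
  constructor
  · intro hxy
    have h1 : gexp N (bch (N := N) y (-x)) = 1 := by
      rw [gexp_bch h, gexp_neg, hxy, mul_inv_cancel]
    have h2 := mem_centerE_of_gexp_eq_one h h1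
    have h3 : lieBrL d N y x = 0 := by
      have h4 := mem_centerE.mp h2 x
      simpa [bch, h _ _, lieBrL_self] using h4
    rwa [bch, map_neg, h3, neg_zero, smul_zero, add_zero] at h1
  · intro hxy
    have h2 := mem_centerE_of_gexp_eq_one h hxy
    have h3 := gexp_add_of_lieBrL_eq_zero h (mem_centerE.mp h2 x)
    rw [hxy, one_mul, neg_add_cancel_right] at h3
    exact h3.symm

/-- The exponential map is the quotient of the vector space by its kernel, which is discrete because
of the local logarithm at `0`. -/
theorem isCoveringMap_gexp [ConnectedSpace N] (h : IsTwoStep d N) :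
    IsCoveringMap (gexp (d := d) N) := by
  set Λ : AddSubgroup (EuclideanSpace ℝ (Fin d)) :=
    { carrier := {x | gexp N x = 1}
      add_mem' := by
        intro x y hx hy
        rw [Set.mem_ofPred_eq] at hx hy ⊢
        rw [gexp_add_of_lieBrL_eq_zero h (mem_centerE.mp (mem_centerE_of_gexp_eq_one h hx) y), hx,
          hy, one_mul]
      zero_mem' := gexp_zero
      neg_mem' := by
        intro x hx
        rw [Set.mem_ofPred_eq] at hx ⊢
        rw [gexp_neg, hx, inv_one] } with hΛ
  have hq : Topology.IsQuotientMap (gexp (d := d) N) :=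
    (isOpenMap_gexp h).isQuotientMap (contMDiff_gexp h).continuous (gexp_surjective h)
  have hd : IsDiscrete (Λ : Set (EuclideanSpace ℝ (Fin d))) := by
    rw [isDiscrete_iff_discreteTopology]
    refine discreteTopology_of_isOpen_singleton_zero ?_
    obtain ⟨l, -, hl0, hl, -⟩ := exists_local_log (N := N) h
    obtain ⟨U, hU, hUo, h0⟩ := eventually_nhds_iff.mp hl
    refine ⟨U, hUo, ?_⟩
    ext ⟨x, hx⟩
    simp only [Set.mem_preimage, Set.mem_singleton_iff]
    constructor
    · intro hxU
      have h1 := hU x hxU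
      have hx1 : gexp N x = 1 := hx
      rw [hx1, hl0] at h1
      exact Subtype.ext h1.symm
    · intro hx0
      rw [show x = 0 from congrArg Subtype.val hx0]
      exact h0
  exact (hq.isAddQuotientCoveringMap_of_addSubgroup Λ hd (gexp_eq_iff h)).isCoveringMap

variable [SimplyConnectedSpace N]

/-- Simple connectedness lifts the identity of `N` through the covering to a section `F`. Then `F ∘
exp` and the identity are lifts of `exp` that agree at `0`, hence everywhere. -/
theorem gexp_homeomorph_exists (h : IsTwoStep d N) :
    ∃ F : C(N, EuclideanSpace ℝ (Fin d)), (∀ g, gexp N (F g) = g) ∧ ∀ a, F (gexp N a) = a := by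
  have : LocallyPathConnectedSpace N :=
    ChartedSpace.locallyPathConnectedSpace (EuclideanSpace ℝ (Fin d)) N
  have hcov := isCoveringMap_gexp (N := N) h
  obtain ⟨F, ⟨hF0, hF⟩, -⟩ := hcov.existsUnique_continuousMap_lifts (ContinuousMap.id N) 1 0
    gexp_zero
  have hF' : ∀ g, gexp N (F g) = g := fun g => congrFun hF g
  refine ⟨F, hF', fun a => ?_⟩
  refine congrFun (hcov.eq_of_comp_eq (g₁ := fun a => F (gexp N a)) (g₂ := id)
    (F.continuous.comp (contMDiff_gexp h).continuous) continuous_id ?_ 0 ?_) a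
  · funext a
    exact hF' _
  · rw [gexp_zero, hF0]; rfl

/-- The exponential map of a simply connected two-step nilpotent group is a homeomorphism. -/
def gexpHomeomorph (h : IsTwoStep d N) : EuclideanSpace ℝ (Fin d) ≃ₜ N where
  toFun := gexp N
  invFun := (gexp_homeomorph_exists h).choose
  left_inv := (gexp_homeomorph_exists h).choose_spec.2
  right_inv := (gexp_homeomorph_exists h).choose_spec.1
  continuous_toFun := (contMDiff_gexp h).continuous
  continuous_invFun := (gexp_homeomorph_exists h).choose.continuous

/-- The inverse of the exponential map. -/
def glog (h : IsTwoStep d N) : N → EuclideanSpace ℝ (Fin d) := (gexpHomeomorph h).symm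

@[simp] theorem gexp_glog (h : IsTwoStep d N) (g : N) : gexp N (glog h g) = g :=
  (gexpHomeomorph h).apply_symm_apply g

@[simp] theorem glog_gexp (h : IsTwoStep d N) (a : EuclideanSpace ℝ (Fin d)) :
    glog h (gexp N a) = a :=
  (gexpHomeomorph h).symm_apply_apply a

theorem gexp_injective (h : IsTwoStep d N) : Function.Injective (gexp (d := d) N) :=
  (gexpHomeomorph h).injective

theorem continuous_glog (h : IsTwoStep d N) : Continuous (glog (d := d) (N := N) h) :=
  (gexpHomeomorph h).symm.continuous

theorem glog_one (h : IsTwoStep d N) : glog (d := d) h (1 : N) = 0 := by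
  rw [← gexp_zero (d := d) (N := N), glog_gexp]

theorem glog_mul (h : IsTwoStep d N) (g k : N) :
    glog (d := d) h (g * k) = bch (N := N) (glog h g) (glog h k) := by
  apply gexp_injective (N := N) h
  rw [gexp_glog, gexp_bch h, gexp_glog, gexp_glog]

/-- Near `1` this is the local logarithm; near `g` use `log k = bch (log g) (log (g⁻¹ k))`. -/
theorem contMDiff_glog (h : IsTwoStep d N) :
    ContMDiff (𝓡 d) 𝓘(ℝ, EuclideanSpace ℝ (Fin d)) ∞ (glog (d := d) (N := N) h) := by
  have h1 : ContMDiffAt (𝓡 d) 𝓘(ℝ, EuclideanSpace ℝ (Fin d)) ∞ (glog (d := d) (N := N) h) 1 := by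
    obtain ⟨l, hl, -, hl', -⟩ := exists_local_log (N := N) h
    refine hl.congr_of_eventuallyEq ?_
    have h2 : Filter.Tendsto (glog (d := d) (N := N) h) (𝓝 1) (𝓝 0) := by
      rw [← glog_one h]; exact (continuous_glog h).continuousAt
    filter_upwards [h2.eventually hl'] with g hg
    rw [gexp_glog] at hg
    exact hg.symm
  intro g
  have h2 : ContMDiffAt (𝓡 d) 𝓘(ℝ, EuclideanSpace ℝ (Fin d)) ∞
      (fun k : N => glog (d := d) h (g⁻¹ * k)) g := by
    refine ContMDiffAt.comp g ?_ (contMDiff_mul_left (a := g⁻¹)).contMDiffAt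
    rwa [inv_mul_cancel]
  have h3 : ContDiff ℝ ∞ (bch (N := N) (glog (d := d) h g)) := by
    have h4 : bch (N := N) (glog (d := d) h g) =
        fun y => glog h g + expField N (glog h g) y := by
      funext y; rw [bch, expField_apply, add_assoc]
    rw [h4]
    exact contDiff_const.add (expField N _).contDiff
  refine (h3.contMDiff.contMDiffAt.comp g h2).congr_of_eventuallyEq
    (Filter.Eventually.of_forall fun k => ?_)
  rw [Function.comp_apply, ← glog_mul, mul_inv_cancel_left]

/-- The center of the group is the exponential of the center of the Lie algebra. -/
theorem gexp_mem_center_iff (h : IsTwoStep d N) {x : EuclideanSpace ℝ (Fin d)} :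
    gexp N x ∈ Subgroup.center N ↔ x ∈ centerE d N := by
  rw [Subgroup.mem_center_iff, mem_centerE]
  constructor
  · intro hx y
    have h1 := gexp_injective h ((gexp_bch h x y).trans
      ((hx (gexp N y)).symm.trans (gexp_bch h y x).symm))
    rw [bch, bch, lieBrL_skew y x, add_comm y x, add_right_inj, smul_neg] at h1
    have h2 : lieBrL d N x y = 0 := by
      have h3 := add_eq_zero_iff_eq_neg.mpr h1
      rw [← add_smul] at h3
      norm_num at h3
      exact h3
    exact h2
  · intro hx g
    rw [← gexp_glog h g, ← gexp_bch h, ← gexp_bch h, bch, bch, lieBrL_skew (glog h g) x, hx]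
    simp [add_comm]

end ExpDiffeo

/-! ### Linear algebra of the null splitting -/

section Splitting

variable {E : Type*} [AddCommGroup E] [Module ℝ E] [FiniteDimensional ℝ E]
  {B : LinearMap.BilinForm ℝ E}

/-- The pairing embeds `P` in the dual of `Q` and `Q` in the dual of `P`. The dimensions agree, so
`P` represents every functional on `Q`, in particular the pairing with `x`. -/
theorem exists_sub_mem_orthogonal (hB : B.IsSymm) {P Q : Submodule ℝ E}
    (hl : Disjoint P (B.orthogonal Q)) (hr : Disjoint Q (B.orthogonal P)) (x : E) :
    ∃ p ∈ P, x - p ∈ B.orthogonal Q := by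
  have hinj : ∀ P Q : Submodule ℝ E, Disjoint P (B.orthogonal Q) →
      Function.Injective (B.domRestrict₁₂ P Q) := by
    intro P Q h
    rw [← LinearMap.ker_eq_bot, Submodule.eq_bot_iff]
    rintro ⟨p, hp⟩ hp0
    have h1 : p ∈ B.orthogonal Q := by
      rw [LinearMap.BilinForm.mem_orthogonal_iff]
      intro q hq
      rw [hB.eq q p]
      exact congrArg (fun L : Q →ₗ[ℝ] ℝ => L ⟨q, hq⟩) (LinearMap.mem_ker.mp hp0)
    exact Subtype.ext ((Submodule.disjoint_def.mp h) p hp h1)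
  have h1 := LinearMap.finrank_le_finrank_of_injective (hinj P Q hl)
  have h2 := LinearMap.finrank_le_finrank_of_injective (hinj Q P hr)
  have h3 : Module.finrank ℝ (Q →ₗ[ℝ] ℝ) = Module.finrank ℝ Q := Subspace.dual_finrank_eq
  have h4 : Module.finrank ℝ (P →ₗ[ℝ] ℝ) = Module.finrank ℝ P := Subspace.dual_finrank_eq
  have h5 : Module.finrank ℝ P = Module.finrank ℝ (Q →ₗ[ℝ] ℝ) := by omega
  have hs := (LinearMap.injective_iff_surjective_of_finrank_eq_finrank h5).mp (hinj P Q hl)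
  obtain ⟨⟨p, hp⟩, hpx⟩ := hs ((B x).domRestrict Q)
  refine ⟨p, hp, ?_⟩
  rw [LinearMap.BilinForm.mem_orthogonal_iff]
  intro q hq
  rw [hB.eq q, map_sub, LinearMap.sub_apply, sub_eq_zero]
  exact (congrArg (fun L : Q →ₗ[ℝ] ℝ => L ⟨q, hq⟩) hpx).symm

theorem isCompl_of_nullComplement (hB : B.IsSymm) (z V : Submodule ℝ E)
    (hl : Disjoint (z ⊓ B.orthogonal z) (B.orthogonal V))
    (hr : Disjoint V (B.orthogonal (z ⊓ B.orthogonal z))) :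
    IsCompl z (V ⊔ ((B.orthogonal (z ⊓ B.orthogonal z) ⊓ B.orthogonal V) ⊓
      B.orthogonal (z ⊓ (B.orthogonal (z ⊓ B.orthogonal z) ⊓ B.orthogonal V)))) := by
  set U := z ⊓ B.orthogonal z with hU
  set Z := z ⊓ (B.orthogonal U ⊓ B.orthogonal V) with hZ
  have mem : ∀ {S : Submodule ℝ E} {x : E}, x ∈ B.orthogonal S ↔ ∀ s ∈ S, B s x = 0 := by
    intro S x; exact LinearMap.BilinForm.mem_orthogonal_iff
  have hzU : z ≤ B.orthogonal U := fun x hx => mem.mpr fun u hu => by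
    rw [hB.eq u x]; exact mem.mp hu.2 x hx
  -- The form is nondegenerate on `Z`. Each `y ∈ z` differs from an element of `U` by one of `Z`, so
  -- a vector `w` of `Z` orthogonal to `Z` is orthogonal to all of `z`. Then `w` lies in `U`, and
  -- being orthogonal to `V` it is zero.
  have key : Disjoint Z (B.orthogonal Z) := by
    rw [Submodule.disjoint_def]
    rintro w ⟨hwz, hwU, hwV⟩ hwZ
    refine (Submodule.disjoint_def.mp hl) w ⟨hwz, mem.mpr fun y hy => ?_⟩ hwV
    obtain ⟨u, hu, hyu⟩ := exists_sub_mem_orthogonal hB hl hr y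
    have h1 : y - u ∈ Z := ⟨z.sub_mem hy hu.1,
      (B.orthogonal U).sub_mem (hzU hy) (hzU hu.1), hyu⟩
    have h2 := mem.mp hwZ _ h1
    rw [map_sub, LinearMap.sub_apply, mem.mp hwU u hu, sub_zero] at h2
    exact h2
  constructor
  · rw [Submodule.disjoint_def]
    intro w hwz hw
    obtain ⟨p, hp, e, ⟨⟨heU, heV⟩, heZ⟩, rfl⟩ := Submodule.mem_sup.mp hw
    have hp0 : p = 0 := by
      refine (Submodule.disjoint_def.mp hr) p hp ?_
      have := (B.orthogonal U).sub_mem (hzU hwz) heU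
      rwa [add_sub_cancel_right] at this
    subst hp0
    rw [zero_add] at hwz ⊢
    exact (Submodule.disjoint_def.mp key) e ⟨hwz, heU, heV⟩ heZ
  · rw [codisjoint_iff, Submodule.eq_top_iff']
    intro x
    -- Remove from `x` its components in `V`, `U` and `Z` in turn; what remains is orthogonal to
    -- `U`, `V` and `Z`, so it lies in the last summand.
    obtain ⟨p, hp, hxp⟩ := exists_sub_mem_orthogonal hB hr hl x
    obtain ⟨u, hu, hxu⟩ := exists_sub_mem_orthogonal hB hl hr (x - p)
    obtain ⟨y, hy, hxy⟩ := exists_sub_mem_orthogonal hB key key (x - p - u)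
    have h1 : x = (u + y) + (p + (x - p - u - y)) := by abel
    rw [h1]
    refine Submodule.add_mem_sup (z.add_mem hu.1 hy.1) (Submodule.add_mem_sup hp ⟨⟨?_, ?_⟩, hxy⟩)
    · exact (B.orthogonal U).sub_mem ((B.orthogonal U).sub_mem hxp (hzU hu.1)) (hzU hy.1)
    · exact (B.orthogonal V).sub_mem hxu hy.2.2

end Splitting

/-! ### The splitting of the Lie algebra, on the model space -/

section LieSplitting

variable {d : ℕ} {N : Type*} [Group N] [TopologicalSpace N] [IsTopologicalGroup N] [T2Space N]
  [ChartedSpace (EuclideanSpace ℝ (Fin d)) N] [LieGroup (𝓡 d) ∞ N]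

theorem mem_lieCenter_iff {x : EuclideanSpace ℝ (Fin d)} :
    (x : GroupLieAlgebra (𝓡 d) N) ∈ lieCenter d N ↔ x ∈ centerE d N := by
  rw [mem_centerE]
  refine (LieModule.mem_maxTrivSubmodule ℝ (GroupLieAlgebra (𝓡 d) N)
    (GroupLieAlgebra (𝓡 d) N) x).trans (forall_congr' fun y => ?_)
  have h1 : lieBrL d N x y = -lieBrL d N y x := lieBrL_skew x y
  rw [h1, neg_eq_zero]
  exact Iff.rfl

theorem isTwoStep_of_lie_mem_center
    (hN : ∀ x y : GroupLieAlgebra (𝓡 d) N,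
      ⁅x, y⁆ ∈ LieAlgebra.center ℝ (GroupLieAlgebra (𝓡 d) N)) : IsTwoStep d N := fun x y =>
  mem_centerE.mp (mem_lieCenter_iff.mp (hN x y))

variable (N) in
/-- A bilinear form on the Lie algebra, regarded as a form on the model space. -/
def formE (B : LinearMap.BilinForm ℝ (GroupLieAlgebra (𝓡 d) N)) :
    LinearMap.BilinForm ℝ (EuclideanSpace ℝ (Fin d)) := B

/-- The complement of the center, as a subspace of the model space. -/
def complE (B : LinearMap.BilinForm ℝ (GroupLieAlgebra (𝓡 d) N))
    (V : Submodule ℝ (GroupLieAlgebra (𝓡 d) N)) : Submodule ℝ (EuclideanSpace ℝ (Fin d)) :=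
  subspaceV B V

theorem lieCenter_eq : (lieCenter d N : Submodule ℝ (EuclideanSpace ℝ (Fin d))) = centerE d N :=
  SetLike.ext fun _ => mem_lieCenter_iff

theorem isCompl_centerE_complE {B : LinearMap.BilinForm ℝ (GroupLieAlgebra (𝓡 d) N)}
    (hB : B.IsSymm) {V : Submodule ℝ (GroupLieAlgebra (𝓡 d) N)} (hV : IsNullComplement B V) :
    IsCompl (centerE d N) (complE B V) := by
  rw [← lieCenter_eq]
  exact isCompl_of_nullComplement (E := EuclideanSpace ℝ (Fin d)) (B := formE N B) hB
    (lieCenter d N) V hV.disjoint_left hV.disjoint_right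

end LieSplitting

/-! ### Vector fields in charts -/

section Sections

variable {d : ℕ} {M : Type*} [TopologicalSpace M] [ChartedSpace (EuclideanSpace ℝ (Fin d)) M]
  [IsManifold (𝓡 d) ∞ M]

/-- A vector field near `x₀`, read in the preferred chart at `x₀`. -/
def chartField (X : ∀ x : M, TangentSpace (𝓡 d) x) (x₀ x : M) : EuclideanSpace ℝ (Fin d) :=
  modelDeriv (𝓡 d) 𝓘(ℝ, EuclideanSpace ℝ (Fin d)) (extChartAt (𝓡 d) x₀) x (X x)

/-- The trivialization of the tangent bundle at `x₀` is the differential of the chart at `x₀`, so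
regularity of fields can be tested on derivatives of charts. -/
theorem trivializationAt_eq_chartField (X : ∀ x : M, TangentSpace (𝓡 d) x) (x₀ : M) :
    (fun x => (trivializationAt (EuclideanSpace ℝ (Fin d)) (TangentSpace (𝓡 d)) x₀
      (⟨x, X x⟩ : TangentBundle (𝓡 d) M)).2) =ᶠ[𝓝 x₀] chartField X x₀ := by
  have : IsManifold (𝓡 d) 1 M := IsManifold.of_le (n := ∞) (by simp)
  filter_upwards [(chartAt (EuclideanSpace ℝ (Fin d)) x₀).open_source.mem_nhds
    (mem_chart_source _ x₀)] with x hx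
  have h1 := TangentBundle.continuousLinearMapAt_trivializationAt (I := 𝓡 d) hx
  have h2 : x ∈ (trivializationAt (EuclideanSpace ℝ (Fin d)) (TangentSpace (𝓡 d)) x₀).baseSet := hx
  have h3 := congrArg (fun L => L (X x)) h1
  refine Eq.trans ?_ h3
  exact (congrFun (Trivialization.coe_linearMapAt_of_mem (R := ℝ) _ h2) (X x)).symm

theorem contMDiffAt_field_iff {n : WithTop ℕ∞} {X : ∀ x : M, TangentSpace (𝓡 d) x} {x₀ : M} :
    ContMDiffAt (𝓡 d) (𝓡 d).tangent n (fun x => (⟨x, X x⟩ : TangentBundle (𝓡 d) M)) x₀ ↔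
      ContMDiffAt (𝓡 d) 𝓘(ℝ, EuclideanSpace ℝ (Fin d)) n (chartField X x₀) x₀ := by
  have : IsManifold (𝓡 d) 1 M := IsManifold.of_le (n := ∞) (by simp)
  refine (contMDiffAt_section (s := X) x₀).trans ?_
  exact (trivializationAt_eq_chartField X x₀).contMDiffAt_iff

theorem mdifferentiableAt_field_iff {X : ∀ x : M, TangentSpace (𝓡 d) x} {x₀ : M} :
    MDifferentiableAt (𝓡 d) (𝓡 d).tangent (fun x => (⟨x, X x⟩ : TangentBundle (𝓡 d) M)) x₀ ↔
      MDifferentiableAt (𝓡 d) 𝓘(ℝ, EuclideanSpace ℝ (Fin d)) (chartField X x₀) x₀ := by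
  have : IsManifold (𝓡 d) 1 M := IsManifold.of_le (n := ∞) (by simp)
  refine (mdifferentiableAt_section (IB := 𝓡 d) X (b₀ := x₀)).trans ?_
  exact (trivializationAt_eq_chartField X x₀).mdifferentiableAt_iff

end Sections

/-! ### The left-invariant frame and exponential coordinates on the quotient -/

section Quotient

variable {d : ℕ} {N : Type*} [Group N] [TopologicalSpace N] [IsTopologicalGroup N] [T2Space N]
  [LocallyCompactSpace N] [ChartedSpace (EuclideanSpace ℝ (Fin d)) N] [LieGroup (𝓡 d) ∞ N]
  (Γ : Subgroup N) [DiscreteTopology Γ]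

/-- The frame of the left-invariant fields on `Γ\N`, with values in the model space. -/
def frE (x : LeftQuotient Γ) : EuclideanSpace ℝ (Fin d) →L[ℝ] EuclideanSpace ℝ (Fin d) :=
  LeftQuotient.frame (d := d) Γ x

theorem modelDeriv_mk_comp (n : N) :
    (modelDeriv (𝓡 d) (𝓡 d) (LeftQuotient.mk Γ) n).comp (leftField d n) =
      frE Γ (LeftQuotient.mk Γ n) := by
  ext1 v
  exact (LeftQuotient.frameAt_apply Γ n v).symm.trans (LeftQuotient.frame_mk Γ n v).symm

theorem frE_isInvertible (x : LeftQuotient Γ) : (frE (d := d) Γ x).IsInvertible := by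
  obtain ⟨n, rfl⟩ := Quotient.exists_rep x
  obtain ⟨L, h1, h2⟩ := LeftQuotient.frameAt_inverse (d := d) Γ n
  refine ContinuousLinearMap.IsInvertible.of_inverse (g := L) ?_ ?_
  · ext1 w
    exact (LeftQuotient.frame_mk Γ n (L w)).trans (h2 w)
  · ext1 w
    exact (congrArg L (LeftQuotient.frame_mk (d := d) Γ n w)).trans (h1 w)

/-- The coordinates of a vector in the frame of the left-invariant fields. -/
def coframe (x : LeftQuotient Γ) : EuclideanSpace ℝ (Fin d) →L[ℝ] EuclideanSpace ℝ (Fin d) :=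
  (frE Γ x).inverse

@[simp] theorem coframe_frE (x : LeftQuotient Γ) (v : EuclideanSpace ℝ (Fin d)) :
    coframe Γ x (frE Γ x v) = v :=
  (frE_isInvertible Γ x).inverse_apply_eq.mpr rfl

@[simp] theorem frE_coframe (x : LeftQuotient Γ) (v : EuclideanSpace ℝ (Fin d)) :
    frE Γ x (coframe Γ x v) = v :=
  ((frE_isInvertible Γ x).inverse_apply_eq.mp rfl).symm

/-- Exponential coordinates on `Γ\N` around the class of `n`. -/
def par (n : N) (a : EuclideanSpace ℝ (Fin d)) : LeftQuotient Γ := LeftQuotient.mk Γ (n * gexp N a)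

theorem par_smul (γ : Γ) (n : N) : par (d := d) Γ ((γ : N) * n) = par Γ n := by
  funext a
  rw [par, par, mul_assoc]
  exact (isCov Γ).map_smul γ

@[simp] theorem par_zero (n : N) : par (d := d) Γ n 0 = LeftQuotient.mk Γ n := by
  rw [par, gexp_zero, mul_one]

variable {Γ}

theorem par_mul_gexp (h : IsTwoStep d N) (n : N) (a b : EuclideanSpace ℝ (Fin d)) :
    par Γ (n * gexp N a) b = par Γ n (bch (N := N) a b) := by
  rw [par, par, gexp_bch h, mul_assoc]

theorem contMDiff_par (h : IsTwoStep d N) (n : N) :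
    ContMDiff 𝓘(ℝ, EuclideanSpace ℝ (Fin d)) (𝓡 d) ∞ (par (d := d) Γ n) :=
  (mk_contMDiff Γ).comp (contMDiff_mul_left.comp (contMDiff_gexp h))

theorem modelDeriv_par_comp (h : IsTwoStep d N) (n : N) (a : EuclideanSpace ℝ (Fin d)) :
    (modelDeriv 𝓘(ℝ, EuclideanSpace ℝ (Fin d)) (𝓡 d) (par (d := d) Γ n) a).comp (expField N a) =
      frE Γ (par Γ n a) := by
  have h1 := (hasModelDerivAt_mul_left d n (gexp N a)).comp (hasModelDerivAt_gexp_modelDeriv h a)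
    rfl
  have h2 := (hasModelDerivAt_of_contMDiffAt (mk_contMDiff (d := d) Γ).contMDiffAt (by simp)).comp
    h1 rfl
  have h3 : modelDeriv 𝓘(ℝ, EuclideanSpace ℝ (Fin d)) (𝓡 d) (par (d := d) Γ n) a = _ :=
    h2.modelDeriv_eq
  rw [h3, ContinuousLinearMap.comp_assoc, ContinuousLinearMap.comp_assoc, modelDeriv_gexp_comp h,
    modelDeriv_mul_left_leftField]
  exact modelDeriv_mk_comp Γ _

theorem modelDeriv_par (h : IsTwoStep d N) (n : N) (a : EuclideanSpace ℝ (Fin d)) :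
    modelDeriv 𝓘(ℝ, EuclideanSpace ℝ (Fin d)) (𝓡 d) (par (d := d) Γ n) a =
      (frE Γ (par Γ n a)).comp (expField N (-a)) := by
  rw [← modelDeriv_par_comp h, ContinuousLinearMap.comp_assoc, expField_comp_neg h]
  rfl

theorem modelDeriv_par_isInvertible (h : IsTwoStep d N) (n : N) (a : EuclideanSpace ℝ (Fin d)) :
    (modelDeriv 𝓘(ℝ, EuclideanSpace ℝ (Fin d)) (𝓡 d) (par (d := d) Γ n) a).IsInvertible := by
  rw [modelDeriv_par h]
  exact (frE_isInvertible Γ _).comp (expField_isInvertible h _)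

variable (Γ) in
theorem exists_par_inverse (h : IsTwoStep d N) (n : N) :
    ∃ σ : LeftQuotient Γ → EuclideanSpace ℝ (Fin d),
      ContMDiffAt (𝓡 d) 𝓘(ℝ, EuclideanSpace ℝ (Fin d)) ∞ σ (LeftQuotient.mk Γ n) ∧
      σ (LeftQuotient.mk Γ n) = 0 ∧ (∀ᶠ a in 𝓝 0, σ (par Γ n a) = a) ∧
      ∀ᶠ x in 𝓝 (LeftQuotient.mk Γ n), par Γ n (σ x) = x := by
  obtain ⟨s, hs, hsn, hl, hr⟩ := mk_localInverse (d := d) Γ n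
  obtain ⟨l, hls, hl1, hll, hlr⟩ := exists_local_log (N := N) h
  have h1 : ContMDiffAt (𝓡 d) (𝓡 d) ∞ (fun x => n⁻¹ * s x) (LeftQuotient.mk Γ n) :=
    (contMDiff_mul_left (a := n⁻¹)).contMDiffAt.comp _ hs
  have h1' : n⁻¹ * s (LeftQuotient.mk Γ n) = 1 := by rw [hsn, inv_mul_cancel]
  have h2 : Filter.Tendsto (fun x => n⁻¹ * s x) (𝓝 (LeftQuotient.mk Γ n)) (𝓝 1) := by
    have := h1.continuousAt
    rwa [ContinuousAt, h1'] at this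
  refine ⟨fun x => l (n⁻¹ * s x), ?_, ?_, ?_, ?_⟩
  · refine ContMDiffAt.comp (LeftQuotient.mk Γ n) (g := l) ?_ h1
    rwa [h1']
  · exact (congrArg l h1').trans hl1
  · have h3 : Filter.Tendsto (fun a : EuclideanSpace ℝ (Fin d) => n * gexp N a) (𝓝 0) (𝓝 n) := by
      have h4 := ((continuous_const_mul n).comp (contMDiff_gexp (N := N) h).continuous).tendsto 0
      simpa [Function.comp_def] using h4
    filter_upwards [h3.eventually hl, hll] with a ha ha'
    rw [par, ha, inv_mul_cancel_left, ha']
  · filter_upwards [hr, h2.eventually hlr] with x hx hx'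
    rw [par, hx', mul_inv_cancel_left, hx]

variable (Γ) in
/-- The components of a vector field in the frame of the left-invariant fields, in exponential
coordinates around the class of `n`. -/
def coord (X : ∀ x : LeftQuotient Γ, TangentSpace (𝓡 d) x) (n : N)
    (a : EuclideanSpace ℝ (Fin d)) : EuclideanSpace ℝ (Fin d) :=
  coframe Γ (par Γ n a) (X (par Γ n a))

/-- Compares chart components with frame components: the transition `L a` is the differential of the
chart composed with the frame. It equals `d(chart ∘ par) ∘ expField a`, which shows that it and its
inverse are smooth. -/
theorem chartField_par_aux (h : IsTwoStep d N) (n : N) :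
    ∃ L : EuclideanSpace ℝ (Fin d) → EuclideanSpace ℝ (Fin d) →L[ℝ] EuclideanSpace ℝ (Fin d),
      ContDiffAt ℝ ∞ L 0 ∧ ContDiffAt ℝ ∞ (fun a => (L a).inverse) 0 ∧
      ∀ X : (∀ x : LeftQuotient Γ, TangentSpace (𝓡 d) x),
        (∀ᶠ a in 𝓝 0, chartField X (LeftQuotient.mk Γ n) (par Γ n a) = L a (coord Γ X n a)) ∧
        ∀ᶠ a in 𝓝 0, coord Γ X n a = (L a).inverse
          (chartField X (LeftQuotient.mk Γ n) (par Γ n a)) := by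
  have hM : IsManifold (𝓡 d) 1 (LeftQuotient Γ) := IsManifold.of_le (n := ∞) (by simp)
  set x₀ := LeftQuotient.mk Γ n with hx₀
  set φ : EuclideanSpace ℝ (Fin d) → EuclideanSpace ℝ (Fin d) :=
    fun a => extChartAt (𝓡 d) x₀ (par Γ n a) with hφ
  have hsrc : ∀ᶠ a in 𝓝 (0 : EuclideanSpace ℝ (Fin d)),
      par Γ n a ∈ (chartAt (EuclideanSpace ℝ (Fin d)) x₀).source := by
    refine (contMDiff_par h n).continuous.continuousAt.eventually ?_
    rw [par_zero]
    exact (chartAt (EuclideanSpace ℝ (Fin d)) x₀).open_source.mem_nhds (mem_chart_source _ x₀)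
  have hφs : ContDiffAt ℝ ∞ φ 0 := by
    rw [← contMDiffAt_iff_contDiffAt]
    refine ContMDiffAt.comp (0 : EuclideanSpace ℝ (Fin d)) ?_ (contMDiff_par h n).contMDiffAt
    rw [par_zero]
    exact contMDiffAt_extChartAt
  have hL : ∀ᶠ a in 𝓝 (0 : EuclideanSpace ℝ (Fin d)), (fderiv ℝ φ a).comp (expField N a) =
      (modelDeriv (𝓡 d) 𝓘(ℝ, EuclideanSpace ℝ (Fin d)) (extChartAt (𝓡 d) x₀) (par Γ n a)).comp
        (frE Γ (par Γ n a)) ∧ ((fderiv ℝ φ a).comp (expField N a)).IsInvertible := by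
    filter_upwards [hsrc] with a ha
    have h1 : ContMDiffAt (𝓡 d) 𝓘(ℝ, EuclideanSpace ℝ (Fin d)) ∞ (extChartAt (𝓡 d) x₀)
        (par Γ n a) := contMDiffAt_extChartAt' ha
    have h2 := (hasModelDerivAt_of_contMDiffAt h1 (by simp)).comp
      (hasModelDerivAt_of_contMDiffAt (contMDiff_par h n).contMDiffAt (by simp)) rfl
    have h3 : fderiv ℝ φ a = _ := (hasModelDerivAt_iff_hasFDerivAt.mp h2).fderiv
    have h4 : (modelDeriv (𝓡 d) 𝓘(ℝ, EuclideanSpace ℝ (Fin d)) (extChartAt (𝓡 d) x₀)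
        (par Γ n a)).IsInvertible :=
      isInvertible_mfderiv_extChartAt (I := 𝓡 d) (by rwa [extChartAt_source])
    have h5 : (fderiv ℝ φ a).comp (expField N a) = _ :=
      (congrArg (fun A => A.comp (expField N a)) h3).trans
        ((ContinuousLinearMap.comp_assoc _ _ _).trans
          (congrArg (ContinuousLinearMap.comp _) (modelDeriv_par_comp h n a)))
    refine ⟨h5, ?_⟩
    rw [h5]
    exact h4.comp (frE_isInvertible Γ _)
  have hLs : ContDiffAt ℝ ∞ (fun a => (fderiv ℝ φ a).comp (expField N a)) 0 := by
    have h1 : ContDiffAt ℝ ∞ (fderiv ℝ φ) 0 := hφs.fderiv_right (by simp)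
    have h2 : ContDiff ℝ ∞ (expField (d := d) N) :=
      contDiff_const.add ((lieBrL d N).contDiff.const_smul (1 / 2 : ℝ))
    exact h1.clm_comp h2.contDiffAt
  refine ⟨fun a => (fderiv ℝ φ a).comp (expField N a), hLs, ?_, fun X => ⟨?_, ?_⟩⟩
  · exact ContDiffAt.comp (0 : EuclideanSpace ℝ (Fin d))
      (hL.self_of_nhds.2.contDiffAt_map_inverse) hLs
  · filter_upwards [hL] with a ha
    rw [ha.1]
    exact congrArg _ (frE_coframe Γ (par Γ n a) (X (par Γ n a))).symm
  · filter_upwards [hL] with a ha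
    refine (ha.2.inverse_apply_eq.mpr ?_).symm
    rw [ha.1]
    exact congrArg _ (frE_coframe Γ (par Γ n a) (X (par Γ n a))).symm

theorem contMDiffAt_field_iff_coord (h : IsTwoStep d N) {k : ℕ∞} {n : N}
    {X : ∀ x : LeftQuotient Γ, TangentSpace (𝓡 d) x} :
    ContMDiffAt (𝓡 d) (𝓡 d).tangent k
      (fun x => (⟨x, X x⟩ : TangentBundle (𝓡 d) (LeftQuotient Γ))) (LeftQuotient.mk Γ n) ↔
      ContDiffAt ℝ k (coord Γ X n) 0 := by
  have hk : (k : WithTop ℕ∞) ≤ ∞ := WithTop.coe_le_coe.mpr le_top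
  rw [contMDiffAt_field_iff]
  obtain ⟨L, hL, hL', hX⟩ := chartField_par_aux (Γ := Γ) h n
  obtain ⟨h1, h2⟩ := hX X
  obtain ⟨σ, hσ, hσ0, hl, hr⟩ := exists_par_inverse Γ h n
  constructor
  · intro hc
    refine ContDiffAt.congr_of_eventuallyEq ?_ h2
    refine (hL'.of_le hk).clm_apply ?_
    rw [← contMDiffAt_iff_contDiffAt]
    have h3 : ContMDiffAt (𝓡 d) 𝓘(ℝ, EuclideanSpace ℝ (Fin d)) k
        (chartField X (LeftQuotient.mk Γ n)) (par (d := d) Γ n 0) := by rwa [par_zero Γ n]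
    exact h3.comp (0 : EuclideanSpace ℝ (Fin d)) ((contMDiff_par h n).contMDiffAt.of_le hk)
  · intro hc
    have h3 : ContMDiffAt 𝓘(ℝ, EuclideanSpace ℝ (Fin d)) 𝓘(ℝ, EuclideanSpace ℝ (Fin d)) k
        (fun a => chartField X (LeftQuotient.mk Γ n) (par Γ n a)) (σ (LeftQuotient.mk Γ n)) := by
      rw [hσ0]
      exact (((hL.of_le hk).clm_apply hc).congr_of_eventuallyEq h1).contMDiffAt
    refine (h3.comp _ (hσ.of_le hk)).congr_of_eventuallyEq ?_
    filter_upwards [hr] with x hx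
    rw [Function.comp_apply, hx]

theorem mdifferentiableAt_field_iff_coord (h : IsTwoStep d N) {n : N}
    {X : ∀ x : LeftQuotient Γ, TangentSpace (𝓡 d) x} :
    MDifferentiableAt (𝓡 d) (𝓡 d).tangent
      (fun x => (⟨x, X x⟩ : TangentBundle (𝓡 d) (LeftQuotient Γ))) (LeftQuotient.mk Γ n) ↔
      DifferentiableAt ℝ (coord Γ X n) 0 := by
  rw [mdifferentiableAt_field_iff]
  obtain ⟨L, hL, hL', hX⟩ := chartField_par_aux (Γ := Γ) h n
  obtain ⟨h1, h2⟩ := hX X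
  obtain ⟨σ, hσ, hσ0, hl, hr⟩ := exists_par_inverse Γ h n
  constructor
  · intro hc
    refine DifferentiableAt.congr_of_eventuallyEq ?_ h2
    refine (hL'.differentiableAt (by simp)).clm_apply ?_
    rw [← mdifferentiableAt_iff_differentiableAt]
    have h3 : MDifferentiableAt (𝓡 d) 𝓘(ℝ, EuclideanSpace ℝ (Fin d))
        (chartField X (LeftQuotient.mk Γ n)) (par (d := d) Γ n 0) := by rwa [par_zero Γ n]
    exact h3.comp (0 : EuclideanSpace ℝ (Fin d))
      ((contMDiff_par h n).contMDiffAt.mdifferentiableAt (by simp))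
  · intro hc
    have h3 : MDifferentiableAt 𝓘(ℝ, EuclideanSpace ℝ (Fin d)) 𝓘(ℝ, EuclideanSpace ℝ (Fin d))
        (fun a => chartField X (LeftQuotient.mk Γ n) (par Γ n a)) (σ (LeftQuotient.mk Γ n)) := by
      rw [hσ0]
      exact (((hL.differentiableAt (by simp)).clm_apply hc).congr_of_eventuallyEq
        h1).mdifferentiableAt
    refine (h3.comp _ (hσ.mdifferentiableAt (by simp))).congr_of_eventuallyEq ?_
    filter_upwards [hr] with x hx
    rw [Function.comp_apply, hx]

end Quotient

/-! ### Vector fields, brackets and connections in the frame -/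

section QuotientCalculus

variable {d : ℕ} {N : Type*} [Group N] [TopologicalSpace N] [IsTopologicalGroup N] [T2Space N]
  [LocallyCompactSpace N] [ChartedSpace (EuclideanSpace ℝ (Fin d)) N] [LieGroup (𝓡 d) ∞ N]
  {Γ : Subgroup N} [DiscreteTopology Γ]

theorem modelDeriv_par_zero (h : IsTwoStep d N) (n : N) :
    modelDeriv 𝓘(ℝ, EuclideanSpace ℝ (Fin d)) (𝓡 d) (par (d := d) Γ n) 0 =
      frE Γ (LeftQuotient.mk Γ n) := by
  rw [← par_zero (d := d), ← modelDeriv_par_comp h]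
  ext1 v
  simp [expField_apply]

theorem hasModelDerivAt_par_zero (h : IsTwoStep d N) (n : N) :
    HasModelDerivAt 𝓘(ℝ, EuclideanSpace ℝ (Fin d)) (𝓡 d) (par (d := d) Γ n) 0
      (frE Γ (LeftQuotient.mk Γ n)) := by
  rw [← modelDeriv_par_zero h]
  exact hasModelDerivAt_of_contMDiffAt (contMDiff_par h n).contMDiffAt (by simp)

/-- Derivatives of functions on `Γ\N` can be computed in exponential coordinates. -/
theorem hasModelDerivAt_of_comp_par (h : IsTwoStep d N) {F : Type*} [NormedAddCommGroup F]
    [NormedSpace ℝ F] {G : LeftQuotient Γ → F} {n : N} {L : EuclideanSpace ℝ (Fin d) →L[ℝ] F}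
    (hG : HasFDerivAt (fun a => G (par Γ n a)) L 0) :
    HasModelDerivAt (𝓡 d) 𝓘(ℝ, F) G (LeftQuotient.mk Γ n)
      (L.comp (coframe Γ (LeftQuotient.mk Γ n))) := by
  obtain ⟨σ, hσ, hσ0, hl, hr⟩ := exists_par_inverse Γ h n
  have h1 := hasModelDerivAt_of_contMDiffAt hσ (by simp)
  have h2 : modelDeriv (𝓡 d) 𝓘(ℝ, EuclideanSpace ℝ (Fin d)) σ (LeftQuotient.mk Γ n) =
      coframe Γ (LeftQuotient.mk Γ n) := by
    have h3 := h1.comp (hasModelDerivAt_par_zero h n) (par_zero Γ n)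
    have h4 : HasModelDerivAt 𝓘(ℝ, EuclideanSpace ℝ (Fin d)) 𝓘(ℝ, EuclideanSpace ℝ (Fin d))
        (σ ∘ par Γ n) 0 (ContinuousLinearMap.id ℝ _) := (hasModelDerivAt_id _).congr hl
    have h5 := h3.unique h4
    ext1 v
    have h6 := congrArg (fun A => A (coframe Γ (LeftQuotient.mk Γ n) v)) h5
    simpa using h6
  rw [h2] at h1
  refine ((hasModelDerivAt_iff_hasFDerivAt.mpr hG).comp h1 hσ0).congr ?_
  filter_upwards [hr] with x hx
  rw [Function.comp_apply, hx]

variable (Γ) in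
/-- The components of a vector field in the frame of the left-invariant fields. -/
def fld (X : ∀ x : LeftQuotient Γ, TangentSpace (𝓡 d) x) (x : LeftQuotient Γ) :
    EuclideanSpace ℝ (Fin d) := coframe Γ x (X x)

theorem coord_eq (X : ∀ x : LeftQuotient Γ, TangentSpace (𝓡 d) x) (n : N)
    (a : EuclideanSpace ℝ (Fin d)) : coord Γ X n a = fld Γ X (par Γ n a) := rfl

theorem coord_zero (X : ∀ x : LeftQuotient Γ, TangentSpace (𝓡 d) x) (n : N) :
    coord Γ X n 0 = fld Γ X (LeftQuotient.mk Γ n) := by rw [coord_eq, par_zero]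

theorem coord_mul_gexp (h : IsTwoStep d N) (X : ∀ x : LeftQuotient Γ, TangentSpace (𝓡 d) x)
    (n : N) (a : EuclideanSpace ℝ (Fin d)) :
    coord Γ X (n * gexp N a) = fun b => coord Γ X n (bch (N := N) a b) := by
  funext b
  rw [coord_eq, coord_eq, par_mul_gexp h]

theorem frE_fld (X : ∀ x : LeftQuotient Γ, TangentSpace (𝓡 d) x) (x : LeftQuotient Γ) :
    frE Γ x (fld Γ X x) = X x := frE_coframe Γ x (X x)

theorem contDiff_bch (a : EuclideanSpace ℝ (Fin d)) : ContDiff ℝ ∞ (bch (N := N) a) := by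
  have h4 : bch (N := N) a = fun y => a + expField N a y := by
    funext y; rw [bch, expField_apply, add_assoc]
  rw [h4]
  exact contDiff_const.add (expField N _).contDiff

theorem isSmoothField_iff_coord (h : IsTwoStep d N)
    {X : ∀ x : LeftQuotient Γ, TangentSpace (𝓡 d) x} :
    IsSmoothField X ↔ ∀ n, ContDiff ℝ ∞ (coord Γ X n) := by
  constructor
  · intro hX n
    rw [contDiff_iff_contDiffAt]
    intro a
    have h1 := (contMDiffAt_field_iff_coord h (k := ⊤)).mp (hX (LeftQuotient.mk Γ (n * gexp N a)))
    -- Recentre at `n exp a`: the new coordinate `bch (-a) b` vanishes at `b = a`, so smoothness at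
    -- the origin of each coordinate system suffices.
    have h2 : coord Γ X n = fun b => coord Γ X (n * gexp N a) (bch (N := N) (-a) b) := by
      funext b
      rw [coord_mul_gexp h]
      congr 1
      simp only [bch, map_neg, map_add, map_smul, _root_.neg_apply, h.right, lieBrL_self]
      module
    rw [h2]
    refine ContDiffAt.comp (g := coord Γ X (n * gexp N a)) a ?_ (contDiff_bch (-a)).contDiffAt
    have h3 : bch (N := N) (-a) a = 0 := by simp [bch, lieBrL_self]
    rw [h3]
    exact h1
  · intro hX x
    obtain ⟨n, rfl⟩ := Quotient.exists_rep x
    exact (contMDiffAt_field_iff_coord h (k := ⊤)).mpr (hX n).contDiffAt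

theorem IsSmoothField.mdifferentiableAt {X : ∀ x : LeftQuotient Γ, TangentSpace (𝓡 d) x}
    (hX : IsSmoothField X) (x : LeftQuotient Γ) :
    MDifferentiableAt (𝓡 d) (𝓡 d).tangent
      (fun x => (⟨x, X x⟩ : TangentBundle (𝓡 d) (LeftQuotient Γ))) x :=
  (hX x).mdifferentiableAt (by simp)

variable (Γ) in
/-- The left-invariant vector fields on `Γ\N`. -/
def frameField (v : EuclideanSpace ℝ (Fin d)) (x : LeftQuotient Γ) : TangentSpace (𝓡 d) x :=
  frE Γ x v

theorem fld_frameField (v : EuclideanSpace ℝ (Fin d)) (x : LeftQuotient Γ) :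
    fld Γ (frameField Γ v) x = v := coframe_frE Γ x v

theorem coord_frameField (v : EuclideanSpace ℝ (Fin d)) (n : N) :
    coord Γ (frameField Γ v) n = fun _ => v :=
  funext fun _ => fld_frameField v _

theorem isSmoothField_frameField (h : IsTwoStep d N) (v : EuclideanSpace ℝ (Fin d)) :
    IsSmoothField (frameField Γ v) := by
  rw [isSmoothField_iff_coord h]
  intro n
  rw [coord_frameField]
  exact contDiff_const

/-- The Lie bracket of vector fields on `Γ\N` in the frame of the left-invariant fields. -/
theorem coframe_mlieBracket (h : IsTwoStep d N)
    {X Y : ∀ x : LeftQuotient Γ, TangentSpace (𝓡 d) x} {n : N}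
    (hX : MDifferentiableAt (𝓡 d) (𝓡 d).tangent
      (fun x => (⟨x, X x⟩ : TangentBundle (𝓡 d) (LeftQuotient Γ))) (LeftQuotient.mk Γ n))
    (hY : MDifferentiableAt (𝓡 d) (𝓡 d).tangent
      (fun x => (⟨x, Y x⟩ : TangentBundle (𝓡 d) (LeftQuotient Γ))) (LeftQuotient.mk Γ n)) :
    coframe Γ (LeftQuotient.mk Γ n) (VectorField.mlieBracket (𝓡 d) X Y (LeftQuotient.mk Γ n)) =
      fderiv ℝ (coord Γ Y n) 0 (coord Γ X n 0) - fderiv ℝ (coord Γ X n) 0 (coord Γ Y n 0) +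
        lieBrL d N (coord Γ X n 0) (coord Γ Y n 0) := by
  have hX' := (mdifferentiableAt_field_iff_coord h).mp hX
  have hY' := (mdifferentiableAt_field_iff_coord h).mp hY
  have hval : ∀ (Z : ∀ x : LeftQuotient Γ, TangentSpace (𝓡 d) x) (b : EuclideanSpace ℝ (Fin d)),
      modelDeriv 𝓘(ℝ, EuclideanSpace ℝ (Fin d)) (𝓡 d) (par (d := d) Γ n) b
        (expField N b (coord Γ Z n b)) = Z (par Γ n b) := fun Z b =>
    (congrArg (fun L => L (coord Γ Z n b)) (modelDeriv_par_comp h n b)).trans (frE_fld Z _)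
  have hd : ∀ Z : (∀ x : LeftQuotient Γ, TangentSpace (𝓡 d) x),
      DifferentiableAt ℝ (coord Γ Z n) 0 →
      HasFDerivAt (fun b => expField N b (coord Γ Z n b))
        (fderiv ℝ (coord Γ Z n) 0 + (1 / 2 : ℝ) • (lieBrL d N).flip (coord Γ Z n 0)) 0 := by
    intro Z hZ
    have h1 := ((lieBrL d N).hasFDerivAt (x := 0)).clm_apply hZ.hasFDerivAt
    have h2 := hZ.hasFDerivAt.add (h1.const_smul (1 / 2 : ℝ))
    refine h2.congr_fderiv ?_
    ext1 v
    simp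
  have e0 := par_zero (d := d) Γ n
  rw [← e0] at hX hY
  have h3 := mlieBracket_eq_of_parametrization (contMDiff_par h n).contMDiffAt
    (Filter.Eventually.of_forall (modelDeriv_par_isInvertible h n)) hX hY
    (Filter.Eventually.of_forall (hval X)) (Filter.Eventually.of_forall (hval Y))
  -- Each field contributes one half of the Lie algebra bracket, through the derivative of
  -- `expField` at `0`; the two halves add up.
  have h4 : VectorField.lieBracket ℝ (fun b => expField N b (coord Γ X n b))
      (fun b => expField N b (coord Γ Y n b)) 0 =
      fderiv ℝ (coord Γ Y n) 0 (coord Γ X n 0) - fderiv ℝ (coord Γ X n) 0 (coord Γ Y n 0) +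
        lieBrL d N (coord Γ X n 0) (coord Γ Y n 0) := by
    rw [VectorField.lieBracket, (hd X hX').fderiv, (hd Y hY').fderiv]
    simp only [expField_apply, map_zero, _root_.zero_apply, smul_zero, add_zero,
      _root_.add_apply, _root_.smul_apply, ContinuousLinearMap.flip_apply]
    rw [lieBrL_skew (coord Γ Y n 0) (coord Γ X n 0), smul_neg]
    module
  rw [h4] at h3
  set w := fderiv ℝ (coord Γ Y n) 0 (coord Γ X n 0) - fderiv ℝ (coord Γ X n) 0 (coord Γ Y n 0) +
    lieBrL d N (coord Γ X n 0) (coord Γ Y n 0)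
  have h5 : coframe Γ (par Γ n 0) (VectorField.mlieBracket (𝓡 d) X Y (par Γ n 0)) = _ :=
    (congrArg (coframe Γ (par Γ n 0)) h3).trans
      (congrArg (fun L : EuclideanSpace ℝ (Fin d) →L[ℝ] EuclideanSpace ℝ (Fin d) =>
        coframe Γ (par (d := d) Γ n 0) (L w))
        ((modelDeriv_par_zero h n).trans (congrArg (frE Γ) e0.symm)))
  rw [coframe_frE] at h5
  refine Eq.trans ?_ h5
  have h6 : ∀ p q : LeftQuotient Γ, p = q →
      coframe Γ p (VectorField.mlieBracket (𝓡 d) X Y p) =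
        coframe Γ q (VectorField.mlieBracket (𝓡 d) X Y q) := by
    rintro p _ rfl; rfl
  exact h6 _ _ e0.symm

variable (Γ) in
/-- The derivative of the components of a vector field in the directions of the frame. -/
def frameDeriv (X : ∀ x : LeftQuotient Γ, TangentSpace (𝓡 d) x) (x : LeftQuotient Γ) :
    EuclideanSpace ℝ (Fin d) →L[ℝ] EuclideanSpace ℝ (Fin d) :=
  fderiv ℝ (coord Γ X (Quotient.out x)) 0

theorem frameDeriv_mk (X : ∀ x : LeftQuotient Γ, TangentSpace (𝓡 d) x) (n : N) :
    frameDeriv Γ X (LeftQuotient.mk Γ n) = fderiv ℝ (coord Γ X n) 0 := by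
  have h : LeftQuotient.mk Γ (Quotient.out (LeftQuotient.mk Γ n)) = LeftQuotient.mk Γ n :=
    Quotient.out_eq _
  obtain ⟨γ, hγ⟩ := (isCov Γ).apply_eq_iff_mem_orbit.mp h
  have hγ' : (γ : N) * n = Quotient.out (LeftQuotient.mk Γ n) := hγ
  have h2 : coord Γ X ((γ : N) * n) = coord Γ X n := by
    funext a
    rw [coord_eq, coord_eq, par_smul]
  rw [frameDeriv, ← hγ', h2]

/-- The covariant derivative on `Γ\N` whose Christoffel symbols in the frame of the left-invariant
fields are given by a bilinear map. -/
def frameConnection (h : IsTwoStep d N) (C : EuclideanSpace ℝ (Fin d) →L[ℝ]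
    EuclideanSpace ℝ (Fin d) →L[ℝ] EuclideanSpace ℝ (Fin d)) : Connection d (LeftQuotient Γ) where
  toFun X x := (frE Γ x).comp ((frameDeriv Γ X x + C.flip (fld Γ X x)).comp (coframe Γ x))
  isCovariantDerivativeOnUniv := by
    refine ⟨fun {X Y x} hX hY _ => ?_, fun {X g x} hX hg _ => ?_⟩
    · obtain ⟨n, rfl⟩ := Quotient.exists_rep x
      have hX' := (mdifferentiableAt_field_iff_coord h).mp hX
      have hY' := (mdifferentiableAt_field_iff_coord h).mp hY
      have h1 : fld Γ (X + Y) = fld Γ X + fld Γ Y := funext fun y => map_add (coframe Γ y) _ _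
      have h2 : coord Γ (X + Y) n = coord Γ X n + coord Γ Y n := funext fun a => congrFun h1 _
      have h3 : frameDeriv Γ (X + Y) (LeftQuotient.mk Γ n) =
          frameDeriv Γ X (LeftQuotient.mk Γ n) + frameDeriv Γ Y (LeftQuotient.mk Γ n) := by
        rw [frameDeriv_mk, frameDeriv_mk, frameDeriv_mk, h2, fderiv_add hX' hY']
      ext1 v
      have h4 := congrArg (fun L => L (coframe Γ (LeftQuotient.mk Γ n) v)) h3
      have h5 := congrFun h1 (LeftQuotient.mk Γ n)
      change frE Γ (LeftQuotient.mk Γ n) (frameDeriv Γ (X + Y) (LeftQuotient.mk Γ n)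
          (coframe Γ (LeftQuotient.mk Γ n) v) + C (coframe Γ (LeftQuotient.mk Γ n) v)
            (fld Γ (X + Y) (LeftQuotient.mk Γ n))) =
        frE Γ (LeftQuotient.mk Γ n) (frameDeriv Γ X (LeftQuotient.mk Γ n)
          (coframe Γ (LeftQuotient.mk Γ n) v) + C (coframe Γ (LeftQuotient.mk Γ n) v)
            (fld Γ X (LeftQuotient.mk Γ n))) + frE Γ (LeftQuotient.mk Γ n)
            (frameDeriv Γ Y (LeftQuotient.mk Γ n)
          (coframe Γ (LeftQuotient.mk Γ n) v) + C (coframe Γ (LeftQuotient.mk Γ n) v)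
            (fld Γ Y (LeftQuotient.mk Γ n)))
      rw [h5, h3, Pi.add_apply, map_add (C _), _root_.add_apply]
      refine Eq.trans (congrArg _ ?_) (map_add (frE Γ (LeftQuotient.mk Γ n)) _ _)
      abel
    · obtain ⟨n, rfl⟩ := Quotient.exists_rep x
      have hX' := (mdifferentiableAt_field_iff_coord h).mp hX
      have hg1 := hasModelDerivAt_of_mdifferentiableAt hg
      set g' := modelDeriv (𝓡 d) 𝓘(ℝ, ℝ) g (LeftQuotient.mk Γ n) with hg'
      have hg2 : HasFDerivAt (fun a => g (par Γ n a))
          (g'.comp (frE Γ (LeftQuotient.mk Γ n))) 0 :=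
        hasModelDerivAt_iff_hasFDerivAt.mp
          (HasModelDerivAt.comp hg1 (hasModelDerivAt_par_zero h n) (par_zero Γ n))
      have h1 : ∀ y, fld Γ (g • X) y = g y • fld Γ X y := fun y => map_smul (coframe Γ y) _ _
      have h2 : coord Γ (g • X) n = fun a => g (par Γ n a) • coord Γ X n a :=
        funext fun a => h1 _
      have h3 := (hg2.smul hX'.hasFDerivAt).fderiv
      have h3' : frameDeriv Γ (g • X) (LeftQuotient.mk Γ n) = _ :=
        (frameDeriv_mk (g • X) n).trans ((congrArg (fun c => fderiv ℝ c 0) h2).trans h3)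
      rw [← frameDeriv_mk, coord_zero, par_zero] at h3'
      ext1 v
      change frE Γ (LeftQuotient.mk Γ n) (frameDeriv Γ (g • X) (LeftQuotient.mk Γ n)
          (coframe Γ (LeftQuotient.mk Γ n) v) + C (coframe Γ (LeftQuotient.mk Γ n) v)
            (fld Γ (g • X) (LeftQuotient.mk Γ n))) =
        g (LeftQuotient.mk Γ n) • frE Γ (LeftQuotient.mk Γ n)
          (frameDeriv Γ X (LeftQuotient.mk Γ n)
          (coframe Γ (LeftQuotient.mk Γ n) v) + C (coframe Γ (LeftQuotient.mk Γ n) v)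
            (fld Γ X (LeftQuotient.mk Γ n))) +
            g' v • (show EuclideanSpace ℝ (Fin d) from X (LeftQuotient.mk Γ n))
      have h4 : (show EuclideanSpace ℝ (Fin d) from X (LeftQuotient.mk Γ n)) =
        frE Γ (LeftQuotient.mk Γ n) (fld Γ X (LeftQuotient.mk Γ n)) := (frE_fld X _).symm
      have h5 : g' v = g' (frE Γ (LeftQuotient.mk Γ n) (coframe Γ (LeftQuotient.mk Γ n) v)) :=
        congrArg g' (frE_coframe Γ (LeftQuotient.mk Γ n) v).symm
      rw [h3', h1, h4, h5, ← map_smul, ← map_smul, ← map_add]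
      congr 1
      simp only [_root_.add_apply, _root_.smul_apply, ContinuousLinearMap.smulRight_apply,
        ContinuousLinearMap.comp_apply, map_smul]
      module

end QuotientCalculus

/-! ### Koszul's formula for constant Christoffel symbols -/

section Koszul

variable {d : ℕ} {N : Type*} [Group N] [TopologicalSpace N] [IsTopologicalGroup N] [T2Space N]
  [ChartedSpace (EuclideanSpace ℝ (Fin d)) N] [LieGroup (𝓡 d) ∞ N]
  {b : LinearMap.BilinForm ℝ (EuclideanSpace ℝ (Fin d))}

variable (N) in
/-- The Christoffel symbols of a torsion free connection compatible with the form `b`. -/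
structure IsChristoffel (b : LinearMap.BilinForm ℝ (EuclideanSpace ℝ (Fin d)))
    (C : EuclideanSpace ℝ (Fin d) → EuclideanSpace ℝ (Fin d) → EuclideanSpace ℝ (Fin d)) :
    Prop where
  torsion : ∀ x y, C x y - C y x = lieBrL d N x y
  metric : ∀ w x y, b (C w x) y + b x (C w y) = 0

/-- Three cyclic instances of the torsion identity combined with three of the metric identity, as
for Koszul's formula with constant inner products. -/
theorem IsChristoffel.koszul (hb : b.IsSymm)
    {C : EuclideanSpace ℝ (Fin d) → EuclideanSpace ℝ (Fin d) → EuclideanSpace ℝ (Fin d)}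
    (hC : IsChristoffel N b C) (x y w : EuclideanSpace ℝ (Fin d)) :
    2 * b (C x y) w = b (lieBrL d N x y) w - b (lieBrL d N y w) x + b (lieBrL d N w x) y := by
  have ht : ∀ x y w, b (C x y) w - b (C y x) w = b (lieBrL d N x y) w := fun x y w => by
    rw [← hC.torsion, map_sub, LinearMap.sub_apply]
  have hm : ∀ w x y, b (C w x) y + b (C w y) x = 0 := fun w x y => by
    rw [hb.eq (C w y) x]; exact hC.metric w x y
  have h1 := ht x y w
  have h2 := ht y w x
  have h3 := ht w x y
  have h4 := hm y x w
  have h5 := hm w y x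
  have h6 := hm x w y
  linarith

theorem IsChristoffel.unique (hb : b.IsSymm) (hbn : b.Nondegenerate)
    {C C' : EuclideanSpace ℝ (Fin d) → EuclideanSpace ℝ (Fin d) → EuclideanSpace ℝ (Fin d)}
    (hC : IsChristoffel N b C) (hC' : IsChristoffel N b C') (x y : EuclideanSpace ℝ (Fin d)) :
    C x y = C' x y := by
  refine sub_eq_zero.mp (hbn.1 _ fun w => ?_)
  have h1 := hC.koszul hb x y w
  have h2 := hC'.koszul hb x y w
  rw [map_sub, LinearMap.sub_apply]
  linarith

/-- Each bracket in Koszul's formula has `x` or `y` as an entry. All the geometry of the orbits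
rests on this. -/
theorem IsChristoffel.eq_zero_of_mem_center (hb : b.IsSymm) (hbn : b.Nondegenerate)
    {C : EuclideanSpace ℝ (Fin d) → EuclideanSpace ℝ (Fin d) → EuclideanSpace ℝ (Fin d)}
    (hC : IsChristoffel N b C) {x y : EuclideanSpace ℝ (Fin d)} (hx : x ∈ centerE d N)
    (hy : y ∈ centerE d N) : C x y = 0 := by
  refine hbn.1 _ fun w => ?_
  have h1 := hC.koszul hb x y w
  rw [mem_centerE] at hx hy
  rw [hx, hy, lieBrL_skew w x, hx] at h1
  simpa using h1

/-- The right side of Koszul's formula is a functional of `w`, represented by a vector since the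
form is nondegenerate. -/
theorem exists_isChristoffel (hb : b.IsSymm) (hbn : b.Nondegenerate) :
    ∃ C : EuclideanSpace ℝ (Fin d) →L[ℝ] EuclideanSpace ℝ (Fin d) →L[ℝ] EuclideanSpace ℝ (Fin d),
      IsChristoffel N b (fun x y => C x y) := by
  set f : EuclideanSpace ℝ (Fin d) → EuclideanSpace ℝ (Fin d) →
      Module.Dual ℝ (EuclideanSpace ℝ (Fin d)) := fun x y =>
    (1 / 2 : ℝ) • (b (lieBrL d N x y) - (b x) ∘ₗ (lieBrL d N y).toLinearMap -
      (b y) ∘ₗ (lieBrL d N x).toLinearMap) with hf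
  have hfa : ∀ x y w, f x y w = (1 / 2 : ℝ) * (b (lieBrL d N x y) w - b x (lieBrL d N y w) -
      b y (lieBrL d N x w)) := fun x y w => rfl
  set C₀ : EuclideanSpace ℝ (Fin d) →ₗ[ℝ] EuclideanSpace ℝ (Fin d) →ₗ[ℝ]
      EuclideanSpace ℝ (Fin d) :=
    LinearMap.mk₂ ℝ (fun x y => (LinearMap.BilinForm.toDual b hbn).symm (f x y))
      (fun x x' y => by
        rw [← map_add]; congr 1; ext1 w
        simp only [LinearMap.add_apply, hfa, map_add, _root_.add_apply]; ring)
      (fun c x y => by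
        rw [← map_smul]; congr 1; ext1 w
        simp only [LinearMap.smul_apply, hfa, map_smul, _root_.smul_apply, smul_eq_mul]; ring)
      (fun x y y' => by
        rw [← map_add]; congr 1; ext1 w
        simp only [LinearMap.add_apply, hfa, map_add, _root_.add_apply]; ring)
      (fun c x y => by
        rw [← map_smul]; congr 1; ext1 w
        simp only [LinearMap.smul_apply, hfa, map_smul, _root_.smul_apply, smul_eq_mul]; ring)
    with hC₀
  have hCb : ∀ x y w, b (C₀ x y) w = (1 / 2 : ℝ) * (b (lieBrL d N x y) w -
      b x (lieBrL d N y w) - b y (lieBrL d N x w)) := fun x y w =>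
    LinearMap.BilinForm.apply_toDual_symm_apply (hB := hbn) (f x y) w
  refine ⟨LinearMap.toContinuousLinearMap ((LinearMap.toContinuousLinearMap (𝕜 := ℝ)
    (E := EuclideanSpace ℝ (Fin d)) (F' := EuclideanSpace ℝ (Fin d))).toLinearMap ∘ₗ C₀),
    fun x y => ?_, fun w x y => ?_⟩
  · change C₀ x y - C₀ y x = _
    refine sub_eq_zero.mp (hbn.1 _ fun w => ?_)
    rw [map_sub, map_sub, LinearMap.sub_apply, LinearMap.sub_apply, hCb, hCb, lieBrL_skew y x,
      map_neg, LinearMap.neg_apply]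
    ring
  · change b (C₀ w x) y + b x (C₀ w y) = 0
    rw [hb.eq x, hCb, hCb, lieBrL_skew y x, hb.eq (lieBrL d N w x) y, hb.eq (lieBrL d N w y) x,
      map_neg]
    ring

end Koszul

/-! ### Existence and uniqueness of the Levi-Civita connection -/

section LeviCivita

variable {d : ℕ} {N : Type*} [Group N] [TopologicalSpace N] [IsTopologicalGroup N] [T2Space N]
  [LocallyCompactSpace N] [ChartedSpace (EuclideanSpace ℝ (Fin d)) N] [LieGroup (𝓡 d) ∞ N]
  {Γ : Subgroup N} [DiscreteTopology Γ] {B : LinearMap.BilinForm ℝ (GroupLieAlgebra (𝓡 d) N)}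
  {C : EuclideanSpace ℝ (Fin d) →L[ℝ] EuclideanSpace ℝ (Fin d) →L[ℝ] EuclideanSpace ℝ (Fin d)}

theorem metric_apply (x : LeftQuotient Γ) (u w : EuclideanSpace ℝ (Fin d)) :
    LeftQuotient.metric Γ B x u w = formE N B (coframe Γ x u) (coframe Γ x w) := rfl

/-- A bilinear form on the model space as a continuous bilinear map. -/
def formL (b : LinearMap.BilinForm ℝ (EuclideanSpace ℝ (Fin d))) :
    EuclideanSpace ℝ (Fin d) →L[ℝ] EuclideanSpace ℝ (Fin d) →L[ℝ] ℝ :=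
  LinearMap.toContinuousLinearMap
    ((LinearMap.toContinuousLinearMap (𝕜 := ℝ) (E := EuclideanSpace ℝ (Fin d))
      (F' := ℝ)).toLinearMap ∘ₗ b)

theorem formL_apply (b : LinearMap.BilinForm ℝ (EuclideanSpace ℝ (Fin d)))
    (x y : EuclideanSpace ℝ (Fin d)) : formL b x y = b x y := rfl

theorem hasFDerivAt_form (b : LinearMap.BilinForm ℝ (EuclideanSpace ℝ (Fin d)))
    {f g : EuclideanSpace ℝ (Fin d) → EuclideanSpace ℝ (Fin d)}
    {f' g' : EuclideanSpace ℝ (Fin d) →L[ℝ] EuclideanSpace ℝ (Fin d)}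
    {a : EuclideanSpace ℝ (Fin d)} (hf : HasFDerivAt f f' a) (hg : HasFDerivAt g g' a) :
    ∃ L : EuclideanSpace ℝ (Fin d) →L[ℝ] ℝ, HasFDerivAt (fun a => b (f a) (g a)) L a ∧
      ∀ v, L v = b (f' v) (g a) + b (f a) (g' v) := by
  refine ⟨_, ((formL b).hasFDerivAt.comp a hf).clm_apply hg, fun v => ?_⟩
  simp [formL_apply, add_comm]

/-- In the frame the metric is a constant form, so the derivatives of components satisfy the product
rule by themselves and give the derivative part of the bracket. What is left are the two algebraic
identities of `IsChristoffel`. -/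
theorem isLeviCivita_frameConnection (h : IsTwoStep d N) (hC : IsChristoffel N (formE N B)
    (fun x y => C x y)) : IsLeviCivita (LeftQuotient.metric Γ B) (frameConnection h C) := by
  constructor
  · rw [CovariantDerivative.torsion_eq_zero_iff]
    intro X Y x hX hY
    obtain ⟨n, rfl⟩ := Quotient.exists_rep x
    have h1 := coframe_mlieBracket h hX hY
    rw [← frameDeriv_mk, ← frameDeriv_mk, coord_zero, coord_zero] at h1
    have h2 : (VectorField.mlieBracket (𝓡 d) X Y (LeftQuotient.mk Γ n) :
        EuclideanSpace ℝ (Fin d)) = _ :=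
      (frE_coframe Γ (LeftQuotient.mk Γ n) _).symm.trans
        (congrArg (frE Γ (LeftQuotient.mk Γ n)) h1)
    refine Eq.trans ?_ h2.symm
    refine (map_sub (frE Γ (LeftQuotient.mk Γ n)) _ _).symm.trans ?_
    congr 1
    change frameDeriv Γ Y (LeftQuotient.mk Γ n) (fld Γ X (LeftQuotient.mk Γ n)) +
      C (fld Γ X (LeftQuotient.mk Γ n)) (fld Γ Y (LeftQuotient.mk Γ n)) -
      (frameDeriv Γ X (LeftQuotient.mk Γ n) (fld Γ Y (LeftQuotient.mk Γ n)) +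
      C (fld Γ Y (LeftQuotient.mk Γ n)) (fld Γ X (LeftQuotient.mk Γ n))) = _
    rw [← hC.torsion]
    abel
  · intro X Y hX hY x v
    obtain ⟨n, rfl⟩ := Quotient.exists_rep x
    have hX' := ((isSmoothField_iff_coord h).mp hX n).differentiable (by simp) 0
    have hY' := ((isSmoothField_iff_coord h).mp hY n).differentiable (by simp) 0
    obtain ⟨L, hL, hLv⟩ := hasFDerivAt_form (formE N B) hX'.hasFDerivAt hY'.hasFDerivAt
    have h1 := (hasModelDerivAt_of_comp_par h
      (G := fun y => formE N B (fld Γ X y) (fld Γ Y y)) hL).modelDeriv_eq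
    refine (congrArg (fun A : EuclideanSpace ℝ (Fin d) →L[ℝ] ℝ => A v) h1).trans ?_
    set u := coframe Γ (LeftQuotient.mk Γ n) v with hu
    have h2 : formE N B (coframe Γ (LeftQuotient.mk Γ n) (frE Γ (LeftQuotient.mk Γ n)
          (frameDeriv Γ X (LeftQuotient.mk Γ n) u + C u (fld Γ X (LeftQuotient.mk Γ n)))))
          (fld Γ Y (LeftQuotient.mk Γ n)) +
        formE N B (fld Γ X (LeftQuotient.mk Γ n)) (coframe Γ (LeftQuotient.mk Γ n)
          (frE Γ (LeftQuotient.mk Γ n) (frameDeriv Γ Y (LeftQuotient.mk Γ n) u +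
            C u (fld Γ Y (LeftQuotient.mk Γ n))))) = L u := by
      rw [hLv, ← frameDeriv_mk, ← frameDeriv_mk, coord_zero, coord_zero, coframe_frE,
        coframe_frE, map_add, map_add, LinearMap.add_apply]
      have := hC.metric u (fld Γ X (LeftQuotient.mk Γ n)) (fld Γ Y (LeftQuotient.mk Γ n))
      linarith
    exact h2.symm

/-- The Levi-Civita connection is determined by its Christoffel symbols. -/
theorem IsLeviCivita.apply_eq (h : IsTwoStep d N) (hb : (formE N B).IsSymm)
    (hbn : (formE N B).Nondegenerate) (hC : IsChristoffel N (formE N B) (fun x y => C x y))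
    {nab : Connection d (LeftQuotient Γ)} (hnab : IsLeviCivita (LeftQuotient.metric Γ B) nab)
    {X : ∀ x : LeftQuotient Γ, TangentSpace (𝓡 d) x} {x : LeftQuotient Γ}
    (hX : MDifferentiableAt (𝓡 d) (𝓡 d).tangent
      (fun x => (⟨x, X x⟩ : TangentBundle (𝓡 d) (LeftQuotient Γ))) x)
    (v : EuclideanSpace ℝ (Fin d)) :
    nab X x v = frE Γ x (frameDeriv Γ X x (coframe Γ x v) + C (coframe Γ x v) (fld Γ X x)) := by
  have hM : IsManifold (𝓡 d) 1 (LeftQuotient Γ) := IsManifold.of_le (n := ∞) (by simp)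
  have hsm := fun u => (isSmoothField_frameField (Γ := Γ) h u)
  -- On frame fields, whose brackets are those of the Lie algebra and whose inner products are
  -- constant, the values of `nab` at `x` are Christoffel symbols, so they equal `C` by uniqueness.
  have hG : IsChristoffel N (formE N B)
      (fun w u => coframe Γ x (nab (frameField Γ u) x (frE Γ x w))) := by
    constructor
    · intro w u
      obtain ⟨n, rfl⟩ := Quotient.exists_rep x
      have h1 := (CovariantDerivative.torsion_eq_zero_iff nab).mp hnab.torsion
        ((hsm w).mdifferentiableAt (LeftQuotient.mk Γ n))
        ((hsm u).mdifferentiableAt (LeftQuotient.mk Γ n))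
      have h2 := coframe_mlieBracket h ((hsm w).mdifferentiableAt (LeftQuotient.mk Γ n))
        ((hsm u).mdifferentiableAt (LeftQuotient.mk Γ n))
      rw [coord_frameField, coord_frameField, fderiv_const_apply, fderiv_const_apply] at h2
      simp only [_root_.zero_apply, sub_zero, zero_add] at h2
      refine Eq.trans ?_ h2
      refine (map_sub (coframe Γ (LeftQuotient.mk Γ n)) _ _).symm.trans ?_
      exact congrArg (coframe Γ (LeftQuotient.mk Γ n)) h1
    · intro w u u'
      have h1 := hnab.metric (frameField Γ u) (frameField Γ u') (hsm u) (hsm u') x (frE Γ x w)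
      have h2 : (fun y => LeftQuotient.metric Γ B y (frameField Γ u y) (frameField Γ u' y)) =
          fun _ => formE N B u u' := by
        funext y
        exact congrArg₂ (fun p q => formE N B p q) (fld_frameField u y) (fld_frameField u' y)
      have h3 : mfderiv (𝓡 d) 𝓘(ℝ, ℝ)
          (fun y => LeftQuotient.metric Γ B y (frameField Γ u y) (frameField Γ u' y)) x
          (frE Γ x w) = 0 := by
        rw [h2, mfderiv_const]; rfl
      have h4 := h1.symm.trans h3
      have h5 := fld_frameField (Γ := Γ) u x
      have h6 := fld_frameField (Γ := Γ) u' x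
      refine Eq.trans ?_ h4
      exact congrArg₂ (· + ·) (congrArg (formE N B _) h6.symm)
        (congrArg (fun p => formE N B p _) h5.symm)
  have key : ∀ w u, nab (frameField Γ u) x (frE Γ x w) =
      (frameConnection h C).toFun (frameField Γ u) x (frE Γ x w) := by
    intro w u
    have h1 := hG.unique hb hbn hC w u
    have h2 : nab (frameField Γ u) x (frE Γ x w) = frE Γ x (C w u) :=
      (frE_coframe Γ x _).symm.trans (congrArg (frE Γ x) h1)
    refine h2.trans ?_
    have h3 : frameDeriv Γ (frameField Γ u) x = 0 := by
      rw [frameDeriv, coord_frameField, fderiv_const_apply]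
    have h4 : frE Γ x (C w u) = frE Γ x (frameDeriv Γ (frameField Γ u) x
        (coframe Γ x (frE Γ x w)) + C (coframe Γ x (frE Γ x w)) (fld Γ (frameField Γ u) x)) := by
      rw [h3, coframe_frE, fld_frameField, _root_.zero_apply, zero_add]
    exact h4
  have hcov := nab.isCovariantDerivativeOnUniv
  have hcov' := (frameConnection (Γ := Γ) h C).isCovariantDerivativeOnUniv
  -- The difference of two covariant derivatives is tensorial, so at `x` the field `X` may be
  -- replaced by the frame field with the same value.
  set D := IsCovariantDerivativeOn.difference hcov hcov' x with hD
  have h1 : D (X x) = nab X x - (frameConnection h C).toFun X x :=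
    IsCovariantDerivativeOn.difference_apply hcov hcov' trivial hX
  have h2 : D (frameField Γ (fld Γ X x) x) = nab (frameField Γ (fld Γ X x)) x -
      (frameConnection h C).toFun (frameField Γ (fld Γ X x)) x :=
    IsCovariantDerivativeOn.difference_apply hcov hcov' trivial ((hsm _).mdifferentiableAt x)
  have h3 : frameField Γ (fld Γ X x) x = X x := frE_fld X x
  rw [h3, h1] at h2
  have h4 : nab X x v - (frameConnection h C).toFun X x v =
      nab (frameField Γ (fld Γ X x)) x v -
      (frameConnection h C).toFun (frameField Γ (fld Γ X x)) x v := congrArg (fun A => A v) h2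
  have h5 : nab (frameField Γ (fld Γ X x)) x v =
      (frameConnection h C).toFun (frameField Γ (fld Γ X x)) x v := by
    have h6 := key (coframe Γ x v) (fld Γ X x)
    have h7 : frE Γ x (coframe Γ x v) = v := frE_coframe Γ x v
    rwa [h7] at h6
  rw [h5, sub_self, sub_eq_zero] at h4
  exact h4

end LeviCivita

/-! ### Curvature, and the geometry of subsets tangent to the center -/

section OrbitGeometry

variable {d : ℕ} {N : Type*} [Group N] [TopologicalSpace N] [IsTopologicalGroup N] [T2Space N]
  [LocallyCompactSpace N] [ChartedSpace (EuclideanSpace ℝ (Fin d)) N] [LieGroup (𝓡 d) ∞ N]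
  {Γ : Subgroup N} [DiscreteTopology Γ] {B : LinearMap.BilinForm ℝ (GroupLieAlgebra (𝓡 d) N)}
  {C : EuclideanSpace ℝ (Fin d) →L[ℝ] EuclideanSpace ℝ (Fin d) →L[ℝ] EuclideanSpace ℝ (Fin d)}
  {nab : Connection d (LeftQuotient Γ)}

/-- Expresses the frame derivative at nearby points in one fixed coordinate system, as second
derivatives require; there the frame at `a` is `expField a`. -/
theorem frameDeriv_par (h : IsTwoStep d N) {X : ∀ x : LeftQuotient Γ, TangentSpace (𝓡 d) x}
    (hX : IsSmoothField X) (n : N) (a : EuclideanSpace ℝ (Fin d)) :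
    frameDeriv Γ X (par Γ n a) = (fderiv ℝ (coord Γ X n) a).comp (expField N a) := by
  have h1 : frameDeriv Γ X (par Γ n a) = _ := frameDeriv_mk X (n * gexp N a)
  rw [h1, coord_mul_gexp h]
  have h2 : DifferentiableAt ℝ (coord Γ X n) (bch (N := N) a 0) :=
    ((isSmoothField_iff_coord h).mp hX n).differentiable (by simp) _
  have h3 := (h2.hasFDerivAt.comp 0 (hasFDerivAt_bch (N := N) a 0)).fderiv
  rw [bch_zero_right] at h3
  exact h3

theorem fld_connection (h : IsTwoStep d N) (hb : (formE N B).IsSymm)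
    (hbn : (formE N B).Nondegenerate) (hC : IsChristoffel N (formE N B) (fun x y => C x y))
    (hnab : IsLeviCivita (LeftQuotient.metric Γ B) nab)
    {Y W : ∀ x : LeftQuotient Γ, TangentSpace (𝓡 d) x}
    {x : LeftQuotient Γ} (hW : MDifferentiableAt (𝓡 d) (𝓡 d).tangent
      (fun x => (⟨x, W x⟩ : TangentBundle (𝓡 d) (LeftQuotient Γ))) x) :
    fld Γ (fun y => nab W y (Y y)) x =
      frameDeriv Γ W x (fld Γ Y x) + C (fld Γ Y x) (fld Γ W x) :=
  (congrArg (coframe Γ x) (hnab.apply_eq h hb hbn hC hW (Y x))).trans (coframe_frE Γ x _)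

/-- In the coordinates at `n` the components of `∇_Y W` are `dW(expField a Y) + C Y W`. The
dependence of `expField` on `a` produces the term with `½[v, Y]`. -/
theorem hasFDerivAt_coord_connection (h : IsTwoStep d N) (hb : (formE N B).IsSymm)
    (hbn : (formE N B).Nondegenerate) (hC : IsChristoffel N (formE N B) (fun x y => C x y))
    (hnab : IsLeviCivita (LeftQuotient.metric Γ B) nab)
    {Y W : ∀ x : LeftQuotient Γ, TangentSpace (𝓡 d) x} (hY : IsSmoothField Y)
    (hW : IsSmoothField W) (n : N) :
    ∃ L : EuclideanSpace ℝ (Fin d) →L[ℝ] EuclideanSpace ℝ (Fin d),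
      HasFDerivAt (coord Γ (fun y => nab W y (Y y)) n) L 0 ∧ ∀ v, L v =
        fderiv ℝ (fderiv ℝ (coord Γ W n)) 0 v (coord Γ Y n 0) +
        fderiv ℝ (coord Γ W n) 0 ((1 / 2 : ℝ) • lieBrL d N v (coord Γ Y n 0) +
          fderiv ℝ (coord Γ Y n) 0 v) +
        (C (fderiv ℝ (coord Γ Y n) 0 v) (coord Γ W n 0) +
          C (coord Γ Y n 0) (fderiv ℝ (coord Γ W n) 0 v)) := by
  have hy := (isSmoothField_iff_coord h).mp hY n
  have hw := (isSmoothField_iff_coord h).mp hW n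
  have hy0 := (hy.differentiable (by simp) 0).hasFDerivAt
  have hw0 := (hw.differentiable (by simp) 0).hasFDerivAt
  have hw1 : HasFDerivAt (fderiv ℝ (coord Γ W n)) _ 0 :=
    ((hw.fderiv_right (m := ∞) (by simp)).differentiable (by simp) 0).hasFDerivAt
  have h1 : coord Γ (fun y => nab W y (Y y)) n = fun a =>
      fderiv ℝ (coord Γ W n) a (coord Γ Y n a + (1 / 2 : ℝ) • lieBrL d N a (coord Γ Y n a)) +
        C (coord Γ Y n a) (coord Γ W n a) := by
    funext a
    rw [coord_eq, fld_connection h hb hbn hC hnab (hW.mdifferentiableAt _),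
      frameDeriv_par h hW]
    rfl
  rw [h1]
  have h2 := hy0.add ((((lieBrL d N).hasFDerivAt (x := 0)).clm_apply hy0).const_smul (1 / 2 : ℝ))
  have h3 := (hw1.clm_apply h2).add ((C.hasFDerivAt.comp 0 hy0).clm_apply hw0)
  refine ⟨_, h3, fun v => ?_⟩
  simp only [Pi.add_apply, Pi.smul_apply, map_zero, _root_.zero_apply, smul_zero, add_zero,
    _root_.add_apply, ContinuousLinearMap.comp_apply, ContinuousLinearMap.flip_apply,
    _root_.smul_apply, map_add, Function.comp_apply, zero_add]
  abel

/-- The curvature of `Γ\N` in the frame of the left-invariant fields. -/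
theorem coframe_curvature (h : IsTwoStep d N) (hb : (formE N B).IsSymm)
    (hbn : (formE N B).Nondegenerate) (hC : IsChristoffel N (formE N B) (fun x y => C x y))
    (hnab : IsLeviCivita (LeftQuotient.metric Γ B) nab)
    {X Y W : ∀ x : LeftQuotient Γ, TangentSpace (𝓡 d) x} (hX : IsSmoothField X)
    (hY : IsSmoothField Y) (hW : IsSmoothField W) (x : LeftQuotient Γ) :
    coframe Γ x (curvature nab X Y W x) =
      C (fld Γ X x) (C (fld Γ Y x) (fld Γ W x)) - C (fld Γ Y x) (C (fld Γ X x) (fld Γ W x)) -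
        C (lieBrL d N (fld Γ X x) (fld Γ Y x)) (fld Γ W x) := by
  obtain ⟨n, hn⟩ := Quotient.exists_rep x
  have hn' : LeftQuotient.mk Γ n = x := hn
  subst hn'
  clear hn
  have hw := (isSmoothField_iff_coord h).mp hW n
  have key : ∀ {X Y : ∀ x : LeftQuotient Γ, TangentSpace (𝓡 d) x}, IsSmoothField X →
      IsSmoothField Y →
      coframe Γ (LeftQuotient.mk Γ n)
        (nab (fun y => nab W y (Y y)) (LeftQuotient.mk Γ n) (X (LeftQuotient.mk Γ n))) =
        fderiv ℝ (fderiv ℝ (coord Γ W n)) 0 (coord Γ X n 0) (coord Γ Y n 0) +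
        fderiv ℝ (coord Γ W n) 0 ((1 / 2 : ℝ) • lieBrL d N (coord Γ X n 0) (coord Γ Y n 0) +
          fderiv ℝ (coord Γ Y n) 0 (coord Γ X n 0)) +
        (C (fderiv ℝ (coord Γ Y n) 0 (coord Γ X n 0)) (coord Γ W n 0) +
          C (coord Γ Y n 0) (fderiv ℝ (coord Γ W n) 0 (coord Γ X n 0))) +
        C (coord Γ X n 0) (fderiv ℝ (coord Γ W n) 0 (coord Γ Y n 0) +
          C (coord Γ Y n 0) (coord Γ W n 0)) := by
    intro X Y hX hY
    obtain ⟨L, hL, hLv⟩ := hasFDerivAt_coord_connection h hb hbn hC hnab hY hW n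
    have h1 : MDifferentiableAt (𝓡 d) (𝓡 d).tangent (fun x =>
        (⟨x, nab W x (Y x)⟩ : TangentBundle (𝓡 d) (LeftQuotient Γ))) (LeftQuotient.mk Γ n) :=
      (mdifferentiableAt_field_iff_coord h).mpr hL.differentiableAt
    have h2 := fld_connection h hb hbn hC hnab (Y := X) h1
    refine Eq.trans h2 ?_
    rw [fld_connection h hb hbn hC hnab (hW.mdifferentiableAt _), frameDeriv_mk, frameDeriv_mk,
      hL.fderiv, ← coord_zero, ← coord_zero, ← coord_zero, hLv]
  have h1 := key hX hY
  have h2 := key hY hX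
  have h3 : coframe Γ (LeftQuotient.mk Γ n) (nab W (LeftQuotient.mk Γ n)
      (VectorField.mlieBracket (𝓡 d) X Y (LeftQuotient.mk Γ n))) = _ :=
    fld_connection h hb hbn hC hnab (Y := VectorField.mlieBracket (𝓡 d) X Y)
      (hW.mdifferentiableAt _)
  have h4 : fld Γ (VectorField.mlieBracket (𝓡 d) X Y) (LeftQuotient.mk Γ n) = _ :=
    coframe_mlieBracket h (hX.mdifferentiableAt _) (hY.mdifferentiableAt _)
  rw [h4, frameDeriv_mk, ← coord_zero] at h3
  -- The second derivatives of `W` cancel in the antisymmetrization. The first derivatives cancel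
  -- against `∇_[X, Y] W`, the terms `½[X, Y]` and `-½[Y, X]` adding up to `[X, Y]`.
  have hsym : fderiv ℝ (fderiv ℝ (coord Γ W n)) 0 (coord Γ X n 0) (coord Γ Y n 0) =
      fderiv ℝ (fderiv ℝ (coord Γ W n)) 0 (coord Γ Y n 0) (coord Γ X n 0) :=
    (hw.contDiffAt.isSymmSndFDerivAt (by
      rw [minSmoothness_of_isRCLikeNormedField]; exact WithTop.coe_le_coe.mpr le_top)) _ _
  rw [← coord_zero, ← coord_zero, ← coord_zero]
  have h5 : coframe Γ (LeftQuotient.mk Γ n) (curvature nab X Y W (LeftQuotient.mk Γ n)) =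
      coframe Γ (LeftQuotient.mk Γ n)
        (nab (fun y => nab W y (Y y)) (LeftQuotient.mk Γ n) (X (LeftQuotient.mk Γ n))) -
      coframe Γ (LeftQuotient.mk Γ n)
        (nab (fun y => nab W y (X y)) (LeftQuotient.mk Γ n) (Y (LeftQuotient.mk Γ n))) -
      coframe Γ (LeftQuotient.mk Γ n) (nab W (LeftQuotient.mk Γ n)
        (VectorField.mlieBracket (𝓡 d) X Y (LeftQuotient.mk Γ n))) :=
    (map_sub (coframe Γ (LeftQuotient.mk Γ n)) _ _).trans
      (congrArg (· - _) (map_sub (coframe Γ (LeftQuotient.mk Γ n)) _ _))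
  rw [h5, h1, h2, h3, hsym, lieBrL_skew (coord Γ Y n 0) (coord Γ X n 0)]
  simp only [map_add, map_sub, map_smul, map_neg, _root_.add_apply, _root_.sub_apply, smul_neg]
  module

variable {S : Set (LeftQuotient Γ)}

/-- For central arguments every term of `coframe_curvature` contains `C` of two central vectors or a
bracket with a central vector. -/
theorem isFlat_of_tangentVectors (h : IsTwoStep d N) (hb : (formE N B).IsSymm)
    (hbn : (formE N B).Nondegenerate) (hnab : IsLeviCivita (LeftQuotient.metric Γ B) nab)
    (hS : ∀ x ∈ S, ∀ v : EuclideanSpace ℝ (Fin d),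
      v ∈ tangentVectors (d := d) S x ↔ coframe Γ x v ∈ centerE d N) :
    IsFlat (LeftQuotient.metric Γ B) nab S := by
  obtain ⟨C, hC⟩ := exists_isChristoffel (N := N) hb hbn
  intro x hx X Y hX hY hXx hYx
  have hx' : fld Γ X x ∈ centerE d N := (hS x hx _).mp hXx
  have hy' : fld Γ Y x ∈ centerE d N := (hS x hx _).mp hYx
  have h1 := coframe_curvature h hb hbn hC hnab hX hY hY x
  have hz : ∀ {u w}, u ∈ centerE d N → w ∈ centerE d N → C u w = 0 := fun hu hw =>
    hC.eq_zero_of_mem_center hb hbn hu hw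
  rw [hz hy' hy', hz hx' hy', mem_centerE.mp hx', map_zero, map_zero, map_zero,
    _root_.zero_apply, sub_zero, sub_zero] at h1
  refine (metric_apply x _ _).trans ?_
  rw [h1, map_zero, LinearMap.zero_apply]

theorem mem_centerE_of_hasDerivAt {f : ℝ → EuclideanSpace ℝ (Fin d)}
    {f' : EuclideanSpace ℝ (Fin d)} {t : ℝ} (hf : HasDerivAt f f' t)
    (hz : ∀ᶠ s in 𝓝 t, f s ∈ centerE d N) : f' ∈ centerE d N := by
  have h1 := (lieBrL d N).hasFDerivAt.comp_hasDerivAt t hf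
  have h2 : HasDerivAt (lieBrL d N ∘ f) 0 t := by
    refine (hasDerivAt_const t 0).congr_of_eventuallyEq ?_
    filter_upwards [hz] with s hs
    exact ContinuousLinearMap.ext (mem_centerE.mp hs)
  rw [mem_centerE]
  exact fun y => congrArg (fun A => A y) (h1.unique h2)

/-- The Christoffel term vanishes, and the components of `Y` stay in the closed subspace `𝔷` along
the central curve with velocity `X`, so their derivative does too. -/
theorem isTotallyGeodesic_of_tangentVectors (h : IsTwoStep d N) (hb : (formE N B).IsSymm)
    (hbn : (formE N B).Nondegenerate) (hnab : IsLeviCivita (LeftQuotient.metric Γ B) nab)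
    (hS : ∀ x ∈ S, ∀ v : EuclideanSpace ℝ (Fin d),
      v ∈ tangentVectors (d := d) S x ↔ coframe Γ x v ∈ centerE d N)
    (hSz : ∀ n, LeftQuotient.mk Γ n ∈ S → ∀ z ∈ centerE d N, par Γ n z ∈ S) :
    IsTotallyGeodesic nab S := by
  obtain ⟨C, hC⟩ := exists_isChristoffel (N := N) hb hbn
  intro X Y hX hY hXS hYS x hx
  obtain ⟨n, hn⟩ := Quotient.exists_rep x
  have hn' : LeftQuotient.mk Γ n = x := hn
  subst hn'
  clear hn
  refine (hS _ hx _).mpr ?_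
  have h1 := fld_connection h hb hbn hC hnab (Y := X) (hY.mdifferentiableAt (LeftQuotient.mk Γ n))
  have hx' : fld Γ X (LeftQuotient.mk Γ n) ∈ centerE d N := (hS _ hx _).mp (hXS _ hx)
  have hy' : fld Γ Y (LeftQuotient.mk Γ n) ∈ centerE d N := (hS _ hx _).mp (hYS _ hx)
  have h2 : C (fld Γ X (LeftQuotient.mk Γ n)) (fld Γ Y (LeftQuotient.mk Γ n)) = 0 :=
    hC.eq_zero_of_mem_center hb hbn hx' hy'
  rw [h2, add_zero] at h1
  have h3 : coframe Γ (LeftQuotient.mk Γ n)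
      (nab Y (LeftQuotient.mk Γ n) (X (LeftQuotient.mk Γ n))) = _ := h1
  rw [h3, frameDeriv_mk]
  set z := fld Γ X (LeftQuotient.mk Γ n)
  have hd : HasDerivAt (fun s : ℝ => s • z) z 0 := by
    simpa using (hasDerivAt_id (0 : ℝ)).smul_const z
  have h4 : HasFDerivAt (coord Γ Y n) (fderiv ℝ (coord Γ Y n) 0) ((0 : ℝ) • z) := by
    rw [zero_smul]
    exact (((isSmoothField_iff_coord h).mp hY n).differentiable (by simp) 0).hasFDerivAt
  refine mem_centerE_of_hasDerivAt (h4.comp_hasDerivAt 0 hd) (Filter.Eventually.of_forall ?_)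
  intro s
  have h5 := hSz n hx (s • z) ((centerE d N).smul_mem s hx')
  exact (hS _ h5 _).mp (hYS _ h5)

/-- The projection of a one-parameter subgroup has the velocity of the left-invariant field. -/
theorem velocity_par_smul (h : IsTwoStep d N) (n : N) (z : EuclideanSpace ℝ (Fin d)) (t : ℝ) :
    velocity (d := d) (fun s : ℝ => par Γ n (s • z)) t =
      ⟨par Γ n (t • z), frE Γ (par Γ n (t • z)) z⟩ := by
  have hd : HasDerivAt (fun s : ℝ => s • z) z t := by
    simpa using (hasDerivAt_id t).smul_const z
  have h1 := HasModelDerivAt.comp (hasModelDerivAt_of_contMDiffAt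
    (contMDiff_par (Γ := Γ) h n).contMDiffAt (by simp))
    (hasModelDerivAt_iff_hasFDerivAt.mpr hd.hasFDerivAt) rfl
  have h2 := congrArg (fun A : ℝ →L[ℝ] EuclideanSpace ℝ (Fin d) => A 1) h1.modelDeriv_eq
  have h3 : modelDeriv 𝓘(ℝ, EuclideanSpace ℝ (Fin d)) (𝓡 d) (par (d := d) Γ n) (t • z) z =
      frE Γ (par Γ n (t • z)) z := by
    have h4 := congrArg (fun A : _ →L[ℝ] EuclideanSpace ℝ (Fin d) => A z)
      (modelDeriv_par_comp (Γ := Γ) h n (t • z))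
    have h5 : expField N (t • z) z = z := by
      simp [expField_apply, lieBrL_self]
    have h6 : modelDeriv 𝓘(ℝ, EuclideanSpace ℝ (Fin d)) (𝓡 d) (par (d := d) Γ n) (t • z)
      (expField N (t • z) z) = frE Γ (par Γ n (t • z)) z := h4
    rwa [h5] at h6
  have h7 : modelDeriv 𝓘(ℝ, ℝ) (𝓡 d) (fun s : ℝ => par Γ n (s • z)) t 1 =
      frE Γ (par Γ n (t • z)) z := by
    refine Eq.trans h2 (Eq.trans ?_ h3)
    simp
  exact congrArg (fun v : EuclideanSpace ℝ (Fin d) =>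
    (⟨par Γ n (t • z), v⟩ : TangentBundle (𝓡 d) (LeftQuotient Γ))) h7

theorem contMDiff_par_smul (h : IsTwoStep d N) (n : N) (z : EuclideanSpace ℝ (Fin d)) :
    ContMDiff 𝓘(ℝ, ℝ) (𝓡 d) ∞ (fun s : ℝ => par Γ n (s • z)) := by
  have h1 : ContDiff ℝ ∞ (fun s : ℝ => s • z) := contDiff_id.smul contDiff_const
  exact (contMDiff_par h n).comp h1.contMDiff

/-- The velocity is the restriction of the frame field of `z`, whose derivative along itself is `C z
z = 0`. -/
theorem isGeodesic_par_smul (h : IsTwoStep d N) (hb : (formE N B).IsSymm)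
    (hbn : (formE N B).Nondegenerate) (hnab : IsLeviCivita (LeftQuotient.metric Γ B) nab)
    (n : N) {z : EuclideanSpace ℝ (Fin d)} (hz : z ∈ centerE d N) :
    IsGeodesic nab (fun s : ℝ => par Γ n (s • z)) := by
  obtain ⟨C, hC⟩ := exists_isChristoffel (N := N) hb hbn
  have hvel : ∀ s, (velocity (d := d) (fun s : ℝ => par Γ n (s • z)) s).2 =
      frameField Γ z (par Γ n (s • z)) := fun s => by
    rw [velocity_par_smul h]; rfl
  refine ⟨contMDiff_par_smul h n z, fun t => ⟨1, fun _ => frameField Γ z, fun _ _ => 1,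
    fun _ => isSmoothField_frameField h z, fun _ => differentiableAt_const _,
    Filter.Eventually.of_forall fun s => ?_, ?_⟩⟩
  · refine (hvel s).trans (Eq.symm ?_)
    exact (Fintype.sum_unique _).trans (one_smul ℝ (frE Γ (par Γ n (s • z)) z))
  · have h1 := hnab.apply_eq h hb hbn hC
      ((isSmoothField_frameField h z).mdifferentiableAt (par Γ n (t • z)))
      (frE Γ (par Γ n (t • z)) z)
    rw [coframe_frE, fld_frameField, hC.eq_zero_of_mem_center hb hbn hz hz, frameDeriv,
      coord_frameField, fderiv_const_apply, _root_.zero_apply, add_zero, map_zero] at h1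
    have h2 : nab (frameField Γ z) (par Γ n (t • z))
        (velocity (d := d) (fun s : ℝ => par Γ n (s • z)) t).2 = 0 := by
      rw [hvel t]; exact h1
    simp only [deriv_const, zero_smul, one_smul, zero_add, Finset.univ_unique,
      Finset.sum_singleton]
    exact h2.symm

theorem isGeodesicallyComplete_of_tangentVectors (h : IsTwoStep d N) (hb : (formE N B).IsSymm)
    (hbn : (formE N B).Nondegenerate) (hnab : IsLeviCivita (LeftQuotient.metric Γ B) nab)
    (hS : ∀ x ∈ S, ∀ v : EuclideanSpace ℝ (Fin d),
      v ∈ tangentVectors (d := d) S x ↔ coframe Γ x v ∈ centerE d N)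
    (hSz : ∀ n, LeftQuotient.mk Γ n ∈ S → ∀ z ∈ centerE d N, par Γ n z ∈ S) :
    IsGeodesicallyComplete nab S := by
  intro x hx v hv
  obtain ⟨n, hn⟩ := Quotient.exists_rep x
  have hn' : LeftQuotient.mk Γ n = x := hn
  subst hn'
  clear hn
  have hz : coframe Γ (LeftQuotient.mk Γ n) v ∈ centerE d N := (hS _ hx _).mp hv
  refine ⟨fun s : ℝ => par Γ n (s • coframe Γ (LeftQuotient.mk Γ n) v),
    isGeodesic_par_smul h hb hbn hnab n hz, ?_, fun t => hSz n hx _ ((centerE d N).smul_mem t hz)⟩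
  rw [velocity_par_smul h, zero_smul, par_zero]
  exact congrArg (fun u : EuclideanSpace ℝ (Fin d) =>
    (⟨LeftQuotient.mk Γ n, u⟩ : TangentBundle (𝓡 d) (LeftQuotient Γ))) (frE_coframe Γ _ v)

end OrbitGeometry

/-! ### Lattices: logarithms span, and the center is met cocompactly -/

section Lattice

variable {d : ℕ} {N : Type*} [Group N] [TopologicalSpace N] [IsTopologicalGroup N] [T2Space N]
  [LocallyCompactSpace N] [SimplyConnectedSpace N]
  [ChartedSpace (EuclideanSpace ℝ (Fin d)) N] [LieGroup (𝓡 d) ∞ N]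
  (Γ : Subgroup N) [DiscreteTopology Γ] [CompactSpace (LeftQuotient Γ)]

/-- A linear functional that vanishes on brackets and on the logarithms of a lattice is zero. -/
theorem eq_zero_of_vanishes_on_lattice (h : IsTwoStep d N)
    (f : EuclideanSpace ℝ (Fin d) →ₗ[ℝ] ℝ) (hbr : ∀ x y, f (lieBrL d N x y) = 0)
    (hΓ : ∀ γ ∈ Γ, f (glog h γ) = 0) : f = 0 := by
  have hadd : ∀ g k : N, f (glog h (g * k)) = f (glog h g) + f (glog h k) := fun g k => by
    rw [glog_mul, bch, map_add, map_add, map_smul, hbr, smul_zero, add_zero]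
  -- As `f` kills brackets, `f ∘ log` is a homomorphism, and it is trivial on `Γ`. It descends to
  -- the compact quotient, so `f` is a bounded linear functional.
  set F : LeftQuotient Γ → ℝ := Quotient.lift (fun n => f (glog h n)) (by
    rintro a b ⟨γ, rfl⟩
    change f (glog h ((γ : N) * b)) = f (glog h b)
    rw [hadd, hΓ γ γ.2, zero_add]) with hF
  have hc : Continuous F :=
    Continuous.quotient_lift (f.continuous_of_finiteDimensional.comp (continuous_glog h)) _
  obtain ⟨C, hC⟩ := (isCompact_range hc).isBounded.exists_norm_le
  have hb : ∀ x, |f x| ≤ C := fun x => by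
    have h1 := hC (F (LeftQuotient.mk Γ (gexp N x))) ⟨_, rfl⟩
    have h2 : F (LeftQuotient.mk Γ (gexp N x)) = f (glog h (gexp N x)) := rfl
    rwa [h2, glog_gexp, Real.norm_eq_abs] at h1
  ext1 x
  by_contra hx
  have hx0 : 0 < |f x| := abs_pos.mpr hx
  -- The scalar is chosen so that `|f|` takes the value `C + 1`.
  have h1 := hb (((C + 1) / |f x|) • x)
  have hC0 : 0 ≤ C := (abs_nonneg _).trans (hb 0)
  rw [map_smul, smul_eq_mul, abs_mul, abs_div, abs_abs, div_mul_cancel₀ _ hx0.ne',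
    abs_of_nonneg (by linarith)] at h1
  linarith

theorem glog_commutator (h : IsTwoStep d N) (g k : N) :
    glog (d := d) h (g * k * g⁻¹ * k⁻¹) = lieBrL d N (glog h g) (glog h k) := by
  obtain ⟨x, rfl⟩ := (gexpHomeomorph (d := d) (N := N) h).surjective g
  obtain ⟨y, rfl⟩ := (gexpHomeomorph (d := d) (N := N) h).surjective k
  change glog (d := d) h (gexp N x * gexp N y * (gexp N x)⁻¹ * (gexp N y)⁻¹) =
    lieBrL d N (glog h (gexp N x)) (glog h (gexp N y))
  rw [← gexp_neg, ← gexp_neg, ← gexp_bch h, ← gexp_bch h, ← gexp_bch h, glog_gexp, glog_gexp,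
    glog_gexp]
  have h1 : bch (N := N) (bch (N := N) x y) (-x) = y + lieBrL d N x y := by
    simp only [bch, map_add, map_neg, map_smul, _root_.add_apply,
      _root_.smul_apply, h x y x, lieBrL_self, lieBrL_skew y x]
    module
  rw [h1]
  simp only [bch, map_add, map_neg, _root_.add_apply, h x y y, lieBrL_self]
  module

/-- The logarithms of a lattice span the Lie algebra. -/
theorem span_glog_eq_top (h : IsTwoStep d N) :
    Submodule.span ℝ (glog (d := d) h '' (Γ : Set N)) = ⊤ := by
  set W := Submodule.span ℝ (glog (d := d) h '' (Γ : Set N)) with hW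
  have key : ∀ W' : Submodule ℝ (EuclideanSpace ℝ (Fin d)), W ≤ W' →
      (∀ x y, lieBrL d N x y ∈ W') → W' = ⊤ := by
    intro W' hWW' hbr
    by_contra hne
    obtain ⟨f, hf0, hf⟩ := Submodule.exists_le_ker_of_lt_top W' (lt_top_iff_ne_top.mpr hne)
    refine hf0 (eq_zero_of_vanishes_on_lattice Γ h f (fun x y => hf (hbr x y)) fun γ hγ => ?_)
    exact hf (hWW' (Submodule.subset_span ⟨γ, hγ, rfl⟩))
  -- First the span together with the center is everything. All brackets are then brackets of
  -- elements of `W`, and these lie in `W` because logarithms of commutators are brackets; so the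
  -- criterion applies to `W` itself.
  have h1 : W ⊔ centerE d N = ⊤ := key _ le_sup_left fun x y =>
    (le_sup_right : centerE d N ≤ W ⊔ centerE d N) (mem_centerE.mpr fun z => h x y z)
  have h2 : ∀ w ∈ W, ∀ w' ∈ W, lieBrL d N w w' ∈ W := by
    intro w hw w' hw'
    induction hw using Submodule.span_induction with
    | mem x hx =>
      induction hw' using Submodule.span_induction with
      | mem y hy =>
        obtain ⟨γ, hγ, rfl⟩ := hx
        obtain ⟨δ, hδ, rfl⟩ := hy
        rw [← glog_commutator]
        exact Submodule.subset_span ⟨_, Γ.mul_mem (Γ.mul_mem (Γ.mul_mem hγ hδ) (Γ.inv_mem hγ))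
          (Γ.inv_mem hδ), rfl⟩
      | zero => rw [map_zero]; exact W.zero_mem
      | add y z _ _ hy hz => rw [map_add]; exact W.add_mem hy hz
      | smul c y _ hy => rw [map_smul]; exact W.smul_mem c hy
    | zero => rw [map_zero]; exact W.zero_mem
    | add x z _ _ hx hz => rw [map_add]; exact W.add_mem hx hz
    | smul c x _ hx => rw [map_smul]; exact W.smul_mem c hx
  refine key W le_rfl fun x y => ?_
  obtain ⟨w, hw, z, hz, rfl⟩ := Submodule.mem_sup.mp (h1.ge (Submodule.mem_top (x := x)))
  obtain ⟨w', hw', z', hz', rfl⟩ := Submodule.mem_sup.mp (h1.ge (Submodule.mem_top (x := y)))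
  have h3 : lieBrL d N (w + z) (w' + z') = lieBrL d N w w' := by
    simp only [map_add, _root_.add_apply, mem_centerE.mp hz, lieBrL_skew w z',
      mem_centerE.mp hz', neg_zero, add_zero]
  rw [h3]
  exact h2 w hw w' hw'

/-- Finitely many images of compact neighbourhoods cover the compact quotient, since the projection
is open. -/
theorem exists_isCompact_surjOn : ∃ K : Set N, IsCompact K ∧ ∀ n : N, ∃ γ ∈ Γ, ∃ k ∈ K, n = γ * k := by
  choose K hK hKn using fun n : N => exists_compact_mem_nhds n
  have hU : ∀ x : LeftQuotient Γ, LeftQuotient.mk Γ '' K (Quotient.out x) ∈ 𝓝 x := fun x => by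
    have h1 := (isLH Γ).isOpenMap.image_mem_nhds (hKn (Quotient.out x))
    have h2 : LeftQuotient.mk Γ (Quotient.out x) = x := Quotient.out_eq x
    rwa [h2] at h1
  obtain ⟨t, ht⟩ := CompactSpace.elim_nhds_subcover _ hU
  refine ⟨⋃ x ∈ t, K (Quotient.out x), t.isCompact_biUnion fun x _ => hK _, fun n => ?_⟩
  have h1 : LeftQuotient.mk Γ n ∈ (⊤ : Set (LeftQuotient Γ)) := trivial
  rw [← ht, Set.mem_iUnion₂] at h1
  obtain ⟨x, hx, k, hk, hkn⟩ := h1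
  obtain ⟨γ, hγ⟩ := (isCov Γ).apply_eq_iff_mem_orbit.mp hkn
  have hγ' : (γ : N) * n = k := hγ
  exact ⟨(γ : N)⁻¹, Γ.inv_mem γ.2, k, Set.mem_biUnion hx hk, by rw [← hγ', inv_mul_cancel_left]⟩

theorem finite_inter_of_isCompact {S : Set N} (hS : IsCompact S) : ((Γ : Set N) ∩ S).Finite := by
  have h1 := Γ.tendsto_coe_cofinite_of_discrete (isDiscrete_iff_discreteTopology.mpr inferInstance)
  have h2 := h1.eventually hS.compl_mem_cocompact
  have h3 : {γ : Γ | ¬ ((γ : N) ∈ Sᶜ)}.Finite := Filter.eventually_cofinite.mp h2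
  refine (h3.image Subtype.val).subset ?_
  rintro γ ⟨hγ, hγS⟩
  exact ⟨⟨γ, hγ⟩, fun hc => hc hγS, rfl⟩

variable {Γ} in
theorem mem_center_of_commute (h : IsTwoStep d N) {F : Set N}
    (hF : Submodule.span ℝ (glog (d := d) h '' F) = ⊤) {g : N}
    (hg : ∀ δ ∈ F, g * δ * g⁻¹ * δ⁻¹ = 1) : g ∈ Subgroup.center N := by
  rw [← gexp_glog (d := d) h g, gexp_mem_center_iff h, mem_centerE]
  intro y
  have hy : y ∈ Submodule.span ℝ (glog (d := d) h '' F) := hF.ge Submodule.mem_top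
  induction hy using Submodule.span_induction with
  | mem x hx =>
    obtain ⟨δ, hδ, rfl⟩ := hx
    rw [← glog_commutator, hg δ hδ, glog_one]
  | zero => rw [map_zero]
  | add x z _ _ hx hz => rw [map_add, hx, hz, add_zero]
  | smul c x _ hx => rw [map_smul, hx, smul_zero]

/-- The intersection of a lattice with the center is cocompact in the center. -/
theorem exists_isCompact_center (h : IsTwoStep d N) :
    ∃ K : Set N, IsCompact K ∧ ∀ z ∈ Subgroup.center N, ∃ γ ∈ Γ, γ ∈ Subgroup.center N ∧
      ∃ k ∈ K, z = γ * k := by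
  obtain ⟨K, hK, hKs⟩ := exists_isCompact_surjOn Γ
  obtain ⟨s, hs, hsspan⟩ := (Submodule.fg_span_iff_fg_span_finset_subset
    (R := ℝ) (glog (d := d) h '' (Γ : Set N))).mp (IsNoetherian.noetherian _)
  rw [span_glog_eq_top] at hsspan
  set F : Set N := gexp (d := d) N '' s with hFdef
  have hFfin : F.Finite := s.finite_toSet.image _
  have hFspan : Submodule.span ℝ (glog (d := d) h '' F) = ⊤ := by
    rw [hFdef, Set.image_image]
    simp only [glog_gexp, Set.image_id']
    exact hsspan.symm
  have hFΓ : F ⊆ Γ := by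
    rintro _ ⟨x, hx, rfl⟩
    obtain ⟨γ, hγ, rfl⟩ := hs hx
    rwa [gexp_glog]
  have : Finite F := hFfin
  set Φ : N → F → N := fun γ δ => γ * δ * γ⁻¹ * (δ : N)⁻¹ with hΦ
  set A : Set N := {γ | γ ∈ Γ ∧ ∃ k ∈ K, γ * k ∈ Subgroup.center N} with hA
  -- If `γ k` is central, then `γ δ γ⁻¹ = k⁻¹ δ k`. The commutators of `γ` with the finite spanning
  -- set `F` thus lie in the lattice and in a compact set, so only finitely many families occur.
  have hfin : (Φ '' A).Finite := by
    have h1 : (Set.univ.pi fun δ : F => (Γ : Set N) ∩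
        ((fun k : N => k⁻¹ * δ * k * (δ : N)⁻¹) '' K)).Finite :=
      Set.Finite.pi fun δ => finite_inter_of_isCompact Γ (hK.image (by fun_prop))
    refine h1.subset ?_
    rintro _ ⟨γ, ⟨hγ, k, hk, hkz⟩, rfl⟩ δ -
    have hδ : (δ : N) ∈ Γ := hFΓ δ.2
    refine ⟨Γ.mul_mem (Γ.mul_mem (Γ.mul_mem hγ hδ) (Γ.inv_mem hγ)) (Γ.inv_mem hδ), k, hk, ?_⟩
    have h2 := Subgroup.mem_center_iff.mp hkz (δ : N)
    change k⁻¹ * δ * k * (δ : N)⁻¹ = γ * δ * γ⁻¹ * (δ : N)⁻¹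
    congr 1
    have h3 : γ = γ * k * k⁻¹ := by group
    have h4 : γ * δ * γ⁻¹ = γ * k * (k⁻¹ * δ * k) * (γ * k)⁻¹ := by group
    rw [h4, ← Subgroup.mem_center_iff.mp hkz, mul_inv_cancel_right]
  have hch : ∀ t ∈ Φ '' A, ∃ γ ∈ A, Φ γ = t := fun t ht => ht
  choose! rep hrepA hrepΦ using hch
  -- Two elements of `A` with the same commutators differ by a central element. Writing `r` for the
  -- representative of `γ`, split `γ k` as `(γ r⁻¹)(r k)`.
  refine ⟨⋃ t ∈ Φ '' A, (fun k => rep t * k) '' K,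
    hfin.isCompact_biUnion fun t _ => hK.image (by fun_prop), fun z hz => ?_⟩
  obtain ⟨γ, hγ, k, hk, rfl⟩ := hKs z
  have hγA : γ ∈ A := ⟨hγ, k, hk, hz⟩
  have ht : Φ γ ∈ Φ '' A := ⟨γ, hγA, rfl⟩
  have hr := hrepA _ ht
  refine ⟨γ * (rep (Φ γ))⁻¹, Γ.mul_mem hγ (Γ.inv_mem hr.1), ?_, rep (Φ γ) * k,
    Set.mem_biUnion ht ⟨k, hk, rfl⟩, by group⟩
  have h5 : (rep (Φ γ))⁻¹ * γ ∈ Subgroup.center N := by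
    refine mem_center_of_commute h hFspan fun δ hδ => ?_
    have h6 := congrFun (hrepΦ _ ht) ⟨δ, hδ⟩
    simp only [hΦ] at h6
    rw [mul_left_inj] at h6
    set r := rep (Φ γ)
    have h7 : r⁻¹ * γ * δ * (r⁻¹ * γ)⁻¹ = r⁻¹ * (γ * δ * γ⁻¹) * r := by group
    rw [h7]
    have h8 : r * δ * r⁻¹ = γ * δ * γ⁻¹ := h6
    rw [← h8]
    group
  have h9 := Subgroup.mem_center_iff.mp h5 (rep (Φ γ))
  rw [mul_inv_cancel_left] at h9
  rwa [mul_inv_eq_iff_eq_mul.mpr h9]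

end Lattice

/-! ### Rigidity of maps that preserve the form and the splitting -/

section Rigidity

variable {d : ℕ} {N : Type*} [Group N] [TopologicalSpace N] [IsTopologicalGroup N] [T2Space N]
  [ChartedSpace (EuclideanSpace ℝ (Fin d)) N] [LieGroup (𝓡 d) ∞ N]

variable (N) in
/-- The differential of `Ψ` at `a`, with respect to the left-invariant frame in exponential
coordinates. -/
def expDeriv (Ψ : EuclideanSpace ℝ (Fin d) → EuclideanSpace ℝ (Fin d))
    (a : EuclideanSpace ℝ (Fin d)) : EuclideanSpace ℝ (Fin d) →L[ℝ] EuclideanSpace ℝ (Fin d) :=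
  (expField N (-Ψ a)).comp ((fderiv ℝ Ψ a).comp (expField N a))

theorem contDiff_expField : ContDiff ℝ ∞ (expField (d := d) N) :=
  contDiff_const.add ((lieBrL d N).contDiff.const_smul (1 / 2 : ℝ))

theorem hasFDerivAt_expField (a : EuclideanSpace ℝ (Fin d)) :
    HasFDerivAt (expField (d := d) N) ((1 / 2 : ℝ) • lieBrL d N) a :=
  ((lieBrL d N).hasFDerivAt.const_smul (1 / 2 : ℝ)).const_add (ContinuousLinearMap.id ℝ _)

variable {Ψ : EuclideanSpace ℝ (Fin d) → EuclideanSpace ℝ (Fin d)}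

theorem contDiff_expDeriv (hΨ : ContDiff ℝ ∞ Ψ) : ContDiff ℝ ∞ (expDeriv N Ψ) :=
  (contDiff_expField.comp hΨ.neg).clm_comp
    ((hΨ.fderiv_right (m := ∞) (by simp)).clm_comp contDiff_expField)

theorem fderiv_expField (h : IsTwoStep d N) (a x : EuclideanSpace ℝ (Fin d)) :
    fderiv ℝ Ψ a (expField N a x) = expField N (Ψ a) (expDeriv N Ψ a x) :=
  (congrArg (fun L : EuclideanSpace ℝ (Fin d) →L[ℝ] EuclideanSpace ℝ (Fin d) =>
    L (fderiv ℝ Ψ a (expField N a x))) (expField_comp_neg h (Ψ a))).symm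

/-- The integrability condition for the frame differential `D`. Differentiate `dΨ(expField a x) =
expField (Ψ a) (D x)` along the field of `y` and antisymmetrize; the second derivatives of `Ψ`
cancel. -/
theorem fderiv_expDeriv_skew (h : IsTwoStep d N) (hΨ : ContDiff ℝ ∞ Ψ)
    (hz : ∀ a, ∀ z ∈ centerE d N, expDeriv N Ψ a z ∈ centerE d N)
    (a x y : EuclideanSpace ℝ (Fin d)) :
    fderiv ℝ (expDeriv N Ψ) a (expField N a y) x - fderiv ℝ (expDeriv N Ψ) a (expField N a x) y =
      expDeriv N Ψ a (lieBrL d N y x) -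
        lieBrL d N (expDeriv N Ψ a y) (expDeriv N Ψ a x) := by
  have hD := ((contDiff_expDeriv (N := N) hΨ).differentiable (by simp) a).hasFDerivAt
  have hΨ1 := (hΨ.differentiable (by simp) a).hasFDerivAt
  have hΨ2 := ((hΨ.fderiv_right (m := ∞) (by simp)).differentiable (by simp) a).hasFDerivAt
  have hc : ∀ u w, lieBrL d N u w ∈ centerE d N := fun u w => mem_centerE.mpr fun v => h u w v
  have key : ∀ x y, fderiv ℝ (fderiv ℝ Ψ) a (expField N a y) (expField N a x) +
      (1 / 2 : ℝ) • expDeriv N Ψ a (lieBrL d N y x) =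
      expField N (Ψ a) (fderiv ℝ (expDeriv N Ψ) a (expField N a y) x) +
      (1 / 2 : ℝ) • lieBrL d N (expDeriv N Ψ a y) (expDeriv N Ψ a x) := by
    intro x y
    have h1 := hΨ2.clm_apply ((hasFDerivAt_expField (N := N) a).clm_apply (hasFDerivAt_const x a))
    have h2 := ((hasFDerivAt_expField (N := N) (Ψ a)).comp a hΨ1).clm_apply
      (hD.clm_apply (hasFDerivAt_const x a))
    have h3 : (fun a => fderiv ℝ Ψ a (expField N a x)) =
        fun a => expField N (Ψ a) (expDeriv N Ψ a x) := funext fun a => fderiv_expField h a x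
    have h4 := congrArg (fun L : EuclideanSpace ℝ (Fin d) →L[ℝ] EuclideanSpace ℝ (Fin d) =>
      L (expField N a y)) ((h3 ▸ h1).unique h2)
    have h5 : lieBrL d N (expField N a y) x = lieBrL d N y x := by
      rw [expField_apply, map_add, map_smul, _root_.add_apply, _root_.smul_apply, h, smul_zero,
        add_zero]
    have h6 : fderiv ℝ Ψ a (lieBrL d N y x) = expDeriv N Ψ a (lieBrL d N y x) := by
      have h7 := fderiv_expField (Ψ := Ψ) h a (lieBrL d N y x)
      rw [expField_apply, h.right, smul_zero, add_zero, expField_apply,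
        lieBrL_skew (Ψ a), mem_centerE.mp (hz a _ (hc y x)), neg_zero, smul_zero, add_zero] at h7
      exact h7
    have h8 : lieBrL d N (expField N (Ψ a) (expDeriv N Ψ a y)) (expDeriv N Ψ a x) =
        lieBrL d N (expDeriv N Ψ a y) (expDeriv N Ψ a x) := by
      rw [expField_apply, map_add, map_smul, _root_.add_apply, _root_.smul_apply, h, smul_zero,
        add_zero]
    simp only [ContinuousLinearMap.comp_apply, ContinuousLinearMap.flip_apply, _root_.add_apply,
      _root_.smul_apply, ContinuousLinearMap.comp_zero, zero_add, h5, map_smul, h6, fderiv_expField h, h8, Function.comp] at h4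
    rw [← h4, add_comm]
  have hs : fderiv ℝ (fderiv ℝ Ψ) a (expField N a y) (expField N a x) =
      fderiv ℝ (fderiv ℝ Ψ) a (expField N a x) (expField N a y) :=
    (hΨ.contDiffAt.isSymmSndFDerivAt (by simp; exact WithTop.coe_le_coe.mpr le_top)).eq _ _
  have k1 := key x y
  have k2 := key y x
  rw [hs] at k1
  set Q := fderiv ℝ (expDeriv N Ψ) a (expField N a y) x -
    fderiv ℝ (expDeriv N Ψ) a (expField N a x) y with hQ
  set K := expDeriv N Ψ a (lieBrL d N y x) -
        lieBrL d N (expDeriv N Ψ a y) (expDeriv N Ψ a x) with hK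
  have k3 : expField N (Ψ a) Q = K := by
    rw [lieBrL_skew x y, lieBrL_skew (expDeriv N Ψ a x), map_neg] at k2
    rw [hQ, map_sub, hK]
    linear_combination (norm := module) k2 - k1
  -- As `K` is central, the inverse `expField (-Ψ a)` fixes it, and `expField (Ψ a) Q = K` becomes
  -- `Q = K`.
  have hKc : K ∈ centerE d N := (centerE d N).sub_mem (hz a _ (hc _ _)) (hc _ _)
  have k4 := congrArg (fun L : EuclideanSpace ℝ (Fin d) →L[ℝ] EuclideanSpace ℝ (Fin d) => L Q)
    (expField_neg_comp h (Ψ a))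
  change expField N (-Ψ a) (expField N (Ψ a) Q) = Q at k4
  rw [k3, expField_apply, lieBrL_skew, mem_centerE.mp hKc, neg_zero, smul_zero, add_zero] at k4
  exact k4.symm

theorem fderiv_mem_of_forall_mem {E F : Type*} [NormedAddCommGroup E] [NormedSpace ℝ E]
    [NormedAddCommGroup F] [NormedSpace ℝ F] {W : Submodule ℝ F} (hW : IsClosed (W : Set F))
    {f : E → F} (hf : ∀ a, f a ∈ W) (a v : E) : fderiv ℝ f a v ∈ W := by
  by_cases hd : DifferentiableAt ℝ f a
  · have h1 : HasDerivAt (fun t : ℝ => f (a + t • v)) (fderiv ℝ f a v) 0 := by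
      have h2 : HasDerivAt (fun t : ℝ => a + t • v) v 0 := by
        simpa using ((hasDerivAt_id (0 : ℝ)).smul_const v).const_add a
      have h3 : HasFDerivAt f (fderiv ℝ f a) (a + (0 : ℝ) • v) := by simpa using hd.hasFDerivAt
      exact h3.comp_hasDerivAt (0 : ℝ) h2
    have h2 := hasDerivAt_iff_tendsto_slope.mp h1
    refine hW.mem_of_tendsto h2 (Filter.Eventually.of_forall fun t => ?_)
    exact W.smul_mem _ (W.sub_mem (hf _) (hf _))
  · rw [fderiv_zero_of_not_differentiableAt hd]; exact W.zero_mem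

variable {b : LinearMap.BilinForm ℝ (EuclideanSpace ℝ (Fin d))}
  {v : Submodule ℝ (EuclideanSpace ℝ (Fin d))}

/-- A map that preserves, in the left-invariant frame, a nondegenerate form and a splitting of the
Lie algebra into the center and a complement, has constant differential in this frame. -/
theorem expDeriv_eq_const (h : IsTwoStep d N) (hΨ : ContDiff ℝ ∞ Ψ) (hb : b.IsSymm)
    (hbn : b.Nondegenerate) (hv : IsCompl (centerE d N) v)
    (hDb : ∀ a x y, b (expDeriv N Ψ a x) (expDeriv N Ψ a y) = b x y)
    (hDz : ∀ a, ∀ z ∈ centerE d N, expDeriv N Ψ a z ∈ centerE d N)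
    (hDv : ∀ a, ∀ w ∈ v, expDeriv N Ψ a w ∈ v) (a : EuclideanSpace ℝ (Fin d)) :
    expDeriv N Ψ a = expDeriv N Ψ 0 := by
  have hdiff := (contDiff_expDeriv (N := N) hΨ).differentiable (by simp)
  have happ : ∀ a u x, fderiv ℝ (expDeriv N Ψ) a u x =
      fderiv ℝ (fun a => expDeriv N Ψ a x) a u := fun a u x => by
    rw [((hdiff a).hasFDerivAt.clm_apply (hasFDerivAt_const x a)).fderiv]
    simp
  refine is_const_of_fderiv_eq_zero hdiff (fun a => ?_) a 0
  set S : EuclideanSpace ℝ (Fin d) → EuclideanSpace ℝ (Fin d) → EuclideanSpace ℝ (Fin d) :=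
    fun y x => fderiv ℝ (expDeriv N Ψ) a (expField N a y) x with hS
  set D := expDeriv N Ψ a with hD
  have hsv : ∀ y, ∀ x ∈ v, S y x ∈ v := fun y x hx => by
    rw [hS]; dsimp only; rw [happ]
    exact fderiv_mem_of_forall_mem v.closed_of_finiteDimensional (fun a => hDv a x hx) _ _
  have hc : ∀ u w, lieBrL d N u w ∈ centerE d N := fun u w => mem_centerE.mpr fun v => h u w v
  -- The skew part is central by the integrability condition and depends only on the components in
  -- `v`, for which it also lies in `v`.
  have hsymm : ∀ x y, S y x = S x y := by
    intro x y
    obtain ⟨x1, hx1, x2, hx2, rfl⟩ := Submodule.mem_sup.mp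
      (hv.sup_eq_top.ge (Submodule.mem_top (x := x)))
    obtain ⟨y1, hy1, y2, hy2, rfl⟩ := Submodule.mem_sup.mp
      (hv.sup_eq_top.ge (Submodule.mem_top (x := y)))
    have h1 := fderiv_expDeriv_skew h hΨ hDz a x2 y2
    have h2 : D (lieBrL d N y2 x2) - lieBrL d N (D y2) (D x2) = 0 :=
      Submodule.disjoint_def.mp hv.disjoint _
        ((centerE d N).sub_mem (hDz a _ (hc _ _)) (hc _ _))
        (h1 ▸ v.sub_mem (hsv y2 x2 hx2) (hsv x2 y2 hy2))
    have h3 := fderiv_expDeriv_skew h hΨ hDz a (x1 + x2) (y1 + y2)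
    have h4 : ∀ {z}, z ∈ centerE d N → ∀ y, lieBrL d N y z = 0 := fun hz y => by
      rw [lieBrL_skew, mem_centerE.mp hz, neg_zero]
    rw [← sub_eq_zero]
    refine h3.trans ?_
    simp only [map_add, _root_.add_apply, mem_centerE.mp hy1, mem_centerE.mp (hDz a _ hy1),
      h4 hx1, h4 (hDz a _ hx1), zero_add]
    exact h2
  have hskew : ∀ y x w, b (S y x) (D w) + b (D x) (S y w) = 0 := by
    intro y x w
    have h1 : ∀ x, HasFDerivAt (fun a => expDeriv N Ψ a x)
        (fderiv ℝ (fun a => expDeriv N Ψ a x) a) a := fun x =>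
      ((hdiff a).clm_apply (differentiableAt_const x)).hasFDerivAt
    have h2 := ((formL b).hasFDerivAt.comp a (h1 x)).clm_apply (h1 w)
    have h3 : (fun a => ((formL b) ∘ fun a => expDeriv N Ψ a x) a (expDeriv N Ψ a w)) =
        fun _ => b x w := funext fun a => hDb a x w
    rw [h3] at h2
    have h4 := congrArg (fun L : EuclideanSpace ℝ (Fin d) →L[ℝ] ℝ => L (expField N a y))
      (h2.unique (hasFDerivAt_const _ _))
    simp only [hS, happ]
    rw [add_comm]
    exact h4
  -- Three alternating uses of the skewness in the last two arguments and the symmetry in the first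
  -- two return the expression with the opposite sign.
  have hzero : ∀ y x w, b (S y x) (D w) = 0 := by
    intro y x w
    have e : ∀ y x w, b (S y x) (D w) = - b (S y w) (D x) := fun y x w => by
      have h1 := hskew y x w
      rw [hb.eq (D x) (S y w)] at h1
      linarith
    have e1 := e y x w
    rw [hsymm w y] at e1
    have e2 := e w y x
    rw [hsymm x w] at e2
    have e3 := e x w y
    rw [hsymm y x] at e3
    linarith
  have hDinj : Function.Injective D := by
    refine (injective_iff_map_eq_zero D).mpr fun x hx => hbn.1 x fun y => ?_
    rw [← hDb a x y, ← hD, hx, map_zero, LinearMap.zero_apply]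
  have hDsurj : Function.Surjective D :=
    (LinearMap.injective_iff_surjective (f := D.toLinearMap)).mp hDinj
  ext1 u
  ext1 x
  have h1 : expField N a (expField N (-a) u) = u :=
    congrArg (fun L : EuclideanSpace ℝ (Fin d) →L[ℝ] EuclideanSpace ℝ (Fin d) => L u)
      (expField_comp_neg h a)
  refine hbn.1 _ fun w => ?_
  obtain ⟨w, rfl⟩ := hDsurj w
  have h2 := hzero (expField N (-a) u) x w
  simp only [hS, h1] at h2
  exact h2

/-- Along the line `t a` the map has velocity `A a + ½[Ψ, A a]`. The bracket `[Ψ, A a]` is constant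
in `t` because the group is two-step, so the image is a straight line. -/
theorem eq_bch_of_expDeriv_eq (h : IsTwoStep d N) (hΨ : ContDiff ℝ ∞ Ψ)
    {A : EuclideanSpace ℝ (Fin d) →L[ℝ] EuclideanSpace ℝ (Fin d)}
    (hA : ∀ a, expDeriv N Ψ a = A) (a : EuclideanSpace ℝ (Fin d)) :
    Ψ a = bch (N := N) (Ψ 0) (A a) := by
  have hc : ∀ t : ℝ, HasDerivAt (fun t : ℝ => Ψ (t • a)) (expField N (Ψ (t • a)) (A a)) t := by
    intro t
    have h1 : HasDerivAt (fun t : ℝ => t • a) a t := by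
      simpa using (hasDerivAt_id t).smul_const a
    have h2 := ((hΨ.differentiable (by simp) (t • a)).hasFDerivAt).comp_hasDerivAt t h1
    have h3 := fderiv_expField (Ψ := Ψ) h (t • a) a
    rw [hA, expField_apply, map_smul, _root_.smul_apply, lieBrL_self, smul_zero, smul_zero,
      add_zero] at h3
    rw [← h3]
    exact h2
  have h1 : ∀ t : ℝ, lieBrL d N (Ψ (t • a)) (A a) = lieBrL d N (Ψ 0) (A a) := by
    intro t
    have h2 : ∀ t : ℝ, HasDerivAt (fun t : ℝ => (lieBrL d N).flip (A a) (Ψ (t • a))) 0 t := by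
      intro t
      have h3 := ((lieBrL d N).flip (A a)).hasFDerivAt.comp_hasDerivAt t (hc t)
      rw [ContinuousLinearMap.flip_apply, expField_apply, map_add, map_smul, _root_.add_apply,
        _root_.smul_apply, h, lieBrL_self, smul_zero, add_zero] at h3
      exact h3
    have h4 := is_const_of_deriv_eq_zero (fun t => (h2 t).differentiableAt)
      (fun t => (h2 t).deriv) t 0
    simpa using h4
  have h2 : ∀ t : ℝ, HasDerivAt (fun t : ℝ => Ψ (t • a) - t • expField N (Ψ 0) (A a)) 0 t := by
    intro t
    have h3 := (hc t).sub ((hasDerivAt_id t).smul_const (expField N (Ψ 0) (A a)))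
    rw [expField_apply, expField_apply, h1, one_smul, sub_self] at h3
    exact h3
  have h3 := is_const_of_deriv_eq_zero (fun t => (h2 t).differentiableAt)
    (fun t => (h2 t).deriv) 1 0
  simp only [one_smul, zero_smul, sub_zero] at h3
  rw [sub_eq_iff_eq_add] at h3
  rw [h3, bch, expField_apply, add_assoc]

/-- Maps as in `expDeriv_eq_const` that commute with the translations by the elements of a lattice
are translations by central elements. -/
theorem eq_add_of_expDeriv (h : IsTwoStep d N) (hΨ : ContDiff ℝ ∞ Ψ) (hb : b.IsSymm)
    (hbn : b.Nondegenerate) (hv : IsCompl (centerE d N) v)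
    (hDb : ∀ a x y, b (expDeriv N Ψ a x) (expDeriv N Ψ a y) = b x y)
    (hDz : ∀ a, ∀ z ∈ centerE d N, expDeriv N Ψ a z ∈ centerE d N)
    (hDv : ∀ a, ∀ w ∈ v, expDeriv N Ψ a w ∈ v) {L : Set (EuclideanSpace ℝ (Fin d))}
    (hL : Submodule.span ℝ L = ⊤) (hΨL : ∀ l ∈ L, Ψ l = bch (N := N) l (Ψ 0)) :
    Ψ 0 ∈ centerE d N ∧ ∀ a, Ψ a = Ψ 0 + a := by
  set A := expDeriv N Ψ 0 with hA
  have hAc := eq_bch_of_expDeriv_eq h hΨ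
    (fun a => expDeriv_eq_const h hΨ hb hbn hv hDb hDz hDv a)
  set y := Ψ 0 with hy
  -- For `l ∈ L` solve `y · A l = l · y`: `A l` is the conjugate of `l` by the inverse of `y`. Both
  -- sides are linear, and `L` spans.
  have hAl : ∀ x, A x = x - lieBrL d N y x := by
    intro x
    have hx : x ∈ Submodule.span ℝ L := hL.ge Submodule.mem_top
    induction hx using Submodule.span_induction with
    | mem l hl =>
      have h1 := (hAc l).symm.trans (hΨL l hl)
      have h2 : expField N y (A l) = l - (1 / 2 : ℝ) • lieBrL d N y l := by
        rw [bch, bch, lieBrL_skew l y] at h1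
        rw [expField_apply]
        linear_combination (norm := module) h1
      have h3 := congrArg (fun L : EuclideanSpace ℝ (Fin d) →L[ℝ] EuclideanSpace ℝ (Fin d) =>
        L (A l)) (expField_neg_comp h y)
      change expField N (-y) (expField N y (A l)) = A l at h3
      rw [← h3, h2, expField_apply]
      simp only [map_neg, map_sub, map_smul, _root_.neg_apply, h.right]
      module
    | zero => simp
    | add x z _ _ hx hz => rw [map_add, map_add, hx, hz]; abel
    | smul c x _ hx => rw [map_smul, map_smul, hx, smul_sub]
  have hyc : y ∈ centerE d N := by
    rw [mem_centerE]
    intro x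
    obtain ⟨x1, hx1, x2, hx2, rfl⟩ := Submodule.mem_sup.mp
      (hv.sup_eq_top.ge (Submodule.mem_top (x := x)))
    rw [map_add, lieBrL_skew y x1, mem_centerE.mp hx1, neg_zero, zero_add]
    -- For `x2 ∈ v` the bracket `[y, x2] = x2 - A x2` is both central and in `v`.
    refine Submodule.disjoint_def.mp hv.disjoint _ (mem_centerE.mpr fun v => h y x2 v) ?_
    have h1 : lieBrL d N y x2 = x2 - A x2 := by rw [hAl]; abel
    rw [h1]
    exact v.sub_mem hx2 (hDv 0 x2 hx2)
  refine ⟨hyc, fun a => ?_⟩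
  rw [hAc a, bch, mem_centerE.mp hyc, smul_zero, add_zero, hAl, mem_centerE.mp hyc, sub_zero]

end Rigidity

/-! ### Central translations of the quotient -/

section CentralTranslation

variable {d : ℕ} {N : Type*} [Group N] [TopologicalSpace N] [IsTopologicalGroup N] [T2Space N]
  [LocallyCompactSpace N] [ChartedSpace (EuclideanSpace ℝ (Fin d)) N] [LieGroup (𝓡 d) ∞ N]
  {Γ : Subgroup N} [DiscreteTopology Γ] {B : LinearMap.BilinForm ℝ (GroupLieAlgebra (𝓡 d) N)}
  {V : Submodule ℝ (GroupLieAlgebra (𝓡 d) N)}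

theorem mk_eq_mk_iff {a b : N} :
    LeftQuotient.mk Γ a = LeftQuotient.mk Γ b ↔ ∃ γ ∈ Γ, γ * b = a := by
  refine (isCov Γ).apply_eq_iff_mem_orbit.trans ⟨?_, ?_⟩
  · rintro ⟨γ, hγ⟩
    exact ⟨γ, γ.2, hγ⟩
  · rintro ⟨γ, hγ, h⟩
    exact ⟨⟨γ, hγ⟩, h⟩

theorem mk_mul_of_mem {γ : N} (hγ : γ ∈ Γ) (n : N) :
    LeftQuotient.mk Γ (γ * n) = LeftQuotient.mk Γ n := mk_eq_mk_iff.mpr ⟨γ, hγ, rfl⟩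

theorem modelDeriv_comp_frE (h : IsTwoStep d N) {ψ : LeftQuotient Γ → LeftQuotient Γ}
    (hψ : ContMDiff (𝓡 d) (𝓡 d) ∞ ψ) {Ψ : EuclideanSpace ℝ (Fin d) → EuclideanSpace ℝ (Fin d)}
    (hΨ : ContDiff ℝ ∞ Ψ) {n m : N} (hpar : ∀ a, ψ (par Γ n a) = par Γ m (Ψ a))
    (a : EuclideanSpace ℝ (Fin d)) :
    (modelDeriv (𝓡 d) (𝓡 d) ψ (par Γ n a)).comp (frE Γ (par Γ n a)) =
      (frE Γ (par Γ m (Ψ a))).comp (expDeriv N Ψ a) := by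
  have h1 := (hasModelDerivAt_of_contMDiffAt (hψ (par Γ n a)) (by simp)).comp
    (hasModelDerivAt_of_contMDiffAt (contMDiff_par (Γ := Γ) h n).contMDiffAt (by simp)) rfl
  have h2 := (hasModelDerivAt_of_contMDiffAt (contMDiff_par (Γ := Γ) h m).contMDiffAt
    (by simp)).comp (hasModelDerivAt_iff_hasFDerivAt.mpr
      (hΨ.differentiable (by simp) a).hasFDerivAt) rfl
  have h3 : ψ ∘ par Γ n = par Γ m ∘ Ψ := funext hpar
  rw [h3] at h1
  have h4 := h1.unique h2
  rw [← modelDeriv_par_comp h, ← ContinuousLinearMap.comp_assoc, h4, modelDeriv_par h]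
  rfl

theorem coframe_modelDeriv (h : IsTwoStep d N) {ψ : LeftQuotient Γ → LeftQuotient Γ}
    (hψ : ContMDiff (𝓡 d) (𝓡 d) ∞ ψ) {Ψ : EuclideanSpace ℝ (Fin d) → EuclideanSpace ℝ (Fin d)}
    (hΨ : ContDiff ℝ ∞ Ψ) {n m : N} (hpar : ∀ a, ψ (par Γ n a) = par Γ m (Ψ a))
    (a v : EuclideanSpace ℝ (Fin d)) :
    coframe Γ (ψ (par Γ n a)) (modelDeriv (𝓡 d) (𝓡 d) ψ (par Γ n a) (frE Γ (par Γ n a) v)) =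
      expDeriv N Ψ a v := by
  have h1 := congrArg (fun L : EuclideanSpace ℝ (Fin d) →L[ℝ] EuclideanSpace ℝ (Fin d) => L v)
    (modelDeriv_comp_frE h hψ hΨ hpar a)
  change modelDeriv (𝓡 d) (𝓡 d) ψ (par Γ n a) (frE Γ (par Γ n a) v) =
    frE Γ (par Γ m (Ψ a)) (expDeriv N Ψ a v) at h1
  rw [h1, hpar, coframe_frE]

theorem mem_distribution_iff {W : Submodule ℝ (EuclideanSpace ℝ (Fin d))} {x : LeftQuotient Γ}
    {u : EuclideanSpace ℝ (Fin d)} :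
    (u : TangentSpace (𝓡 d) x) ∈ LeftQuotient.distribution Γ
      (W : Submodule ℝ (GroupLieAlgebra (𝓡 d) N)) x ↔ coframe Γ x u ∈ W := by
  constructor
  · rintro ⟨w, hw, rfl⟩
    have key : ∀ w : EuclideanSpace ℝ (Fin d), w ∈ W → coframe Γ x (frE Γ x w) ∈ W :=
      fun w hw => by rw [coframe_frE]; exact hw
    exact key w hw
  · intro hu
    exact ⟨coframe Γ x u, hu, frE_coframe Γ x u⟩

theorem IsSplitIsometry.coframe_mem {W : Submodule ℝ (EuclideanSpace ℝ (Fin d))}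
    {ψ : LeftQuotient Γ → LeftQuotient Γ} {x : LeftQuotient Γ}
    (hW : (LeftQuotient.distribution Γ (W : Submodule ℝ (GroupLieAlgebra (𝓡 d) N)) x).map
      (mfderiv (𝓡 d) (𝓡 d) ψ x).toLinearMap = LeftQuotient.distribution Γ
      (W : Submodule ℝ (GroupLieAlgebra (𝓡 d) N)) (ψ x)) {w : EuclideanSpace ℝ (Fin d)}
    (hw : w ∈ W) : coframe Γ (ψ x) (modelDeriv (𝓡 d) (𝓡 d) ψ x (frE Γ x w)) ∈ W := by
  refine mem_distribution_iff.mp (hW.le ⟨frE Γ x w, mem_distribution_iff.mpr ?_, rfl⟩)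
  rw [coframe_frE]
  exact hw

/-- A split isometry of `Γ\N` that lifts to a map of `N` commuting with `Γ` is induced by
the translation by a central element. -/
theorem exists_center_of_lift [SimplyConnectedSpace N] (h : IsTwoStep d N) (hB : B.IsSymm)
    (hBn : B.Nondegenerate) (hV : IsNullComplement B V)
    (hspan : Submodule.span ℝ (glog (d := d) h '' (Γ : Set N)) = ⊤)
    {ψ : LeftQuotient Γ ≃ₜ LeftQuotient Γ} (hψ : ψ ∈ splGroup Γ B V) {f : N → N}
    (hf : Continuous f) (hfψ : ∀ n, LeftQuotient.mk Γ (f n) = ψ (LeftQuotient.mk Γ n))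
    (hfΓ : ∀ γ ∈ Γ, ∀ n, f (γ * n) = γ * f n) :
    ∃ z ∈ Subgroup.center N, ∀ n, ψ (LeftQuotient.mk Γ n) = LeftQuotient.mk Γ (z * n) := by
  have hψs := hψ.smooth
  -- Locally a continuous lift is a smooth local inverse of the projection applied to `ψ`, so it is
  -- smooth.
  have hfs : ContMDiff (𝓡 d) (𝓡 d) ∞ f := fun n => by
    obtain ⟨s, hs, -, hl, -⟩ := mk_localInverse (d := d) Γ (f n)
    rw [hfψ] at hs
    refine ((hs.comp n ((hψs _).comp n (mk_contMDiff Γ n))).congr_of_eventuallyEq ?_)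
    filter_upwards [hf.continuousAt.eventually hl] with m hm
    rw [← hm, hfψ]
    rfl
  set Ψ : EuclideanSpace ℝ (Fin d) → EuclideanSpace ℝ (Fin d) :=
    fun a => glog h (f (gexp N a)) with hΨdef
  have hΨ : ContDiff ℝ ∞ Ψ :=
    ((contMDiff_glog h).comp (hfs.comp (contMDiff_gexp h))).contDiff
  have hgΨ : ∀ a, gexp N (Ψ a) = f (gexp N a) := fun a => gexp_glog h _
  have hpar : ∀ a, ψ (par Γ 1 a) = par Γ 1 (Ψ a) := fun a => by
    rw [par, par, one_mul, one_mul, hgΨ, hfψ]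
  have hD := coframe_modelDeriv h hψs hΨ hpar
  obtain ⟨hc, hadd⟩ := eq_add_of_expDeriv (N := N) (Ψ := Ψ) (b := formE N B) (v := complE B V)
    h hΨ hB hBn (isCompl_centerE_complE hB hV)
    (fun a x y => by
      rw [← hD a x, ← hD a y]
      refine (hψ.metric (par Γ 1 a) (frE Γ (par Γ 1 a) x) (frE Γ (par Γ 1 a) y)).trans ?_
      rw [metric_apply, coframe_frE, coframe_frE])
    (fun a z hz => by
      rw [← hD a z]
      rw [← lieCenter_eq] at hz ⊢
      exact IsSplitIsometry.coframe_mem (hψ.map_fst (par Γ 1 a)) hz)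
    (fun a w hw => by
      rw [← hD a w]
      exact IsSplitIsometry.coframe_mem (W := complE B V) (hψ.map_snd (par Γ 1 a)) hw)
    hspan (by
      rintro _ ⟨γ, hγ, rfl⟩
      simp only [hΨdef]
      rw [gexp_glog, gexp_zero, ← glog_mul, ← hfΓ γ hγ, mul_one])
  refine ⟨gexp N (Ψ 0), (gexp_mem_center_iff h).mpr hc, fun n => ?_⟩
  have h1 : n = gexp N (glog (d := d) h n) := (gexp_glog h n).symm
  rw [← hfψ, h1, ← hgΨ, hadd, ← gexp_bch h, bch, mem_centerE.mp hc, smul_zero, add_zero]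

/-- The homeomorphism of `Γ\N` induced by the translation by a central element. -/
def centralHomeo (Γ : Subgroup N) (z : Subgroup.center N) : LeftQuotient Γ ≃ₜ LeftQuotient Γ := by
  have key : ∀ z : Subgroup.center N, ∀ a b : N, (MulAction.orbitRel Γ N) a b →
      LeftQuotient.mk Γ (z * a) = LeftQuotient.mk Γ (z * b) := by
    rintro z a b ⟨γ, rfl⟩
    have h2 : (z : N) * ((γ : N) * b) = (γ : N) * (z * b) := by
      rw [← mul_assoc, ← mul_assoc, (Subgroup.mem_center_iff.mp z.2 γ)]
    refine (congrArg (LeftQuotient.mk Γ) h2).trans ?_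
    exact Quotient.sound (s := MulAction.orbitRel Γ N) ⟨γ, rfl⟩
  have hc : ∀ z : Subgroup.center N, Continuous
      (Quotient.lift (s := MulAction.orbitRel Γ N) (fun n => LeftQuotient.mk Γ (z * n)) (key z)) :=
    fun z => Continuous.quotient_lift
      (continuous_quotient_mk'.comp (continuous_const_mul (z : N))) _
  exact
    { toFun := Quotient.lift (s := MulAction.orbitRel Γ N) (fun n => LeftQuotient.mk Γ (z * n))
        (key z)
      invFun := Quotient.lift (s := MulAction.orbitRel Γ N)
        (fun n => LeftQuotient.mk Γ ((z⁻¹ : Subgroup.center N) * n)) (key z⁻¹)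
      left_inv := by
        rintro ⟨n⟩
        exact congrArg (LeftQuotient.mk Γ) (inv_mul_cancel_left (z : N) n)
      right_inv := by
        rintro ⟨n⟩
        exact congrArg (LeftQuotient.mk Γ) (mul_inv_cancel_left (z : N) n)
      continuous_toFun := hc z
      continuous_invFun := hc z⁻¹ }

variable (Γ) in
/-- The action of the center of `N` on `Γ\N`. -/
def centralHom : Subgroup.center N →* (LeftQuotient Γ ≃ₜ LeftQuotient Γ) where
  toFun := centralHomeo Γ
  map_one' := by
    ext x
    obtain ⟨n, rfl⟩ := Quotient.exists_rep x
    exact congrArg (LeftQuotient.mk Γ) (one_mul n)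
  map_mul' z w := by
    ext x
    obtain ⟨n, rfl⟩ := Quotient.exists_rep x
    exact congrArg (LeftQuotient.mk Γ) (mul_assoc (z : N) w n)

theorem centralHom_mk (z : Subgroup.center N) (n : N) :
    centralHom Γ z (LeftQuotient.mk Γ n) = LeftQuotient.mk Γ (z * n) := rfl

theorem contMDiff_centralHom (z : Subgroup.center N) :
    ContMDiff (𝓡 d) (𝓡 d) ∞ (centralHom Γ z) := by
  intro x
  obtain ⟨n, hn⟩ := Quotient.exists_rep x
  have hn' : LeftQuotient.mk Γ n = x := hn
  subst hn'
  obtain ⟨s, hs, hsn, -, hr⟩ := mk_localInverse (d := d) Γ n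
  have h1 : ContMDiffAt (𝓡 d) (𝓡 d) ∞ (fun m : N => LeftQuotient.mk Γ (z * m))
      (s (LeftQuotient.mk Γ n)) :=
    ((mk_contMDiff Γ).comp (contMDiff_mul_left (a := (z : N)))).contMDiffAt
  refine (h1.comp _ hs).congr_of_eventuallyEq ?_
  filter_upwards [hr] with q hq
  exact (congrArg (centralHom Γ z) hq).symm

theorem centralHom_par (z : Subgroup.center N) (n : N) (a : EuclideanSpace ℝ (Fin d)) :
    centralHom Γ z (par Γ n a) = par Γ (z * n) a := by
  rw [par, par, centralHom_mk, mul_assoc]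

theorem coframe_modelDeriv_centralHom (h : IsTwoStep d N) (z : Subgroup.center N)
    (x : LeftQuotient Γ) (v : EuclideanSpace ℝ (Fin d)) :
    coframe Γ (centralHom Γ z x) (modelDeriv (𝓡 d) (𝓡 d) (centralHom Γ z) x v) =
      coframe Γ x v := by
  obtain ⟨n, hn⟩ := Quotient.exists_rep x
  have hn' : LeftQuotient.mk Γ n = x := hn
  subst hn'
  have h1 := coframe_modelDeriv (Γ := Γ) h (contMDiff_centralHom z) (Ψ := id) contDiff_id
    (centralHom_par z n) 0 (coframe Γ (LeftQuotient.mk Γ n) v)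
  rw [par_zero, frE_coframe] at h1
  rw [h1]
  simp [expDeriv, expField_apply]

theorem map_distribution_centralHom (h : IsTwoStep d N) (z : Subgroup.center N)
    (W : Submodule ℝ (EuclideanSpace ℝ (Fin d))) (x : LeftQuotient Γ) :
    (LeftQuotient.distribution Γ (W : Submodule ℝ (GroupLieAlgebra (𝓡 d) N)) x).map
      (mfderiv (𝓡 d) (𝓡 d) (centralHom Γ z) x).toLinearMap =
      LeftQuotient.distribution Γ (W : Submodule ℝ (GroupLieAlgebra (𝓡 d) N))
        (centralHom Γ z x) := by
  have key := coframe_modelDeriv_centralHom (d := d) h z x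
  apply le_antisymm
  · rintro _ ⟨u, hu, rfl⟩
    refine mem_distribution_iff.mpr ?_
    have h1 := mem_distribution_iff.mp hu
    rw [← key u] at h1
    exact h1
  · intro u hu
    have h1 := mem_distribution_iff.mp hu
    refine ⟨frE Γ x (coframe Γ (centralHom Γ z x) u), mem_distribution_iff.mpr ?_, ?_⟩
    · rw [coframe_frE]; exact h1
    · have h2 := congrArg (frE Γ (centralHom Γ z x))
        (key (frE Γ x (coframe Γ (centralHom Γ z x) u)))
      rw [frE_coframe, coframe_frE] at h2
      exact h2.trans (frE_coframe Γ _ u)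

theorem centralHom_mem_splGroup (h : IsTwoStep d N) (z : Subgroup.center N) :
    centralHom Γ z ∈ splGroup Γ B V := by
  refine ⟨contMDiff_centralHom z, contMDiff_centralHom z⁻¹, fun x u w => ?_,
    map_distribution_centralHom h z _, map_distribution_centralHom h z _⟩
  refine (metric_apply _ _ _).trans (Eq.trans ?_ (metric_apply x u w).symm)
  exact congrArg₂ (fun a b => formE N B a b) (coframe_modelDeriv_centralHom h z x u)
    (coframe_modelDeriv_centralHom h z x w)

end CentralTranslation

/-! ### The identity component of the group of split isometries -/

section IdentityComponent

variable {d : ℕ} {N : Type*} [Group N] [TopologicalSpace N] [IsTopologicalGroup N] [T2Space N]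
  [LocallyCompactSpace N] [SimplyConnectedSpace N]
  [ChartedSpace (EuclideanSpace ℝ (Fin d)) N] [LieGroup (𝓡 d) ∞ N]
  {Γ : Subgroup N} [DiscreteTopology Γ] [CompactSpace (LeftQuotient Γ)]
  {B : LinearMap.BilinForm ℝ (GroupLieAlgebra (𝓡 d) N)}
  {V : Submodule ℝ (GroupLieAlgebra (𝓡 d) N)}

variable (Γ) in
/-- The conjugates of the nontrivial elements of a lattice stay away from the identity. -/
theorem exists_nhds_one_conj : ∃ W ∈ 𝓝 (1 : N), ∀ γ ∈ Γ, ∀ n : N, n⁻¹ * γ * n ∈ W → γ = 1 := by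
  obtain ⟨K, hK, hKs⟩ := exists_isCompact_surjOn Γ
  obtain ⟨C, hC, hC1⟩ := exists_compact_mem_nhds (1 : N)
  set S : Set N := (fun p : N × N => p.1 * p.2 * p.1⁻¹) '' (K ×ˢ C) with hS
  -- With `n = δ k`, the conjugate of `γ` by `n` is that of `δ⁻¹ γ δ` by `k ∈ K`. If it lies in the
  -- compact set `C`, only finitely many `δ⁻¹ γ δ` are possible, and the nontrivial ones are
  -- excluded one by one.
  have hfin : ((Γ : Set N) ∩ S).Finite :=
    finite_inter_of_isCompact Γ ((hK.prod hC).image (by fun_prop))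
  have hW : ∀ γ ∈ ((Γ : Set N) ∩ S) \ {1}, ((fun k : N => k⁻¹ * γ * k) '' K)ᶜ ∈ 𝓝 (1 : N) := by
    intro γ hγ
    refine (hK.image (by fun_prop)).isClosed.isOpen_compl.mem_nhds ?_
    rintro ⟨k, -, hk⟩
    have hk' : k⁻¹ * γ * k = 1 := hk
    refine hγ.2 ?_
    have h1 : γ = k * (k⁻¹ * γ * k) * k⁻¹ := by group
    rw [h1, hk']
    simp
  refine ⟨C ∩ ⋂ γ ∈ ((Γ : Set N) ∩ S) \ {1}, ((fun k : N => k⁻¹ * γ * k) '' K)ᶜ,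
    Filter.inter_mem hC1 ((Filter.biInter_mem (hfin.subset Set.sdiff_subset)).mpr hW), ?_⟩
  rintro γ hγ n ⟨hnC, hn⟩
  obtain ⟨δ, hδ, k, hk, rfl⟩ := hKs n
  have h1 : (δ * k)⁻¹ * γ * (δ * k) = k⁻¹ * (δ⁻¹ * γ * δ) * k := by group
  rw [h1] at hnC hn
  by_contra hne
  have h2 : δ⁻¹ * γ * δ ∈ ((Γ : Set N) ∩ S) \ {1} := by
    refine ⟨⟨Γ.mul_mem (Γ.mul_mem (Γ.inv_mem hδ) hγ) hδ, (k, _), ⟨hk, hnC⟩, by group⟩, ?_⟩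
    intro h3
    have h4 : δ⁻¹ * γ * δ = 1 := h3
    apply hne
    have h5 : γ = δ * (δ⁻¹ * γ * δ) * δ⁻¹ := by group
    rw [h5, h4]
    simp
  exact Set.mem_iInter₂.mp hn _ h2 ⟨k, hk, rfl⟩

/-- Each class `ψ(Γ n)` has exactly one representative in `n O`. The lift starting in `O` keeps
choosing it, by connectedness, and a canonical choice commutes with `Γ`. -/
theorem exists_lift_of_close [LocallyPathConnectedSpace N] {O : Set N} (hO : IsOpen O)
    (hOΓ : ∀ γ ∈ Γ, ∀ n : N, ∀ o ∈ O, ∀ o' ∈ O, γ * (n * o) = n * o' → γ = 1)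
    {ψ : LeftQuotient Γ → LeftQuotient Γ} (hψ : Continuous ψ)
    (hψO : ∀ n, ∃ o ∈ O, LeftQuotient.mk Γ (n * o) = ψ (LeftQuotient.mk Γ n)) :
    ∃ f : N → N, Continuous f ∧ (∀ n, LeftQuotient.mk Γ (f n) = ψ (LeftQuotient.mk Γ n)) ∧
      ∀ γ ∈ Γ, ∀ n, f (γ * n) = γ * f n := by
  obtain ⟨o₀, ho₀, h0⟩ := hψO 1
  rw [one_mul] at h0
  obtain ⟨f, ⟨hf0, hf⟩, -⟩ := (isCov Γ).isCoveringMap.existsUnique_continuousMap_lifts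
    (⟨fun n => ψ (LeftQuotient.mk Γ n), hψ.comp (isLH Γ).continuous⟩ : C(N, LeftQuotient Γ)) 1 o₀ h0
  have hfψ : ∀ n, LeftQuotient.mk Γ (f n) = ψ (LeftQuotient.mk Γ n) := congrFun hf
  have hS : {n : N | n⁻¹ * f n ∈ O} = Set.univ := by
    refine IsClopen.eq_univ ⟨⟨?_⟩, hO.preimage (by fun_prop)⟩ ⟨1, ?_⟩
    -- If `f n` is not in `n O`, some `γ f n` is. This persists nearby, and if `f m` were also in `m
    -- O` then `γ = 1`.
    · rw [isOpen_iff_mem_nhds]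
      intro n hn
      obtain ⟨o, ho, hno⟩ := hψO n
      rw [← hfψ] at hno
      obtain ⟨γ, hγ, hγn⟩ := mk_eq_mk_iff.mp hno
      have h1 : ∀ᶠ m in 𝓝 n, m⁻¹ * (γ * f m) ∈ O := by
        have h2 : Continuous fun m : N => m⁻¹ * (γ * f m) := by fun_prop
        refine h2.continuousAt.eventually (hO.mem_nhds ?_)
        change n⁻¹ * (γ * f n) ∈ O
        rw [hγn, inv_mul_cancel_left]
        exact ho
      filter_upwards [h1] with m hm hm'
      have h3 := hOΓ γ hγ m _ hm' _ hm (by rw [mul_inv_cancel_left, mul_inv_cancel_left])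
      subst h3
      rw [one_mul] at hγn
      refine hn ?_
      change n⁻¹ * f n ∈ O
      rw [hγn, inv_mul_cancel_left]
      exact ho
    · change (1 : N)⁻¹ * f 1 ∈ O
      rw [hf0, inv_one, one_mul]
      exact ho₀
  have hS' : ∀ n, n⁻¹ * f n ∈ O := fun n => hS.ge (Set.mem_univ n)
  refine ⟨f, f.continuous, hfψ, fun γ hγ n => ?_⟩
  have h1 : LeftQuotient.mk Γ (f (γ * n)) = LeftQuotient.mk Γ (f n) := by
    rw [hfψ, hfψ, mk_mul_of_mem hγ]
  obtain ⟨δ, hδ, hδn⟩ := mk_eq_mk_iff.mp h1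
  have h2 : δ * γ⁻¹ = 1 := by
    refine hOΓ _ (Γ.mul_mem hδ (Γ.inv_mem hγ)) (γ * n) _ (hS' n) _ (hS' (γ * n)) ?_
    rw [mul_inv_cancel_left, ← hδn]
    group
  rw [← hδn, mul_inv_eq_one.mp h2]

/-- Split isometries near the identity are induced by translations by central elements. -/
theorem eventually_exists_center (h : IsTwoStep d N) (hB : B.IsSymm)
    (hBn : B.Nondegenerate) (hV : IsNullComplement B V) :
    ∀ᶠ ψ : splGroup Γ B V in 𝓝 1, ∃ z : Subgroup.center N, centralHom Γ z = ψ.1 := by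
  have : LocallyPathConnectedSpace N :=
    ChartedSpace.locallyPathConnectedSpace (EuclideanSpace ℝ (Fin d)) N
  obtain ⟨W, hW, hWΓ⟩ := exists_nhds_one_conj Γ
  have h1 : ∀ᶠ p : N × N in 𝓝 (1, 1), p.2 * p.1⁻¹ ∈ W := by
    have h2 : Continuous fun p : N × N => p.2 * p.1⁻¹ := by fun_prop
    exact h2.continuousAt.eventually (by simpa using hW)
  rw [nhds_prod_eq, Filter.eventually_prod_self_iff'] at h1
  obtain ⟨t, ht, htW⟩ := h1
  obtain ⟨O, hOt, hO, hO1⟩ := mem_nhds_iff.mp ht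
  have hOΓ : ∀ γ ∈ Γ, ∀ n : N, ∀ o ∈ O, ∀ o' ∈ O, γ * (n * o) = n * o' → γ = 1 := by
    intro γ hγ n o ho o' ho' he
    refine hWΓ γ hγ n ?_
    have h2 : n⁻¹ * γ * n = o' * o⁻¹ := by
      have h3 : o' = n⁻¹ * (γ * (n * o)) := by rw [he, inv_mul_cancel_left]
      rw [h3]; group
    rw [h2]
    exact htW o (hOt ho) o' (hOt ho')
  -- A neighbourhood of the diagonal; by compactness, having the graph in it is an open condition in
  -- the compact-open topology.
  set U : Set (LeftQuotient Γ × LeftQuotient Γ) :=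
    Prod.map (LeftQuotient.mk Γ) (LeftQuotient.mk Γ) '' {p : N × N | p.1⁻¹ * p.2 ∈ O} with hU
  have hUo : IsOpen U :=
    ((isLH Γ).isOpenMap.prodMap (isLH Γ).isOpenMap) _ (hO.preimage (by fun_prop))
  have hcont : Continuous fun ψ : splGroup Γ B V =>
      ((ContinuousMap.id (LeftQuotient Γ)).prodMk
        (⟨ψ.1, ψ.1.continuous⟩ : C(LeftQuotient Γ, LeftQuotient Γ))) := by
    have h2 : Continuous fun ψ : LeftQuotient Γ ≃ₜ LeftQuotient Γ =>
      (⟨ψ, ψ.continuous⟩ : C(LeftQuotient Γ, LeftQuotient Γ)) := continuous_induced_dom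
    refine ContinuousMap.continuous_of_continuous_uncurry _ ?_
    exact continuous_snd.prodMk (ContinuousEval.continuous_eval.comp
      ((h2.comp continuous_subtype_val).prodMap continuous_id))
  have hev : ∀ᶠ ψ : splGroup Γ B V in 𝓝 1, ∀ x : LeftQuotient Γ, (x, ψ.1 x) ∈ U := by
    have h2 := (ContinuousMap.isOpen_setOfPred_mapsTo (X := LeftQuotient Γ) isCompact_univ hUo).preimage
      hcont
    have h3 := h2.mem_nhds (x := 1) (fun x _ => by
      obtain ⟨n, rfl⟩ := Quotient.exists_rep x
      exact ⟨(n, n), by simpa using hO1, rfl⟩)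
    filter_upwards [h3] with ψ hψ x using hψ (Set.mem_univ x)
  filter_upwards [hev] with ψ hψ
  obtain ⟨f, hf, hfψ, hfΓ⟩ := exists_lift_of_close hO hOΓ ψ.1.continuous (fun n => by
    obtain ⟨⟨a, b⟩, hab, he⟩ := hψ (LeftQuotient.mk Γ n)
    have he1 : LeftQuotient.mk Γ a = LeftQuotient.mk Γ n := congrArg Prod.fst he
    have he2 : LeftQuotient.mk Γ b = ψ.1 (LeftQuotient.mk Γ n) := congrArg Prod.snd he
    obtain ⟨γ, hγ, rfl⟩ := mk_eq_mk_iff.mp he1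
    refine ⟨_, hab, ?_⟩
    rw [← he2]
    refine Eq.trans ?_ (mk_mul_of_mem (Γ.inv_mem hγ) b)
    congr 1
    simp only
    group)
  obtain ⟨z, hz, hzψ⟩ := exists_center_of_lift h hB hBn hV (span_glog_eq_top Γ h) ψ.2 hf hfψ hfΓ
  refine ⟨⟨z, hz⟩, ?_⟩
  ext x
  obtain ⟨n, rfl⟩ := Quotient.exists_rep x
  exact (hzψ n).symm

theorem continuous_centralHom : Continuous (centralHom Γ) := by
  refine continuous_induced_rng.mpr (ContinuousMap.continuous_of_continuous_uncurry _ ?_)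
  have h1 : IsOpenQuotientMap (Prod.map id (LeftQuotient.mk Γ) :
      Subgroup.center N × N → Subgroup.center N × LeftQuotient Γ) :=
    IsOpenQuotientMap.id.prodMap
      ⟨Quotient.mk_surjective, (isLH Γ).continuous, (isLH Γ).isOpenMap⟩
  rw [h1.isQuotientMap.continuous_iff]
  have h2 : Continuous fun p : Subgroup.center N × N => LeftQuotient.mk Γ ((p.1 : N) * p.2) :=
    (isLH Γ).continuous.comp (by fun_prop)
  exact h2

theorem centralHom_eq_of_apply_eq {z : Subgroup.center N} {x : LeftQuotient Γ}
    (hz : centralHom Γ z x = x) : (z : N) ∈ Γ := by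
  obtain ⟨n, rfl⟩ := Quotient.exists_rep x
  obtain ⟨γ, hγ, h⟩ := mk_eq_mk_iff.mp ((centralHom_mk z n).symm.trans hz)
  rw [← mul_right_cancel h]
  exact hγ

theorem centralHom_eq_one {z : Subgroup.center N} (hz : (z : N) ∈ Γ) : centralHom Γ z = 1 := by
  ext x
  obtain ⟨n, rfl⟩ := Quotient.exists_rep x
  exact mk_mul_of_mem hz n

variable (Γ B V) in
/-- The homomorphism from the torus `(Γ ∩ Z)\Z` to the group of split isometries. -/
def torusHom (h : IsTwoStep d N) : CentralTorus Γ →* splGroup Γ B V :=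
  QuotientGroup.lift _ ((centralHom Γ).codRestrict (splGroup Γ B V)
    (centralHom_mem_splGroup h)) fun _ hz => Subtype.ext (centralHom_eq_one hz)

theorem continuous_torusHom (h : IsTwoStep d N) : Continuous (torusHom Γ B V h) :=
  (continuous_centralHom.subtype_mk (centralHom_mem_splGroup h)).quotient_lift _

theorem eq_one_of_torusHom_apply_eq (h : IsTwoStep d N) {t : CentralTorus Γ}
    {x : LeftQuotient Γ} (ht : (torusHom Γ B V h t).1 x = x) : t = 1 := by
  obtain ⟨z, rfl⟩ := QuotientGroup.mk_surjective t
  exact (QuotientGroup.eq_one_iff z).mpr (centralHom_eq_of_apply_eq ht)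

theorem torusHom_injective (h : IsTwoStep d N) : Function.Injective (torusHom Γ B V h) := by
  refine (injective_iff_map_eq_one _).mpr fun t ht => ?_
  refine eq_one_of_torusHom_apply_eq (B := B) (V := V) h (x := LeftQuotient.mk Γ 1) ?_
  rw [ht]
  rfl

theorem compactSpace_centralTorus (h : IsTwoStep d N) : CompactSpace (CentralTorus Γ) := by
  obtain ⟨K, hK, hKs⟩ := exists_isCompact_center (d := d) Γ h
  have hcl : IsClosed (Subgroup.center N : Set N) := by
    have h0 := Set.isClosed_centralizer (Set.univ : Set N)
    rwa [Set.centralizer_univ] at h0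
  have h1 : IsCompact ((↑) ⁻¹' K : Set (Subgroup.center N)) :=
    hcl.isClosedEmbedding_subtypeVal.isCompact_preimage hK
  have h2 := h1.image (continuous_quotient_mk' (s := QuotientGroup.leftRel
    (Γ.subgroupOf (Subgroup.center N))))
  refine ⟨h2.of_isClosed_subset isClosed_univ fun t _ => ?_⟩
  obtain ⟨z, rfl⟩ := QuotientGroup.mk_surjective t
  obtain ⟨γ, hγ, hγc, k, hk, hz⟩ := hKs z z.2
  have hkc : k ∈ Subgroup.center N := by
    have h3 : k = γ⁻¹ * z := by rw [hz, inv_mul_cancel_left]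
    rw [h3]
    exact Subgroup.mul_mem _ (Subgroup.inv_mem _ hγc) z.2
  refine ⟨⟨k, hkc⟩, hk, ?_⟩
  refine QuotientGroup.eq.mpr ?_
  change k⁻¹ * (z : N) ∈ Γ
  rw [hz, Subgroup.mem_center_iff.mp hkc, inv_mul_cancel_left]
  exact hγ

/-- The range is connected, because the torus is an image of the vector space `𝔷`. It contains a
neighbourhood of `1` by `eventually_exists_center`, so it is an open and closed subgroup. -/
theorem range_torusHom (h : IsTwoStep d N) (hB : B.IsSymm)
    (hBn : B.Nondegenerate) (hV : IsNullComplement B V) :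
    (torusHom Γ B V h).range = splGroupZero Γ B V := by
  have hconn : ConnectedSpace (CentralTorus Γ) := by
    have h1 : Continuous fun z : centerE d N => (QuotientGroup.mk
        (⟨gexp N (z : EuclideanSpace ℝ (Fin d)), (gexp_mem_center_iff h).mpr z.2⟩ :
          Subgroup.center N) : CentralTorus Γ) :=
      continuous_quotient_mk'.comp (((contMDiff_gexp h).continuous.comp
        continuous_subtype_val).subtype_mk _)
    refine Function.Surjective.connectedSpace (f := _) ?_ h1
    intro t
    obtain ⟨z, rfl⟩ := QuotientGroup.mk_surjective t
    have h2 : glog (d := d) h (z : N) ∈ centerE d N :=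
      (gexp_mem_center_iff h).mp (by rw [gexp_glog]; exact z.2)
    refine ⟨⟨_, h2⟩, ?_⟩
    exact congrArg QuotientGroup.mk (Subtype.ext (gexp_glog h _))
  apply le_antisymm
  · intro ψ hψ
    refine (isPreconnected_range (continuous_torusHom h)).subset_connectedComponent
      (x := 1) ⟨1, map_one _⟩ hψ
  · have h1 : ((torusHom Γ B V h).range : Set (splGroup Γ B V)) ∈ 𝓝 1 := by
      filter_upwards [eventually_exists_center h hB hBn hV] with ψ hψ
      obtain ⟨z, hz⟩ := hψ
      exact ⟨QuotientGroup.mk z, Subtype.ext hz⟩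
    have h2 := Subgroup.isOpen_of_mem_nhds _ h1
    exact IsClopen.connectedComponent_subset ⟨Subgroup.isClosed_of_isOpen _ h2, h2⟩
      (Subgroup.one_mem _)

variable (Γ) in
/-- The isomorphism from the torus `(Γ ∩ Z)\Z` onto the identity component of the group
of split isometries. -/
def torusEquiv (h : IsTwoStep d N) (hB : B.IsSymm)
    (hBn : B.Nondegenerate) (hV : IsNullComplement B V) : CentralTorus Γ ≃* splGroupZero Γ B V :=
  MulEquiv.ofBijective ((torusHom Γ B V h).codRestrict (splGroupZero Γ B V)
    fun t => (range_torusHom h hB hBn hV).le ⟨t, rfl⟩)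
    ⟨fun _ _ hst => torusHom_injective (B := B) (V := V) h (congrArg Subtype.val hst), fun ψ => by
      obtain ⟨t, ht⟩ := (range_torusHom h hB hBn hV).ge ψ.2
      exact ⟨t, Subtype.ext ht⟩⟩

/-- A continuous bijection from a compact space to a Hausdorff one. -/
theorem isHomeomorph_torusEquiv (h : IsTwoStep d N) (hB : B.IsSymm)
    (hBn : B.Nondegenerate) (hV : IsNullComplement B V) :
    IsHomeomorph (torusEquiv Γ h hB hBn hV) := by
  have := compactSpace_centralTorus (Γ := Γ) h
  have : T2Space (LeftQuotient Γ ≃ₜ LeftQuotient Γ) := by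
    refine T2Space.of_injective_continuous
      (f := fun ψ => (⟨ψ, ψ.continuous⟩ : C(LeftQuotient Γ, LeftQuotient Γ))) ?_
      continuous_induced_dom
    intro φ ψ hφψ
    ext x
    exact congrArg (fun f : C(LeftQuotient Γ, LeftQuotient Γ) => f x) hφψ
  rw [isHomeomorph_iff_continuous_bijective]
  exact ⟨(continuous_torusHom h).subtype_mk _, (torusEquiv Γ h hB hBn hV).bijective⟩

end IdentityComponent

/-! ### Maps whose local inverses are charts -/

section Parametrization

variable {E : Type*} [NormedAddCommGroup E] [NormedSpace ℝ E]
  {M : Type*} [TopologicalSpace M] [ChartedSpace E M]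

/-- A map from the model space all of whose local inverses are charts. -/
def IsParametrization (p : E → M) : Prop :=
  ∀ v, ∃ e ∈ IsManifold.maximalAtlas 𝓘(ℝ, E) ∞ M, v ∈ e.target ∧ ⇑e.symm = p

variable {p : E → M}

theorem IsParametrization.contMDiff [IsManifold 𝓘(ℝ, E) ∞ M] (hp : IsParametrization p) :
    ContMDiff 𝓘(ℝ, E) 𝓘(ℝ, E) ∞ p := fun v => by
  obtain ⟨e, he, hv, rfl⟩ := hp v
  exact contMDiffAt_symm_of_mem_maximalAtlas he hv

theorem IsParametrization.exists_section [IsManifold 𝓘(ℝ, E) ∞ M] (hp : IsParametrization p)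
    (v : E) : ∃ s : M → E, ContMDiffAt 𝓘(ℝ, E) 𝓘(ℝ, E) ∞ s (p v) ∧ s (p v) = v ∧
      ∀ᶠ q in 𝓝 (p v), p (s q) = q := by
  obtain ⟨e, he, hv, rfl⟩ := hp v
  refine ⟨e, contMDiffAt_of_mem_maximalAtlas he (e.map_target hv), e.right_inv hv, ?_⟩
  filter_upwards [e.open_source.mem_nhds (e.map_target hv)] with q hq using e.left_inv hq

theorem IsParametrization.contMDiff_of_comp [IsManifold 𝓘(ℝ, E) ∞ M] (hp : IsParametrization p)
    (hs : Function.Surjective p) {E' : Type*} [NormedAddCommGroup E'] [NormedSpace ℝ E']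
    {H' : Type*} [TopologicalSpace H'] {I' : ModelWithCorners ℝ E' H'} {M' : Type*}
    [TopologicalSpace M'] [ChartedSpace H' M'] {f : M → M'}
    (hf : ContMDiff 𝓘(ℝ, E) I' ∞ (f ∘ p)) : ContMDiff 𝓘(ℝ, E) I' ∞ f := by
  intro q
  obtain ⟨v, rfl⟩ := hs q
  obtain ⟨s, hs, -, hr⟩ := hp.exists_section v
  refine ((hf (s (p v))).comp (p v) hs).congr_of_eventuallyEq ?_
  filter_upwards [hr] with q hq
  exact (congrArg f hq).symm

/-- In the charts inverse to the two parametrizations `f` is exactly `w ↦ L (w, 0)`; the source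
chart is only shrunk so that the image stays in the target chart. -/
theorem IsParametrization.isImmersionAtOfComplement [IsManifold 𝓘(ℝ, E) ∞ M]
    (hp : IsParametrization p) {E' : Type*} [NormedAddCommGroup E'] [NormedSpace ℝ E']
    {M' : Type*} [TopologicalSpace M'] [ChartedSpace E' M'] [IsManifold 𝓘(ℝ, E') ∞ M']
    {p' : E' → M'} (hp' : IsParametrization p') {f : M → M'} {F : Type*} [NormedAddCommGroup F]
    [NormedSpace ℝ F] (L : (E × F) ≃L[ℝ] E') (hf : ∀ v, f (p v) = p' (L (v, 0))) (v : E) :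
    Manifold.IsImmersionAtOfComplement F 𝓘(ℝ, E) 𝓘(ℝ, E') ∞ f (p v) := by
  obtain ⟨e, he, hv, rfl⟩ := hp v
  obtain ⟨e', he', hv', rfl⟩ := hp' (L (v, 0))
  set g : E → E' := fun w => L (w, 0) with hg
  have hgc : Continuous g := by fun_prop
  set φ := e.trans (OpenPartialHomeomorph.ofSet (g ⁻¹' e'.target)
    (e'.open_target.preimage hgc)) with hφ
  have hφa : φ ∈ IsManifold.maximalAtlas 𝓘(ℝ, E) ∞ M := by
    refine φ.mem_maximalAtlas_of_contMDiffOn ?_ ?_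
    · refine (contMDiffOn_of_mem_maximalAtlas he).mono ?_
      simp [hφ]
    · refine (contMDiffOn_symm_of_mem_maximalAtlas he).mono ?_
      simp [hφ]
  have hsrc : ∀ q ∈ φ.source, q ∈ e.source ∧ g (e q) ∈ e'.target := fun q hq => by
    simpa [hφ] using hq
  have hf' : ∀ q ∈ e.source, f q = e'.symm (g (e q)) := fun q hq => by
    rw [hg, ← hf, e.left_inv hq]
  refine Manifold.IsImmersionAtOfComplement.mk_of_charts L φ e' ?_ ?_ hφa he' ?_ ?_
  · simp only [hφ, mfld_simps]
    exact ⟨e.map_target hv, by rw [e.right_inv hv]; exact hv'⟩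
  · rw [hf]
    exact e'.map_target hv'
  · intro q hq
    change f q ∈ e'.source
    rw [hf' q (hsrc q hq).1]
    exact e'.map_target (hsrc q hq).2
  · intro w hw
    have hw' : w ∈ e.target ∧ g w ∈ e'.target := by
      simpa [hφ, and_comm] using hw
    change e' (f (e.symm w)) = L (w, 0)
    rw [hf]
    exact e'.right_inv hw'.2

end Parametrization

/-! ### Lie group structures from coverings by vector spaces -/

section CoveringGroup

variable {E : Type*} [NormedAddCommGroup E] [NormedSpace ℝ E]
  {G : Type*} [Group G] [TopologicalSpace G]

/-- A surjective homomorphism from a vector space that is a local homeomorphism makes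
a Lie group of its target. -/
theorem exists_lieGroup_of_isLocalHomeomorph {p : E → G} (hp : IsLocalHomeomorph p)
    (hs : Function.Surjective p) (hadd : ∀ v w, p (v + w) = p v * p w) :
    ∃ (_ : ChartedSpace E G) (_ : LieGroup 𝓘(ℝ, E) ∞ G), IsParametrization p := by
  have h0 : p 0 = 1 := by
    have h1 := hadd 0 0
    rw [add_zero] at h1
    exact (mul_eq_left.mp h1.symm)
  choose v hv using hs
  let cs : ChartedSpace E G :=
    { atlas := {e | ⇑e.symm = p}
      chartAt := fun g => hp.localInverseAt (v g)
      mem_chart_source := fun g => by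
        have h1 := hp.apply_self_mem_localInverseAt_source (x := v g)
        rwa [hv] at h1
      chart_mem_atlas := fun g => hp.localInverseAt_symm (v g) }
  have hat : ∀ e ∈ atlas E G, ⇑e.symm = p := fun e he => he
  have htrans : ∀ e ∈ atlas E G, ∀ y, p y ∈ e.source →
      ContDiffAt ℝ ∞ (fun x => e (p x)) y := by
    intro e he y hy
    have hep := hat e he
    -- Transition maps are translations: `k` lies in the kernel of `p`, and near `y` the point `x +
    -- k` is the preimage of `p x` selected by `e`.
    set k := e (p y) - y with hk
    have hk1 : y + k = e (p y) := by rw [hk]; abel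
    have hpk : p k = 1 := by
      have h1 : p (e (p y)) = p y := by rw [← hep]; rw [← hep] at hy; exact e.left_inv hy
      rw [← hk1, hadd] at h1
      exact mul_eq_left.mp h1
    have hc : Continuous fun x : E => x + k := by fun_prop
    have h2 : ∀ᶠ x in 𝓝 y, x + k ∈ e.target := by
      refine hc.continuousAt.eventually (e.open_target.mem_nhds ?_)
      change y + k ∈ e.target
      rw [hk1]
      exact e.map_source hy
    have h4 : ContDiffAt ℝ ∞ (fun x : E => x + k) y := contDiffAt_id.add contDiffAt_const
    refine h4.congr_of_eventuallyEq ?_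
    filter_upwards [h2] with x hx
    have h3 : p x = e.symm (x + k) := by rw [hep, hadd, hpk, mul_one]
    rw [h3, e.right_inv hx]
  have hm : IsManifold 𝓘(ℝ, E) ∞ G := by
    refine isManifold_of_contDiffOn _ _ _ fun e e' he he' => ?_
    intro y hy
    simp only [mfld_simps] at hy
    refine ContDiffAt.contDiffWithinAt ?_
    rw [hat e he] at hy
    have h1 := htrans e' he' y hy.2
    have h2 : (𝓘(ℝ, E) ∘ (e.symm.trans e') ∘ 𝓘(ℝ, E).symm : E → E) = fun x => e' (p x) := by
      funext x
      simp [hat e he]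
    rw [h2]
    exact h1
  have hpar : IsParametrization p := fun w =>
    ⟨hp.localInverseAt w, IsManifold.subset_maximalAtlas (hp.localInverseAt_symm w),
      hp.self_mem_localInverseAt_target, hp.localInverseAt_symm w⟩
  have hsurj : Function.Surjective p := fun g => ⟨v g, hv g⟩
  have hneg : ∀ w, p (-w) = (p w)⁻¹ := fun w => by
    rw [eq_inv_iff_mul_eq_one, ← hadd, neg_add_cancel, h0]
  refine ⟨cs, ?_, hpar⟩
  have hmul : ContMDiffMul 𝓘(ℝ, E) ∞ G := by
    refine ⟨?_⟩
    rintro ⟨g, k⟩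
    obtain ⟨a, rfl⟩ := hsurj g
    obtain ⟨b, rfl⟩ := hsurj k
    obtain ⟨s, hs, -, hr⟩ := hpar.exists_section a
    obtain ⟨s', hs', -, hr'⟩ := hpar.exists_section b
    have h1 : ContMDiffAt (𝓘(ℝ, E).prod 𝓘(ℝ, E)) 𝓘(ℝ, E) ∞
        (fun q : G × G => s q.1 + s' q.2) (p a, p b) :=
      (hs.comp (p a, p b) contMDiffAt_fst).add (hs'.comp (p a, p b) contMDiffAt_snd)
    refine ((hpar.contMDiff _).comp _ h1).congr_of_eventuallyEq ?_
    filter_upwards [continuousAt_fst.eventually hr, continuousAt_snd.eventually hr'] with q hq hq'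
    change q.1 * q.2 = p (s q.1 + s' q.2)
    rw [hadd, hq, hq']
  refine ⟨hpar.contMDiff_of_comp hsurj ?_⟩
  have h3 : ((fun g : G => g⁻¹) ∘ p) = p ∘ fun w => -w := funext fun w => (hneg w).symm
  rw [h3]
  exact hpar.contMDiff.comp contDiff_neg.contMDiff

end CoveringGroup

/-! ### Exponential coordinates are charts of the quotient -/

section QuotientParametrization

variable {d : ℕ} {N : Type*} [Group N] [TopologicalSpace N] [IsTopologicalGroup N] [T2Space N]
  [LocallyCompactSpace N] [SimplyConnectedSpace N]
  [ChartedSpace (EuclideanSpace ℝ (Fin d)) N] [LieGroup (𝓡 d) ∞ N]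
  {Γ : Subgroup N} [DiscreteTopology Γ]

theorem isLocalHomeomorph_par (h : IsTwoStep d N) (n : N) :
    IsLocalHomeomorph (par (d := d) Γ n) :=
  (isLH Γ).comp (((gexpHomeomorph h).trans (Homeomorph.mulLeft n)).isLocalHomeomorph)

/-- The local inverses of `par` are smooth: near the point with coordinate `b` they are `bch b ∘ σ`,
with `σ` the smooth inverse centred at that point. -/
theorem isParametrization_par (h : IsTwoStep d N) (n : N) :
    IsParametrization (par (d := d) Γ n) := by
  have hl := isLocalHomeomorph_par (d := d) (Γ := Γ) h n
  intro a
  refine ⟨hl.localInverseAt a, ?_, hl.self_mem_localInverseAt_target, hl.localInverseAt_symm a⟩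
  set e := hl.localInverseAt a with he
  have hes : ⇑e.symm = par (d := d) Γ n := hl.localInverseAt_symm a
  refine e.mem_maximalAtlas_of_contMDiffOn ?_ ?_
  · intro q hq
    refine ContMDiffAt.contMDiffWithinAt ?_
    set b := e q with hb
    have hbt : b ∈ e.target := e.map_source hq
    have hq' : q = LeftQuotient.mk Γ (n * gexp N b) := by
      have h1 := e.left_inv hq
      rw [hes] at h1
      exact h1.symm
    obtain ⟨σ, hσ, hσ0, -, hr⟩ := exists_par_inverse (d := d) Γ h (n * gexp N b)
    rw [← hq'] at hσ hσ0 hr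
    have hbσ : ContMDiffAt (𝓡 d) 𝓘(ℝ, EuclideanSpace ℝ (Fin d)) ∞
        (fun y => bch (N := N) b (σ y)) q := (contDiff_bch b).contMDiff.contMDiffAt.comp q hσ
    refine hbσ.congr_of_eventuallyEq ?_
    have hev : ∀ᶠ y in 𝓝 q, bch (N := N) b (σ y) ∈ e.target := by
      refine hbσ.continuousAt.eventually (e.open_target.mem_nhds ?_)
      change bch (N := N) b (σ q) ∈ e.target
      rw [hσ0, bch_zero_right]
      exact hbt
    filter_upwards [hev, hr] with y hy hy'
    rw [par_mul_gexp h] at hy'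
    have h2 := e.right_inv hy
    rw [hes, hy'] at h2
    exact h2
  · rw [hes]
    exact (contMDiff_par h n).contMDiffOn

end QuotientParametrization

/-! ### Compact quotients of vector spaces are products of circles -/

section TorusIso

variable {E : Type*} [NormedAddCommGroup E] [NormedSpace ℝ E] [FiniteDimensional ℝ E]
  {G : Type*} [Group G] [TopologicalSpace G] [CompactSpace G]

/-- A compact group that is covered by a vector space of dimension `m` is isomorphic to the product
of `m` circles. -/
theorem nonempty_continuousMulEquiv_circle {p : E → G} (hp : IsLocalHomeomorph p)
    (hs : Function.Surjective p) (hadd : ∀ v w, p (v + w) = p v * p w) {m : ℕ}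
    (hm : Module.finrank ℝ E = m) : Nonempty (G ≃ₜ* (Fin m → Circle)) := by
  have h0 : p 0 = 1 := by
    have h1 := hadd 0 0
    rw [add_zero] at h1
    exact (mul_eq_left.mp h1.symm)
  have hneg : ∀ w, p (-w) = (p w)⁻¹ := fun w => by
    rw [eq_inv_iff_mul_eq_one, ← hadd, neg_add_cancel, h0]
  set Λ₀ : AddSubgroup E :=
    { carrier := {v | p v = 1}
      add_mem' := fun {v w} hv hw => by
        rw [Set.mem_ofPred_eq] at hv hw ⊢
        rw [hadd, hv, hw, one_mul]
      zero_mem' := h0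
      neg_mem' := fun {v} hv => by
        rw [Set.mem_ofPred_eq] at hv ⊢
        rw [hneg, hv, inv_one] } with hΛ₀
  set Λ : Submodule ℤ E := AddSubgroup.toIntSubmodule Λ₀ with hΛdef
  have hΛ : ∀ {v}, v ∈ Λ ↔ p v = 1 := Iff.rfl
  have hpq : ∀ {v w}, p v = p w ↔ v - w ∈ Λ := fun {v w} => by
    rw [hΛ, sub_eq_add_neg, hadd, hneg, mul_inv_eq_one]
  have hq : Topology.IsQuotientMap p := hp.isOpenMap.isQuotientMap hp.continuous hs
  have hdisc : DiscreteTopology Λ := by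
    refine discreteTopology_of_isOpen_singleton_zero ?_
    refine ⟨(hp.localInverseAt 0).target, (hp.localInverseAt 0).open_target, ?_⟩
    ext ⟨x, hx⟩
    simp only [Set.mem_preimage, Set.mem_singleton_iff]
    constructor
    · intro hx'
      exact Subtype.ext (hp.injOn_localInverseAt_target hx' hp.self_mem_localInverseAt_target
        ((hΛ.mp hx).trans h0.symm))
    · intro hx0
      rw [show x = 0 from congrArg Subtype.val hx0]
      exact hp.self_mem_localInverseAt_target
  -- A functional vanishing on the kernel descends to the compact group, so it is bounded and hence
  -- zero: the kernel spans.
  have hlat : IsZLattice ℝ Λ := by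
    refine ⟨?_⟩
    by_contra hne
    obtain ⟨f, hf0, hf⟩ := Submodule.exists_le_ker_of_lt_top _ (lt_top_iff_ne_top.mpr hne)
    choose v hv using hs
    have hF : (fun g => f (v g)) ∘ p = f := by
      funext w
      have h1 : v (p w) - w ∈ Λ := hpq.mp (hv (p w))
      have h2 := LinearMap.mem_ker.mp (hf (Submodule.subset_span h1))
      rw [map_sub, sub_eq_zero] at h2
      exact h2
    have hFc : Continuous fun g => f (v g) := by
      rw [hq.continuous_iff, hF]
      exact f.continuous_of_finiteDimensional
    obtain ⟨C, hC⟩ := (isCompact_range hFc).isBounded.exists_norm_le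
    have hb : ∀ x, |f x| ≤ C := fun x => by
      have h1 := hC _ ⟨p x, congrFun hF x⟩
      rwa [Real.norm_eq_abs] at h1
    apply hf0
    ext1 x
    by_contra hx
    have hx0 : 0 < |f x| := abs_pos.mpr hx
    have h1 := hb (((C + 1) / |f x|) • x)
    have hC0 : 0 ≤ C := (abs_nonneg _).trans (hb 0)
    rw [map_smul, smul_eq_mul, abs_mul, abs_div, abs_abs, div_mul_cancel₀ _ hx0.ne',
      abs_of_nonneg (by linarith)] at h1
    linarith
  have : Module.Finite ℤ Λ := ZLattice.module_finite ℝ Λ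
  have : Module.Free ℤ Λ := ZLattice.module_free ℝ Λ
  set b := (Module.finBasisOfFinrankEq ℤ Λ ((ZLattice.rank ℝ Λ).trans hm)).ofZLatticeBasis ℝ Λ
    with hb
  have hbΛ : ∀ v, v ∈ Λ ↔ ∀ i, ∃ k : ℤ, b.repr v i = k := fun v => by
    rw [← Module.Basis.ofZLatticeBasis_span ℝ Λ
      (Module.finBasisOfFinrankEq ℤ Λ ((ZLattice.rank ℝ Λ).trans hm)), ← hb,
      Module.Basis.mem_span_iff_repr_mem ℤ b v]
    exact forall_congr' fun i => ⟨fun ⟨k, hk⟩ => ⟨k, hk.symm⟩, fun ⟨k, hk⟩ => ⟨k, hk.symm⟩⟩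
  -- In a basis of the lattice, this homomorphism has the same kernel as `p`, so it factors through
  -- an isomorphism.
  set q : E → Fin m → Circle := fun v i => Circle.exp (2 * Real.pi * b.repr v i) with hqdef
  have hqc : Continuous q := by
    refine continuous_pi fun i => Circle.exp.continuous.comp (continuous_const.mul ?_)
    exact (b.coord i).continuous_of_finiteDimensional
  have hqadd : ∀ v w, q (v + w) = q v * q w := fun v w => by
    funext i
    simp only [hqdef, map_add, Finsupp.add_apply, mul_add, Circle.exp_add, Pi.mul_apply]
  have hqs : Function.Surjective q := fun c => by
    choose a ha using fun i => Circle.exp_surjective (c i)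
    refine ⟨b.equivFun.symm fun i => a i / (2 * Real.pi), ?_⟩
    funext i
    have h1 : b.repr (b.equivFun.symm fun i => a i / (2 * Real.pi)) i = a i / (2 * Real.pi) :=
      congrFun (b.equivFun.apply_symm_apply _) i
    simp only [hqdef]
    rw [h1, mul_div_cancel₀ _ (by positivity), ha]
  have hq1 : ∀ v w, q v = q w ↔ v - w ∈ Λ := fun v w => by
    rw [hbΛ, funext_iff]
    refine forall_congr' fun i => ?_
    simp only [hqdef]
    rw [Circle.exp_eq_exp]
    refine exists_congr fun k => ?_
    rw [map_sub, Finsupp.sub_apply]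
    have hpi := Real.pi_pos
    constructor
    · intro h1
      have h2 : 2 * Real.pi * (b.repr v i - b.repr w i) = 2 * Real.pi * k := by linarith
      exact mul_left_cancel₀ (by positivity) h2
    · intro h1
      have h2 : b.repr v i = b.repr w i + k := by linarith
      rw [h2]; ring
  choose v hv using hs
  have hφ : (fun g => q (v g)) ∘ p = q := by
    funext w
    exact (hq1 _ _).mpr (hpq.mp (hv (p w)))
  have hφc : Continuous fun g => q (v g) := by
    rw [hq.continuous_iff, hφ]
    exact hqc
  have hbij : Function.Bijective fun g => q (v g) := by
    constructor
    · intro g g' hgg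
      rw [← hv g, ← hv g']
      exact hpq.mpr ((hq1 _ _).mp hgg)
    · intro c
      obtain ⟨w, hw⟩ := hqs c
      exact ⟨p w, (congrFun hφ w).trans hw⟩
  have hmul : ∀ g g', q (v (g * g')) = q (v g) * q (v g') := fun g g' => by
    rw [← hqadd]
    refine (hq1 _ _).mpr (hpq.mp ?_)
    rw [hadd, hv, hv, hv]
  have hhom := isHomeomorph_iff_continuous_bijective.mpr ⟨hφc, hbij⟩
  set e := MulEquiv.ofBijective (MulHom.mk _ hmul) hbij with he
  refine ⟨⟨e, hφc, ?_⟩⟩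
  have h1 : (e.symm : (Fin m → Circle) → G) = hhom.homeomorph.symm := by
    funext c
    rw [MulEquiv.symm_apply_eq]
    exact (hhom.homeomorph.apply_symm_apply c).symm
  change Continuous e.symm
  rw [h1]
  exact hhom.homeomorph.symm.continuous

end TorusIso

/-! ### The covering of the central torus by the center of the Lie algebra -/

section CentralTorus

variable {d : ℕ} {N : Type*} [Group N] [TopologicalSpace N] [IsTopologicalGroup N] [T2Space N]
  [LocallyCompactSpace N] [SimplyConnectedSpace N]
  [ChartedSpace (EuclideanSpace ℝ (Fin d)) N] [LieGroup (𝓡 d) ∞ N]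

variable (d N) in
/-- Linear coordinates on the center of the Lie algebra. -/
def centerCoord : EuclideanSpace ℝ (Fin (centerDim d N)) ≃L[ℝ] centerE d N :=
  ContinuousLinearEquiv.ofFinrankEq (by
    rw [finrank_euclideanSpace_fin, ← lieCenter_eq]
    rfl)

/-- The exponential map from the center of the Lie algebra onto the center of the group. -/
def centerExp (h : IsTwoStep d N) : centerE d N ≃ₜ Subgroup.center N :=
  (gexpHomeomorph h).subtype fun _ => (gexp_mem_center_iff h).symm

theorem centerExp_add (h : IsTwoStep d N) (z w : centerE d N) :
    centerExp h (z + w) = centerExp h z * centerExp h w :=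
  Subtype.ext (gexp_add_of_lieBrL_eq_zero h (mem_centerE.mp z.2 w))

theorem centralHom_centerExp (Γ : Subgroup N) [DiscreteTopology Γ] (h : IsTwoStep d N)
    (z : centerE d N) (n : N) :
    centralHom Γ (centerExp h z) (LeftQuotient.mk Γ n) = par Γ n (z : EuclideanSpace ℝ (Fin d)) :=
  congrArg (LeftQuotient.mk Γ) (Subgroup.mem_center_iff.mp (centerExp h z).2 n).symm

variable (Γ : Subgroup N)

/-- The exponential map from the center of the Lie algebra onto the torus `(Γ ∩ Z)\Z`. -/
def torusParam (h : IsTwoStep d N) (v : EuclideanSpace ℝ (Fin (centerDim d N))) :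
    CentralTorus Γ :=
  QuotientGroup.mk (centerExp h (centerCoord d N v))

theorem torusParam_add (h : IsTwoStep d N) (v w : EuclideanSpace ℝ (Fin (centerDim d N))) :
    torusParam Γ h (v + w) = torusParam Γ h v * torusParam Γ h w := by
  rw [torusParam, map_add, centerExp_add]
  rfl

theorem torusParam_surjective (h : IsTwoStep d N) : Function.Surjective (torusParam Γ h) :=
  QuotientGroup.mk_surjective.comp
    ((centerExp h).surjective.comp (centerCoord d N).surjective)

theorem isLocalHomeomorph_torusParam [DiscreteTopology Γ] (h : IsTwoStep d N) :
    IsLocalHomeomorph (torusParam Γ h) := by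
  have hd : IsDiscrete (Γ.subgroupOf (Subgroup.center N) : Set (Subgroup.center N)) := by
    rw [isDiscrete_iff_discreteTopology]
    exact DiscreteTopology.of_continuous_injective
      (f := fun z : Γ.subgroupOf (Subgroup.center N) => (⟨z.1.1, z.2⟩ : Γ))
      (by fun_prop) fun z w hzw => Subtype.ext (Subtype.ext (congrArg (fun γ : Γ => (γ : N)) hzw))
  have h1 := ((Γ.subgroupOf (Subgroup.center N)).isQuotientCoveringMap hd).isCoveringMap
  exact h1.isLocalHomeomorph.comp ((centerCoord d N).toHomeomorph.trans (centerExp h)).isLocalHomeomorph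

end CentralTorus

/-! ### The orbits: embedding, tangent spaces and smoothness of the action -/

section Orbits

variable {d : ℕ} {N : Type*} [Group N] [TopologicalSpace N] [IsTopologicalGroup N] [T2Space N]
  [LocallyCompactSpace N] [SimplyConnectedSpace N]
  [ChartedSpace (EuclideanSpace ℝ (Fin d)) N] [LieGroup (𝓡 d) ∞ N]
  {Γ : Subgroup N} [DiscreteTopology Γ] [CompactSpace (LeftQuotient Γ)]
  {B : LinearMap.BilinForm ℝ (GroupLieAlgebra (𝓡 d) N)}
  {V : Submodule ℝ (GroupLieAlgebra (𝓡 d) N)}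

theorem torusHom_torusParam (h : IsTwoStep d N)
    (v : EuclideanSpace ℝ (Fin (centerDim d N))) (n : N) :
    (torusHom Γ B V h (torusParam Γ h v)).1 (LeftQuotient.mk Γ n) =
      par Γ n (centerCoord d N v : EuclideanSpace ℝ (Fin d)) :=
  centralHom_centerExp Γ h _ n

/-- The orbit map is injective because stabilizers are trivial, and a continuous injection of a
compact space into a Hausdorff one is an embedding. -/
theorem isEmbedding_torusHom_apply (h : IsTwoStep d N) (x : LeftQuotient Γ) :
    Topology.IsEmbedding fun t : CentralTorus Γ => (torusHom Γ B V h t).1 x := by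
  have := compactSpace_centralTorus (Γ := Γ) h
  refine (Continuous.isClosedEmbedding ?_ fun t s hts => ?_).isEmbedding
  · have h2 : Continuous fun ψ : LeftQuotient Γ ≃ₜ LeftQuotient Γ =>
      (⟨ψ, ψ.continuous⟩ : C(LeftQuotient Γ, LeftQuotient Γ)) := continuous_induced_dom
    exact (continuous_eval_const (F := C(LeftQuotient Γ, LeftQuotient Γ)) x).comp
      (h2.comp (continuous_subtype_val.comp (continuous_torusHom h)))
  · have h1 : (torusHom Γ B V h (s⁻¹ * t)).1 x = x := by
      rw [map_mul, map_inv]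
      exact (Homeomorph.symm_apply_eq _).mpr hts
    exact (inv_mul_eq_one.mp (eq_one_of_torusHom_apply_eq h h1)).symm

theorem mem_orbit_iff (h : IsTwoStep d N) (hB : B.IsSymm) (hBn : B.Nondegenerate)
    (hV : IsNullComplement B V) {x y : LeftQuotient Γ} :
    y ∈ orbit Γ B V x ↔ ∃ t, (torusHom Γ B V h t).1 x = y := by
  constructor
  · rintro ⟨ψ, rfl⟩
    obtain ⟨t, ht⟩ := (torusEquiv Γ h hB hBn hV).surjective ψ
    exact ⟨t, by rw [← ht]; rfl⟩
  · rintro ⟨t, rfl⟩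
    exact ⟨torusEquiv Γ h hB hBn hV t, rfl⟩

theorem exists_torusHom_apply_eq (h : IsTwoStep d N) (hB : B.IsSymm) (hBn : B.Nondegenerate)
    (hV : IsNullComplement B V) {x y y' : LeftQuotient Γ} (hy : y ∈ orbit Γ B V x)
    (hy' : y' ∈ orbit Γ B V x) : ∃ t, (torusHom Γ B V h t).1 y = y' := by
  obtain ⟨t, rfl⟩ := (mem_orbit_iff h hB hBn hV).mp hy
  obtain ⟨t', rfl⟩ := (mem_orbit_iff h hB hBn hV).mp hy'
  refine ⟨t' * t⁻¹, ?_⟩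
  rw [map_mul, map_inv]
  exact congrArg (torusHom Γ B V h t').1 ((torusHom Γ B V h t).1.symm_apply_apply x)

theorem par_mem_orbit (h : IsTwoStep d N) (hB : B.IsSymm) (hBn : B.Nondegenerate)
    (hV : IsNullComplement B V) {x : LeftQuotient Γ} {n : N}
    (hn : LeftQuotient.mk Γ n ∈ orbit Γ B V x) {z : EuclideanSpace ℝ (Fin d)}
    (hz : z ∈ centerE d N) : par Γ n z ∈ orbit Γ B V x := by
  obtain ⟨t, ht⟩ := (mem_orbit_iff h hB hBn hV).mp hn
  refine (mem_orbit_iff h hB hBn hV).mpr ⟨QuotientGroup.mk (centerExp h ⟨z, hz⟩) * t, ?_⟩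
  rw [map_mul]
  refine (congrArg (centralHom Γ (centerExp h ⟨z, hz⟩)) ht).trans ?_
  exact centralHom_centerExp Γ h ⟨z, hz⟩ n

/-- As the orbit is embedded, its points near `Γ n` come from small elements of the torus, so they
are `par Γ n z` with `z` small and central. An orbit does not return to accumulate on itself. -/
theorem eventually_mem_centerE (h : IsTwoStep d N) (hB : B.IsSymm) (hBn : B.Nondegenerate)
    (hV : IsNullComplement B V) {x : LeftQuotient Γ} {n : N}
    (hn : LeftQuotient.mk Γ n ∈ orbit Γ B V x) {σ : LeftQuotient Γ → EuclideanSpace ℝ (Fin d)}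
    (hσ : ∀ᶠ a in 𝓝 0, σ (par Γ n a) = a) :
    ∀ᶠ y in 𝓝 (LeftQuotient.mk Γ n), y ∈ orbit Γ B V x → σ y ∈ centerE d N := by
  have hc : Continuous fun v : EuclideanSpace ℝ (Fin (centerDim d N)) =>
      (centerCoord d N v : EuclideanSpace ℝ (Fin d)) :=
    continuous_subtype_val.comp (centerCoord d N).continuous
  have h1 : ∀ᶠ v in 𝓝 0, σ (par Γ n (centerCoord d N v : EuclideanSpace ℝ (Fin d))) =
      centerCoord d N v := by
    have h3 := hc.tendsto 0
    rw [map_zero] at h3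
    exact h3.eventually hσ
  have h2 := (isLocalHomeomorph_torusParam Γ h).isOpenMap.image_mem_nhds h1
  have h0 : torusParam Γ h (0 : EuclideanSpace ℝ (Fin (centerDim d N))) = 1 := by
    have h3 := torusParam_add Γ h (0 : EuclideanSpace ℝ (Fin (centerDim d N))) 0
    rw [add_zero] at h3
    exact mul_eq_left.mp h3.symm
  rw [h0, (isEmbedding_torusHom_apply (B := B) (V := V) h (LeftQuotient.mk Γ n)).nhds_eq_comap,
    map_one] at h2
  obtain ⟨W, hW, hWs⟩ := Filter.mem_comap.mp h2
  filter_upwards [hW] with y hy hyo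
  obtain ⟨t, rfl⟩ := exists_torusHom_apply_eq h hB hBn hV hn hyo
  obtain ⟨v, hv, rfl⟩ := hWs hy
  rw [torusHom_torusParam]
  rw [Set.mem_ofPred_eq] at hv
  rw [hv]
  exact (centerCoord d N v).2

/-- In exponential coordinates a curve in the orbit stays in `𝔷` for small times, hence so does its
velocity. Conversely, central vectors are velocities of projected one-parameter groups. -/
theorem mem_tangentVectors_orbit_iff (h : IsTwoStep d N) (hB : B.IsSymm) (hBn : B.Nondegenerate)
    (hV : IsNullComplement B V) {x y : LeftQuotient Γ} (hy : y ∈ orbit Γ B V x)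
    (v : EuclideanSpace ℝ (Fin d)) :
    v ∈ tangentVectors (d := d) (orbit Γ B V x) y ↔ coframe Γ y v ∈ centerE d N := by
  obtain ⟨n, hn⟩ := Quotient.exists_rep y
  have hn' : LeftQuotient.mk Γ n = y := hn
  subst hn'
  clear hn
  constructor
  · rintro ⟨c, hc, hco, hcv⟩
    have hc0 : c 0 = LeftQuotient.mk Γ n := congrArg Bundle.TotalSpace.proj hcv
    have hv : modelDeriv 𝓘(ℝ, ℝ) (𝓡 d) c 0 1 = v :=
      congrArg (fun p : TangentBundle (𝓡 d) (LeftQuotient Γ) =>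
        (show EuclideanSpace ℝ (Fin d) from p.2)) hcv
    obtain ⟨σ, hσs, hσ0, hl, -⟩ := exists_par_inverse (d := d) Γ h n
    have h1 : HasModelDerivAt (𝓡 d) 𝓘(ℝ, EuclideanSpace ℝ (Fin d)) σ (LeftQuotient.mk Γ n)
        ((ContinuousLinearMap.id ℝ _).comp (coframe Γ (LeftQuotient.mk Γ n))) :=
      hasModelDerivAt_of_comp_par h ((hasFDerivAt_id _).congr_of_eventuallyEq hl)
    have h2 := h1.comp (hasModelDerivAt_of_contMDiffAt (hc 0) (by simp)) hc0
    have h3 := (hasModelDerivAt_iff_hasFDerivAt.mp h2).hasDerivAt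
    have h4 : (((ContinuousLinearMap.id ℝ _).comp (coframe Γ (LeftQuotient.mk Γ n))).comp
        (modelDeriv 𝓘(ℝ, ℝ) (𝓡 d) c 0)) 1 = coframe Γ (LeftQuotient.mk Γ n) v := by
      rw [← hv]; rfl
    rw [h4] at h3
    refine mem_centerE_of_hasDerivAt h3 ?_
    have h5 := eventually_mem_centerE h hB hBn hV hy hl
    rw [← hc0] at h5
    filter_upwards [hc.continuous.continuousAt.eventually h5] with s hs using hs (hco s)
  · intro hv
    refine ⟨fun s : ℝ => par Γ n (s • coframe Γ (LeftQuotient.mk Γ n) v),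
      contMDiff_par_smul h n _, fun s => par_mem_orbit h hB hBn hV hy
        ((centerE d N).smul_mem s hv), ?_⟩
    rw [velocity_par_smul h, zero_smul, par_zero]
    exact congrArg (Bundle.TotalSpace.mk (LeftQuotient.mk Γ n)) (frE_coframe Γ _ v)

/-- The exponential map from the center of the Lie algebra onto the identity component of the group
of split isometries. -/
def isometryParam (h : IsTwoStep d N) (hB : B.IsSymm) (hBn : B.Nondegenerate)
    (hV : IsNullComplement B V) (v : EuclideanSpace ℝ (Fin (centerDim d N))) :
    splGroupZero Γ B V :=
  torusEquiv Γ h hB hBn hV (torusParam Γ h v)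

theorem isLocalHomeomorph_isometryParam (h : IsTwoStep d N) (hB : B.IsSymm)
    (hBn : B.Nondegenerate) (hV : IsNullComplement B V) :
    IsLocalHomeomorph (isometryParam (Γ := Γ) h hB hBn hV) :=
  (isHomeomorph_torusEquiv (Γ := Γ) h hB hBn hV).homeomorph.isLocalHomeomorph.comp
    (isLocalHomeomorph_torusParam Γ h)

theorem isometryParam_surjective (h : IsTwoStep d N) (hB : B.IsSymm)
    (hBn : B.Nondegenerate) (hV : IsNullComplement B V) :
    Function.Surjective (isometryParam (Γ := Γ) h hB hBn hV) :=
  (torusEquiv Γ h hB hBn hV).surjective.comp (torusParam_surjective Γ h)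

theorem isometryParam_add (h : IsTwoStep d N) (hB : B.IsSymm)
    (hBn : B.Nondegenerate) (hV : IsNullComplement B V)
    (v w : EuclideanSpace ℝ (Fin (centerDim d N))) :
    isometryParam (Γ := Γ) h hB hBn hV (v + w) =
      isometryParam h hB hBn hV v * isometryParam h hB hBn hV w := by
  rw [isometryParam, torusParam_add, map_mul]
  rfl

theorem isometryParam_apply_mk (h : IsTwoStep d N) (hB : B.IsSymm)
    (hBn : B.Nondegenerate) (hV : IsNullComplement B V)
    (v : EuclideanSpace ℝ (Fin (centerDim d N))) (n : N) :
    (isometryParam (Γ := Γ) h hB hBn hV v).1.1 (LeftQuotient.mk Γ n) =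
      par Γ n (centerCoord d N v : EuclideanSpace ℝ (Fin d)) :=
  torusHom_torusParam (B := B) (V := V) h v n

theorem isEmbedding_splGroupZero_apply (h : IsTwoStep d N) (hB : B.IsSymm)
    (hBn : B.Nondegenerate) (hV : IsNullComplement B V) (x : LeftQuotient Γ) :
    Topology.IsEmbedding fun ψ : splGroupZero Γ B V => ψ.1.1 x := by
  have h1 := (isEmbedding_torusHom_apply (B := B) (V := V) h x).comp
    (isHomeomorph_torusEquiv (Γ := Γ) h hB hBn hV).homeomorph.symm.isEmbedding
  convert h1 using 1
  funext ψ
  obtain ⟨t, rfl⟩ := (isHomeomorph_torusEquiv (Γ := Γ) h hB hBn hV).homeomorph.surjective ψ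
  rw [Function.comp_apply, Homeomorph.symm_apply_apply]
  rfl

variable [ChartedSpace (EuclideanSpace ℝ (Fin (centerDim d N))) (splGroupZero Γ B V)]
  [IsManifold (𝓡 (centerDim d N)) ∞ (splGroupZero Γ B V)]

/-- With local sections of both parametrizations, the action is multiplication in `N` by the
exponential of a central vector. -/
theorem contMDiff_splGroupZero_apply (h : IsTwoStep d N) (hB : B.IsSymm)
    (hBn : B.Nondegenerate) (hV : IsNullComplement B V)
    (hp : IsParametrization (isometryParam (Γ := Γ) h hB hBn hV)) :
    ContMDiff ((𝓡 (centerDim d N)).prod (𝓡 d)) (𝓡 d) ∞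
      (fun p : splGroupZero Γ B V × LeftQuotient Γ => p.1.1.1 p.2) := by
  rintro ⟨ψ, y⟩
  obtain ⟨v, rfl⟩ := isometryParam_surjective h hB hBn hV ψ
  obtain ⟨n, hn⟩ := Quotient.exists_rep y
  have hn' : LeftQuotient.mk Γ n = y := hn
  subst hn'
  clear hn
  obtain ⟨s, hs, -, hr⟩ := hp.exists_section v
  obtain ⟨s', hs', -, -, hr'⟩ := mk_localInverse (d := d) Γ n
  set pt : splGroupZero Γ B V × LeftQuotient Γ := (isometryParam h hB hBn hV v,
    LeftQuotient.mk Γ n)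
  have h1 : ContMDiffAt ((𝓡 (centerDim d N)).prod (𝓡 d)) 𝓘(ℝ, EuclideanSpace ℝ (Fin d)) ∞
      (fun p : splGroupZero Γ B V × LeftQuotient Γ =>
        (centerCoord d N (s p.1) : EuclideanSpace ℝ (Fin d))) pt := by
    have h2 : ContDiff ℝ ∞ fun w : EuclideanSpace ℝ (Fin (centerDim d N)) =>
        (centerCoord d N w : EuclideanSpace ℝ (Fin d)) :=
      ((centerE d N).subtypeL.comp (centerCoord d N).toContinuousLinearMap).contDiff
    exact h2.contMDiff.contMDiffAt.comp pt (hs.comp pt contMDiffAt_fst)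
  have h3 : ContMDiffAt ((𝓡 (centerDim d N)).prod (𝓡 d)) (𝓡 d) ∞
      (fun p : splGroupZero Γ B V × LeftQuotient Γ => s' p.2) pt := hs'.comp pt contMDiffAt_snd
  have h4 : ContMDiffAt ((𝓡 (centerDim d N)).prod (𝓡 d)) (𝓡 d) ∞
      (fun p : splGroupZero Γ B V × LeftQuotient Γ =>
        par Γ (s' p.2) (centerCoord d N (s p.1) : EuclideanSpace ℝ (Fin d))) pt :=
    (mk_contMDiff (d := d) Γ).contMDiffAt.comp pt
      (h3.mul ((contMDiff_gexp (N := N) h).contMDiffAt.comp pt h1))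
  refine h4.congr_of_eventuallyEq ?_
  filter_upwards [continuousAt_fst.eventually hr, continuousAt_snd.eventually hr'] with q hq hq'
  have h5 := isometryParam_apply_mk (Γ := Γ) h hB hBn hV (s q.1) (s' q.2)
  rw [hq, hq'] at h5
  exact h5

/-- In the coordinates `par` the orbit map is the linear inclusion of `𝔷` into `𝔷 ⊕ 𝔳`, with
complement `complE B V`. -/
theorem isSmoothEmbedding_splGroupZero_apply (h : IsTwoStep d N) (hB : B.IsSymm)
    (hBn : B.Nondegenerate) (hV : IsNullComplement B V)
    (hp : IsParametrization (isometryParam (Γ := Γ) h hB hBn hV)) (x : LeftQuotient Γ) :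
    Manifold.IsSmoothEmbedding (𝓡 (centerDim d N)) (𝓡 d) ∞
      (fun ψ : splGroupZero Γ B V => ψ.1.1 x) := by
  refine ⟨⟨complE B V, inferInstance, inferInstance, fun ψ => ?_⟩,
    isEmbedding_splGroupZero_apply h hB hBn hV x⟩
  obtain ⟨v, rfl⟩ := isometryParam_surjective h hB hBn hV ψ
  obtain ⟨n, hn⟩ := Quotient.exists_rep x
  have hn' : LeftQuotient.mk Γ n = x := hn
  subst hn'
  clear hn
  refine hp.isImmersionAtOfComplement (isParametrization_par h n)
    (((centerCoord d N).toLinearEquiv.prodCongr (LinearEquiv.refl ℝ _)).trans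
      (Submodule.prodEquivOfIsCompl _ _
        (isCompl_centerE_complE hB hV))).toContinuousLinearEquiv (fun w => ?_) v
  rw [isometryParam_apply_mk]
  congr 1
  simp

end Orbits

end

end PseudoNil

/-! ### The theorem -/

theorem mainTheorem8 {d : ℕ} {N : Type*} [Group N] [TopologicalSpace N] [IsTopologicalGroup N]
    [T2Space N] [LocallyCompactSpace N] [SimplyConnectedSpace N]
    [ChartedSpace (EuclideanSpace ℝ (Fin d)) N] [LieGroup (𝓡 d) ∞ N]
    (hN : ∀ x y : GroupLieAlgebra (𝓡 d) N,
      ⁅x, y⁆ ∈ LieAlgebra.center ℝ (GroupLieAlgebra (𝓡 d) N))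
    (B : LinearMap.BilinForm ℝ (GroupLieAlgebra (𝓡 d) N)) (hBs : B.IsSymm) (hBn : B.Nondegenerate)
    (V : Submodule ℝ (GroupLieAlgebra (𝓡 d) N)) (hV : IsNullComplement B V)
    (Γ : Subgroup N) [DiscreteTopology Γ] [CompactSpace (LeftQuotient Γ)] :
    -- The torus and the identity component are Lie groups, and `F` is a Lie group isomorphism.
    (∃ (_ : ChartedSpace (EuclideanSpace ℝ (Fin (centerDim d N))) (CentralTorus Γ))
        (_ : LieGroup (𝓡 (centerDim d N)) ∞ (CentralTorus Γ))
        (_ : ChartedSpace (EuclideanSpace ℝ (Fin (centerDim d N))) (splGroupZero Γ B V))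
        (_ : LieGroup (𝓡 (centerDim d N)) ∞ (splGroupZero Γ B V))
        (F : CentralTorus Γ ≃* splGroupZero Γ B V),
      Nonempty (CentralTorus Γ ≃ₜ* (Fin (centerDim d N) → Circle)) ∧
      ContMDiff ((𝓡 (centerDim d N)).prod (𝓡 d)) (𝓡 d) ∞
        (fun p : splGroupZero Γ B V × LeftQuotient Γ => p.1.1.1 p.2) ∧
      (∀ (z : Subgroup.center N) (n : N),
        (F (QuotientGroup.mk z)).1.1 (LeftQuotient.mk Γ n) = LeftQuotient.mk Γ ((z : N) * n)) ∧
      ContMDiff (𝓡 (centerDim d N)) (𝓡 (centerDim d N)) ∞ F ∧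
      ContMDiff (𝓡 (centerDim d N)) (𝓡 (centerDim d N)) ∞ F.symm ∧
      -- The orbits are embedded submanifolds.
      ∀ x : LeftQuotient Γ, Manifold.IsSmoothEmbedding (𝓡 (centerDim d N)) (𝓡 d) ∞
        (fun ψ : splGroupZero Γ B V => ψ.1.1 x)) ∧
    -- The action is free.
    (∀ (ψ : splGroupZero Γ B V) (x : LeftQuotient Γ), ψ.1.1 x = x → ψ = 1) ∧
    -- The orbits are complete, flat and totally geodesic for the Levi-Civita connection.
    (∃ nab : Connection d (LeftQuotient Γ), IsLeviCivita (LeftQuotient.metric Γ B) nab) ∧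
    ∀ nab : Connection d (LeftQuotient Γ), IsLeviCivita (LeftQuotient.metric Γ B) nab →
      ∀ x : LeftQuotient Γ,
        IsTotallyGeodesic nab (orbit Γ B V x) ∧
        IsFlat (LeftQuotient.metric Γ B) nab (orbit Γ B V x) ∧
        IsGeodesicallyComplete nab (orbit Γ B V x) := by
  have h : IsTwoStep d N := isTwoStep_of_lie_mem_center hN
  refine ⟨?_, ?_, ?_, ?_⟩
  · have := compactSpace_centralTorus (Γ := Γ) h
    -- Both groups are charted by the same vector space, through `torusParam` and its composite with
    -- `torusEquiv`; so the isomorphism and its inverse are smooth because they intertwine the two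
    -- parametrizations.
    obtain ⟨csT, lgT, hpT⟩ := exists_lieGroup_of_isLocalHomeomorph
      (isLocalHomeomorph_torusParam Γ h) (torusParam_surjective Γ h) (torusParam_add Γ h)
    obtain ⟨csI, lgI, hpI⟩ := exists_lieGroup_of_isLocalHomeomorph
      (isLocalHomeomorph_isometryParam (Γ := Γ) h hBs hBn hV)
      (isometryParam_surjective h hBs hBn hV) (isometryParam_add h hBs hBn hV)
    refine ⟨csT, lgT, csI, lgI, torusEquiv Γ h hBs hBn hV,
      nonempty_continuousMulEquiv_circle (isLocalHomeomorph_torusParam Γ h)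
        (torusParam_surjective Γ h) (torusParam_add Γ h) finrank_euclideanSpace_fin,
      contMDiff_splGroupZero_apply h hBs hBn hV hpI, fun _ _ => rfl,
      hpT.contMDiff_of_comp (torusParam_surjective Γ h) hpI.contMDiff,
      hpI.contMDiff_of_comp (isometryParam_surjective h hBs hBn hV) ?_,
      isSmoothEmbedding_splGroupZero_apply h hBs hBn hV hpI⟩
    have h1 : (torusEquiv Γ h hBs hBn hV).symm ∘ isometryParam h hBs hBn hV = torusParam Γ h :=
      funext fun v => (torusEquiv Γ h hBs hBn hV).symm_apply_apply (torusParam Γ h v)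
    rw [h1]
    exact hpT.contMDiff
  · intro ψ x hx
    obtain ⟨t, rfl⟩ := (torusEquiv Γ h hBs hBn hV).surjective ψ
    rw [eq_one_of_torusHom_apply_eq (B := B) (V := V) h hx, map_one]
  · obtain ⟨C, hC⟩ := exists_isChristoffel (N := N) (b := formE N B) hBs hBn
    exact ⟨frameConnection h C, isLeviCivita_frameConnection h hC⟩
  · intro nab hnab x
    have hS := fun y (hy : y ∈ orbit Γ B V x) =>
      mem_tangentVectors_orbit_iff h hBs hBn hV hy
    have hSz := fun n (hn : LeftQuotient.mk Γ n ∈ orbit Γ B V x) z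
      (hz : z ∈ centerE d N) => par_mem_orbit h hBs hBn hV hn hz
    exact ⟨isTotallyGeodesic_of_tangentVectors h hBs hBn hnab hS hSz,
      isFlat_of_tangentVectors h hBs hBn hnab hS,
      isGeodesicallyComplete_of_tangentVectors h hBs hBn hnab hS hSz⟩
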